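/- Let $R$ be a commutative ring. All modules and algebras are over $R$, $\otimes=\otimes_R$, and $N^\vee=\operatorname{Hom}_R(N,R)$. A ternary quadratic module $(M,I,q)$ consists of a finitely generated projective module $M$ of constant rank $3$, an invertible module $I$ and a quadratic map $q:M\to I$; an isometry $(M,I,q)\to(M',I',q')$ is a pair of isomorphisms $f:M\to M'$, $g:I\to I'$ with $q'\circ f=g\circ q$. Let $L[I]=\bigoplus_{d\in\mathbb Z}I^{\otimes d}$ (with $I^{\otimes(-d)}=(I^\vee)^{\otimes d}$). The even Clifford algebra $C^0(M,I,q)$ is the degree-$0$ part of $(\operatorname{Ten}(M)\otimes L[I])/(x\otimes x\otimes 1-1\otimes q(x):x\in M)$, where $M$ has degree $1$ and $I$ has degree $2$. A quaternion ring is an $R$-algebra isomorphic to $C^0(M,I,q)$ for some ternary quadratic module $(M,I,q)$. A parity factorization on a quaternion ring $B$ is an isomorphism $p:P^{\otimes2}\otimes Q\to\bigwedge^4B$ with $P,Q$ invertible modules; an isomorphism $(B,P,Q,p)\to(B',P',Q',p')$ consists of an algebra isomorphism $B\to B'$ and module isomorphisms $P\to P'$, $Q\to Q'$ that carry $p$ to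 $p'$. Theorem. For every commutative ring $R$ there is a bijection from the set of isometry classes of ternary quadratic modules over $R$ to the set of isomorphism classes of quaternion rings over $R$ equipped with a parity factorization, with the following properties. (a) The class of $(M,I,q)$ maps to the class of $C^0(M,I,q)$ with its canonical parity factorization $$\bigl(\textstyle\bigwedge^3M\otimes(I^\vee)^{\otimes2}\bigr)^{\otimes2}\otimes I\;\xrightarrow{\sim}\;\textstyle\bigwedge^4C^0(M,I,q),$$ namely the composite of the contraction $I^\vee\otimes I\cong R$ with the inverse of the isomorphism $\bigwedge^4C^0(M,I,q)\cong(\bigwedge^3M)^{\otimes2}\otimes(I^\vee)^{\otimes3}$ that takes $1\wedge xx'f\wedge yy'g\wedge zz'h$ to $\bigl((x\wedge x'\wedge y')\otimes(y\wedge z\wedge z')-(x\wedge x'\wedge y)\otimes(y'\wedge z\wedge z')\bigr)\otimes f\otimes g\otimes h$ for $x,x',y,y',z,z'\in M$ and $f,g,h\in I^\vee$. (b) Every quaternion ring $B$ has a unique quadratic map $\phi_B:\bigwedge^2(B/R)\to\bigwedge^4B$ with $\phi_B(x\wedge y)=1\wedge x\wedge y\wedge xy$ for all $x,y\in B$ (the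 canonical exterior form). The inverse bijection takes the class of $(B,P,Q,p)$ to the class of the ternary quadratic module $\bigl(\bigwedge^2(B/R)\otimes P^\vee,\,Q,\,\phi_B\otimes p^*\bigr)$. Here $p^*:(P^\vee)^{\otimes2}\cong(\bigwedge^4B)^\vee\otimes Q=\operatorname{Hom}_R(\bigwedge^4B,Q)$ is the isomorphism dual to $p$, and $\phi_B\otimes p^*$ is the unique quadratic map with $(\phi_B\otimes p^*)(\omega\otimes\xi)=p^*(\xi\otimes\xi)(\phi_B(\omega))$ for all $\omega\in\bigwedge^2(B/R)$ and $\xi\in P^\vee$. (c) The bijection is functorial in $R$: for every ring homomorphism $R\to S$, the base change to $S$ of a quaternion ring with a parity factorization over $R$ is a quaternion ring with a parity factorization over $S$, and the bijections over $R$ and over $S$ commute with the base change of both kinds of objects. -/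

import Mathlib

open scoped TensorProduct

universe u

namespace TernaryQuaternion

noncomputable section

/-! ### The Clifford algebra of a quadratic module with values in an invertible module -/

section Clifford

variable {R : Type u} [CommRing R]
variable (I : Type u) [AddCommGroup I] [Module R I]
variable {M : Type u} [AddCommGroup M] [Module R M]

/-- The relations `x · f = f(x)`, for `x ∈ I` and `f ∈ I^∨`, in the symmetric algebra
of `I ⊕ I^∨`. -/
def contractionIdeal : Ideal (SymmetricAlgebra R (I × Module.Dual R I)) :=
  Ideal.span {z | ∃ (x : I) (f : Module.Dual R I),
    z = SymmetricAlgebra.ι R (I × Module.Dual R I) (x, 0) *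
          SymmetricAlgebra.ι R (I × Module.Dual R I) (0, f) -
        algebraMap R (SymmetricAlgebra R (I × Module.Dual R I)) (f x)}

/-- The Rees algebra `L[I] = ⨁_{d ∈ ℤ} I^{⊗ d}` of an invertible module `I` (with
`I^{⊗ (-d)} = (I^∨)^{⊗ d}`), presented as the commutative algebra generated by `I` and `I^∨`
with the contractions `x · f = f(x)` as relations. As `I` is invertible, the products of `d`
elements of `I` (or of `I^∨`) span a copy of `I^{⊗ d}` (or of `I^{⊗ (-d)}`). -/
def ReesAlg : Type u :=
  SymmetricAlgebra R (I × Module.Dual R I) ⧸ contractionIdeal (R := R) I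

instance : CommRing (ReesAlg (R := R) I) := Ideal.Quotient.commRing (contractionIdeal (R := R) I)

instance : Algebra R (ReesAlg (R := R) I) := Ideal.Quotient.algebra R

/-- The quotient map `Sym(I ⊕ I^∨) → L[I]`. -/
def reesMk : SymmetricAlgebra R (I × Module.Dual R I) →ₐ[R] ReesAlg (R := R) I :=
  Ideal.Quotient.mkₐ R (contractionIdeal (R := R) I)

/-- The inclusion `I → L[I]`, in degree `1`. -/
def reesPos : I →ₗ[R] ReesAlg (R := R) I :=
  (reesMk I).toLinearMap ∘ₗ
    SymmetricAlgebra.ι R (I × Module.Dual R I) ∘ₗ LinearMap.inl R I (Module.Dual R I)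

/-- The inclusion `I^∨ → L[I]`, in degree `-1`. -/
def reesNeg : Module.Dual R I →ₗ[R] ReesAlg (R := R) I :=
  (reesMk I).toLinearMap ∘ₗ
    SymmetricAlgebra.ι R (I × Module.Dual R I) ∘ₗ LinearMap.inr R I (Module.Dual R I)

variable {I}

/-- The relations `x ⊗ x ⊗ 1 = 1 ⊗ q(x)`, for `x ∈ M`, in `Ten(M) ⊗ L[I]`. -/
inductive CliffRel (q : QuadraticMap R M I) :
    TensorAlgebra R M ⊗[R] ReesAlg (R := R) I →
      TensorAlgebra R M ⊗[R] ReesAlg (R := R) I → Prop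
  | sq (x : M) : CliffRel q ((TensorAlgebra.ι R x * TensorAlgebra.ι R x) ⊗ₜ[R] 1)
      (1 ⊗ₜ[R] reesPos I (q x))

/-- The Clifford algebra `C(M,I,q)`: the quotient of `Ten(M) ⊗ L[I]` by the two-sided ideal
generated by the elements `x ⊗ x ⊗ 1 - 1 ⊗ q(x)`. -/
def Cliff (q : QuadraticMap R M I) : Type u := RingQuot (CliffRel q)

instance (q : QuadraticMap R M I) : Ring (Cliff q) :=
  @RingQuot.instRing (TensorAlgebra R M ⊗[R] ReesAlg (R := R) I)
    Algebra.TensorProduct.instRing (CliffRel q)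

instance (q : QuadraticMap R M I) : Algebra R (Cliff q) :=
  RingQuot.instAlgebra (CliffRel q)

/-- The quotient map `Ten(M) ⊗ L[I] → C(M,I,q)`. -/
def cliffMk (q : QuadraticMap R M I) :
    TensorAlgebra R M ⊗[R] ReesAlg (R := R) I →ₐ[R] Cliff q :=
  RingQuot.mkAlgHom R (CliffRel q)

/-- The map `M → C(M,I,q)`. -/
def cliffVec (q : QuadraticMap R M I) : M →ₗ[R] Cliff q :=
  (cliffMk q).toLinearMap ∘ₗ
    (Algebra.TensorProduct.includeLeft :
      TensorAlgebra R M →ₐ[R] TensorAlgebra R M ⊗[R] ReesAlg (R := R) I).toLinearMap ∘ₗ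
    TensorAlgebra.ι R

/-- The map `L[I] → C(M,I,q)`. -/
def cliffRees (q : QuadraticMap R M I) : ReesAlg (R := R) I →ₐ[R] Cliff q :=
  (cliffMk q).comp
    (Algebra.TensorProduct.includeRight :
      ReesAlg (R := R) I →ₐ[R] TensorAlgebra R M ⊗[R] ReesAlg (R := R) I)

/-- The map `I → C(M,I,q)`. -/
def cliffPos (q : QuadraticMap R M I) : I →ₗ[R] Cliff q :=
  (cliffRees q).toLinearMap ∘ₗ reesPos I

/-- The map `I^∨ → C(M,I,q)`. -/
def cliffNeg (q : QuadraticMap R M I) : Module.Dual R I →ₗ[R] Cliff q :=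
  (cliffRees q).toLinearMap ∘ₗ reesNeg I

/-- The span of the products of `a` elements of `M`, `b` elements of `I` and `c` elements
of `I^∨`. -/
def cliffPiece (q : QuadraticMap R M I) (a b c : ℕ) : Submodule R (Cliff q) :=
  LinearMap.range (cliffVec q) ^ a *
    (LinearMap.range (cliffPos q) ^ b * LinearMap.range (cliffNeg q) ^ c)

/-- The part of degree `n` of the Clifford algebra, where `M`, `I`, `I^∨` have
degrees `1`, `2`, `-2`. -/
def cliffDegree (q : QuadraticMap R M I) (n : ℤ) : Submodule R (Cliff q) :=
  ⨆ (a : ℕ) (b : ℕ) (c : ℕ) (_ : (a : ℤ) + 2 * b - 2 * c = n), cliffPiece q a b c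

theorem includeRight_commute {A L : Type u} [Ring A] [Algebra R A] [CommRing L] [Algebra R L]
    (l : L) (z : A ⊗[R] L) : Commute ((1 : A) ⊗ₜ[R] l) z := by
  induction z with
  | zero => exact Commute.zero_right _
  | add x y hx hy => exact hx.add_right hy
  | tmul t m => exact (Commute.one_left t).tmul (Commute.all l m)

theorem cliffRees_commute (q : QuadraticMap R M I) (l : ReesAlg (R := R) I) (z : Cliff q) :
    Commute (cliffRees q l) z := by
  obtain ⟨z, rfl⟩ : ∃ w, cliffMk q w = z := RingQuot.mkAlgHom_surjective R (CliffRel q) z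
  have := includeRight_commute (R := R) (A := TensorAlgebra R M) l z
  exact this.map (cliffMk q)

theorem cliffPiece_mul (q : QuadraticMap R M I) (a b c a' b' c' : ℕ) :
    cliffPiece q a b c * cliffPiece q a' b' c' ≤ cliffPiece q (a + a') (b + b') (c + c') := by
  have key : ∀ (N : Submodule R (Cliff q)) (f : Submodule R (Cliff q)),
      f ≤ LinearMap.range (cliffRees q).toLinearMap → Commute f N := by
    intro N f hf
    apply le_antisymm
    · rw [Submodule.mul_le]
      intro x hx y hy
      obtain ⟨l, rfl⟩ := hf hx
      rw [AlgHom.toLinearMap_apply, (cliffRees_commute q l y).eq]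
      exact Submodule.mul_mem_mul hy hx
    · rw [Submodule.mul_le]
      intro y hy x hx
      obtain ⟨l, rfl⟩ := hf hx
      rw [AlgHom.toLinearMap_apply, ← (cliffRees_commute q l y).eq]
      exact Submodule.mul_mem_mul hx hy
  have hp : ∀ N, Commute (LinearMap.range (cliffPos q)) N :=
    fun N => key N _ (LinearMap.range_comp_le_range _ _)
  have hn : ∀ N, Commute (LinearMap.range (cliffNeg q)) N :=
    fun N => key N _ (LinearMap.range_comp_le_range _ _)
  simp only [cliffPiece, pow_add]
  generalize LinearMap.range (cliffVec q) = V at *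
  generalize LinearMap.range (cliffPos q) = W at *
  generalize LinearMap.range (cliffNeg q) = W' at *
  refine le_of_eq ?_
  have h1 : W ^ b * W' ^ c * V ^ a' = V ^ a' * (W ^ b * W' ^ c) :=
    (((hp _).pow_left b).mul_left ((hn _).pow_left c)).eq
  have h2 : W' ^ c * W ^ b' = W ^ b' * W' ^ c := ((hn _).pow_left c).eq
  calc V ^ a * (W ^ b * W' ^ c) * (V ^ a' * (W ^ b' * W' ^ c'))
      = V ^ a * (W ^ b * W' ^ c * V ^ a') * (W ^ b' * W' ^ c') := by simp only [mul_assoc]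
    _ = V ^ a * V ^ a' * (W ^ b * (W' ^ c * W ^ b') * W' ^ c') := by
        rw [h1]; simp only [mul_assoc]
    _ = _ := by rw [h2]; simp only [mul_assoc]

theorem cliffPiece_le (q : QuadraticMap R M I) {a b c : ℕ} {n : ℤ}
    (h : (a : ℤ) + 2 * b - 2 * c = n) : cliffPiece q a b c ≤ cliffDegree q n :=
  le_iSup_of_le a <| le_iSup_of_le b <| le_iSup_of_le c <| le_iSup_of_le h le_rfl

theorem cliffDegree_mul (q : QuadraticMap R M I) (m n : ℤ) :
    cliffDegree q m * cliffDegree q n ≤ cliffDegree q (m + n) := by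
  conv_lhs => unfold cliffDegree
  simp only [Submodule.iSup_mul, Submodule.mul_iSup, iSup_le_iff]
  intro a b c h a' b' c' h'
  exact (cliffPiece_mul q _ _ _ _ _ _).trans (cliffPiece_le q (by push_cast; omega))

/-- The even Clifford algebra `C⁰(M,I,q)`: the subalgebra of `C(M,I,q)` of the elements
of degree `0`. -/
def evenClifford (q : QuadraticMap R M I) : Subalgebra R (Cliff q) :=
  (cliffDegree q 0).toSubalgebra
    (cliffPiece_le q (a := 0) (b := 0) (c := 0) (by simp) (by
      simp only [cliffPiece, pow_zero, mul_one]; exact Submodule.one_le.mp le_rfl))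
    (fun x y hx hy => by simpa using cliffDegree_mul q 0 0 (Submodule.mul_mem_mul hx hy))

/-- The element `x y f` of `C⁰(M,I,q)`, for `x, y ∈ M` and `f ∈ I^∨`. -/
def evenMk (q : QuadraticMap R M I) (x y : M) (f : Module.Dual R I) : evenClifford q :=
  ⟨cliffVec q x * cliffVec q y * cliffNeg q f,
    cliffPiece_le q (a := 2) (b := 0) (c := 1) (by norm_num) (by
      simp only [cliffPiece, pow_zero, one_mul, pow_one, pow_two]
      exact Submodule.mul_mem_mul
        (Submodule.mul_mem_mul (LinearMap.mem_range_self _ _) (LinearMap.mem_range_self _ _))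
        (LinearMap.mem_range_self _ _))⟩

end Clifford

/-! ### Base change of quadratic maps -/

section BaseChange

variable {R : Type u} [CommRing R]
variable {M : Type u} [AddCommGroup M] [Module R M]
variable {I : Type u} [AddCommGroup I] [Module R I]

theorem exists_bilinMap [Module.Projective R M] (q : QuadraticMap R M I) :
    ∃ b : LinearMap.BilinMap R M I, b.toQuadraticMap = q := by
  obtain ⟨s, hs⟩ := Module.projective_def'.mp (inferInstance : Module.Projective R M)
  obtain ⟨b, hb⟩ := LinearMap.BilinMap.toQuadraticMap_surjective
    (q.comp (Finsupp.linearCombination R (id : M → M)))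
  refine ⟨b.compl₁₂ s s, ?_⟩
  ext x
  have h1 := congrArg (fun Q => Q (s x)) hb
  have h2 := LinearMap.congr_fun hs x
  simp only [QuadraticMap.comp_apply] at h1
  simp only [LinearMap.comp_apply, LinearMap.id_apply] at h2
  rw [h2] at h1
  simpa using h1

variable (S : Type u) [CommRing S] [Algebra R S]

theorem exists_quadraticBaseChange [Module.Projective R M] (q : QuadraticMap R M I) :
    ∃ q' : QuadraticMap S (S ⊗[R] M) (S ⊗[R] I),
      ∀ (s : S) (x : M), q' (s ⊗ₜ[R] x) = (s * s) ⊗ₜ[R] q x := by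
  obtain ⟨b, rfl⟩ := exists_bilinMap q
  exact ⟨(LinearMap.BilinMap.baseChange S b).toQuadraticMap, fun s x => by simp⟩

/-- The base change `q_S : S ⊗ M → S ⊗ I` of a quadratic map, i.e. the unique quadratic map
over `S` with `q_S(s ⊗ x) = s² ⊗ q(x)`. -/
def quadraticBaseChange [Module.Projective R M] (q : QuadraticMap R M I) :
    QuadraticMap S (S ⊗[R] M) (S ⊗[R] I) :=
  (exists_quadraticBaseChange S q).choose

theorem quadraticBaseChange_tmul [Module.Projective R M] (q : QuadraticMap R M I)
    (s : S) (x : M) : quadraticBaseChange S q (s ⊗ₜ[R] x) = (s * s) ⊗ₜ[R] q x :=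
  (exists_quadraticBaseChange S q).choose_spec s x

/-- The canonical `R`-linear map `⋀ⁿ_R B → ⋀ⁿ_S (S ⊗ B)`,
`x₁ ∧ ⋯ ∧ xₙ ↦ (1 ⊗ x₁) ∧ ⋯ ∧ (1 ⊗ xₙ)`. -/
def wedgeBaseChange (n : ℕ) (B : Type u) [AddCommGroup B] [Module R B] :
    ⋀[R]^n B →ₗ[R] ⋀[S]^n (S ⊗[R] B) :=
  exteriorPower.alternatingMapLinearEquiv
    { toFun := fun v => exteriorPower.ιMulti S n (fun i => (1 : S) ⊗ₜ[R] v i)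
      map_update_add' := fun v i x y => by
        have h : ∀ z : B, (fun j => (1 : S) ⊗ₜ[R] Function.update v i z j) =
            Function.update (fun j => (1 : S) ⊗ₜ[R] v j) i ((1 : S) ⊗ₜ[R] z) := fun z => by
          ext j; by_cases hj : j = i
          · subst hj; simp
          · simp [hj]
        simp only [h, TensorProduct.tmul_add, AlternatingMap.map_update_add]
      map_update_smul' := fun v i c x => by
        have h : ∀ z : B, (fun j => (1 : S) ⊗ₜ[R] Function.update v i z j) =
            Function.update (fun j => (1 : S) ⊗ₜ[R] v j) i ((1 : S) ⊗ₜ[R] z) := fun z => by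
          ext j; by_cases hj : j = i
          · subst hj; simp
          · simp [hj]
        have h2 : (1 : S) ⊗ₜ[R] (c • x) = (algebraMap R S c) • ((1 : S) ⊗ₜ[R] x) := by
          rw [algebraMap_smul, TensorProduct.tmul_smul]
        simp only [h, h2]
        rw [AlternatingMap.map_update_smul, algebraMap_smul]
      map_eq_zero_of_eq' := fun v i j hv hij =>
        AlternatingMap.map_eq_zero_of_eq _ _ (by simp [hv]) hij }

theorem wedgeBaseChange_ιMulti (n : ℕ) (B : Type u) [AddCommGroup B] [Module R B]
    (v : Fin n → B) : wedgeBaseChange S n B (exteriorPower.ιMulti R n v) =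
      exteriorPower.ιMulti S n (fun i => (1 : S) ⊗ₜ[R] v i) := by
  simp [wedgeBaseChange]

end BaseChange

/-! ### Ternary quadratic modules -/

/-- The condition on the modules in a ternary quadratic module `(M,I,q)`: `M` is finitely
generated projective of constant rank `3`, and `I` is invertible. -/
structure IsTernary (R : Type u) [CommRing R] (M I : Type u) [AddCommGroup M] [Module R M]
    [AddCommGroup I] [Module R I] : Prop where
  finite : Module.Finite R M
  projective : Module.Projective R M
  rank_eq : ∀ 𝔭 : PrimeSpectrum R, Module.rankAtStalk M 𝔭 = 3
  invertible : Module.Invertible R I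

/-- A ternary quadratic module `(M,I,q)` over `R`. -/
structure TernaryModule (R : Type u) [CommRing R] where
  M : Type u
  I : Type u
  [addCommGroupM : AddCommGroup M]
  [moduleM : Module R M]
  [addCommGroupI : AddCommGroup I]
  [moduleI : Module R I]
  isTernary : IsTernary R M I
  q : QuadraticMap R M I

attribute [instance] TernaryModule.addCommGroupM TernaryModule.moduleM
  TernaryModule.addCommGroupI TernaryModule.moduleI

namespace TernaryModule

variable {R : Type u} [CommRing R]

/-- `(M,I,q)` and `(M',I',q')` are isometric: there are isomorphisms `f : M → M'` and
`g : I → I'` with `q'(f(x)) = g(q(x))`. -/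
def Isometric (N N' : TernaryModule R) : Prop :=
  ∃ (f : N.M ≃ₗ[R] N'.M) (g : N.I ≃ₗ[R] N'.I), ∀ x, N'.q (f x) = g (N.q x)

instance isometricSetoid (R : Type u) [CommRing R] : Setoid (TernaryModule R) where
  r := Isometric
  iseqv :=
    { refl := fun N => ⟨.refl R _, .refl R _, fun _ => rfl⟩
      symm := by
        rintro N N' ⟨f, g, h⟩
        exact ⟨f.symm, g.symm, fun x => by rw [LinearEquiv.eq_symm_apply, ← h]; simp⟩
      trans := by
        rintro N N' N'' ⟨f, g, h⟩ ⟨f', g', h'⟩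
        exact ⟨f.trans f', g.trans g', fun x => by simp [h, h']⟩ }

instance (N : TernaryModule R) : Module.Projective R N.M := N.isTernary.projective

/-- The base change of a ternary quadratic module. -/
def baseChange (N : TernaryModule R) (S : Type u) [CommRing S] [Algebra R S] :
    TernaryModule S where
  M := S ⊗[R] N.M
  I := S ⊗[R] N.I
  isTernary :=
    have := N.isTernary.finite
    have := N.isTernary.invertible
    { finite := inferInstance
      projective := inferInstance
      rank_eq := fun 𝔭 => by
        rw [Module.rankAtStalk_baseChange]; exact N.isTernary.rank_eq _
      invertible := inferInstance }
  q := quadraticBaseChange S N.q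

end TernaryModule

/-- The set of isometry classes of ternary quadratic modules over `R`. -/
abbrev TernaryClass (R : Type u) [CommRing R] : Type (u + 1) :=
  Quotient (TernaryModule.isometricSetoid R)

/-! ### Quaternion rings with a parity factorization -/

/-- An `R`-algebra is a quaternion ring if it is isomorphic to the even Clifford algebra of a
ternary quadratic module. -/
def IsQuaternionRing (R : Type u) [CommRing R] (B : Type u) [Ring B] [Algebra R B] : Prop :=
  ∃ N : TernaryModule R, Nonempty (B ≃ₐ[R] evenClifford N.q)

/-- A quaternion ring `B` over `R` equipped with a parity factorization
`p : P^{⊗2} ⊗ Q ≅ ⋀⁴ B`, where `P` and `Q` are invertible modules. -/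
structure ParityRing (R : Type u) [CommRing R] where
  B : Type u
  [ringB : Ring B]
  [algebraB : Algebra R B]
  isQuaternionRing : IsQuaternionRing R B
  P : Type u
  Q : Type u
  [addCommGroupP : AddCommGroup P]
  [moduleP : Module R P]
  [addCommGroupQ : AddCommGroup Q]
  [moduleQ : Module R Q]
  invertibleP : Module.Invertible R P
  invertibleQ : Module.Invertible R Q
  p : (P ⊗[R] P) ⊗[R] Q ≃ₗ[R] ⋀[R]^4 B

attribute [instance] ParityRing.ringB ParityRing.algebraB ParityRing.addCommGroupP
  ParityRing.moduleP ParityRing.addCommGroupQ ParityRing.moduleQ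
  ParityRing.invertibleP ParityRing.invertibleQ

namespace ParityRing

variable {R : Type u} [CommRing R]

/-- An isomorphism of quaternion rings with parity factorizations: an isomorphism of algebras
`B ≅ B'` with isomorphisms `P ≅ P'` and `Q ≅ Q'`, compatible with `p` and `p'`. -/
def Isomorphic (X X' : ParityRing R) : Prop :=
  ∃ (ψ : X.B ≃ₐ[R] X'.B) (f : X.P ≃ₗ[R] X'.P) (g : X.Q ≃ₗ[R] X'.Q),
    ∀ (a b : X.P) (c : X.Q),
      X'.p ((f a ⊗ₜ[R] f b) ⊗ₜ[R] g c) =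
        exteriorPower.map 4 ψ.toLinearMap (X.p ((a ⊗ₜ[R] b) ⊗ₜ[R] c))

instance isomorphicSetoid (R : Type u) [CommRing R] : Setoid (ParityRing R) where
  r := Isomorphic
  iseqv :=
    { refl := fun X => ⟨.refl, .refl R _, .refl R _, fun a b c => by
        have : (AlgEquiv.refl : X.B ≃ₐ[R] X.B).toLinearMap = LinearMap.id := rfl
        simp [this, exteriorPower.map_id]⟩
      symm := by
        rintro X X' ⟨ψ, f, g, h⟩
        refine ⟨ψ.symm, f.symm, g.symm, fun a b c => ?_⟩
        have h1 := h (f.symm a) (f.symm b) (g.symm c)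
        simp only [LinearEquiv.apply_symm_apply] at h1
        have h2 : ψ.symm.toLinearMap ∘ₗ ψ.toLinearMap = LinearMap.id := by ext; simp
        rw [h1, ← LinearMap.comp_apply, ← exteriorPower.map_comp, h2, exteriorPower.map_id]
        rfl
      trans := by
        rintro X X' X'' ⟨ψ, f, g, h⟩ ⟨ψ', f', g', h'⟩
        refine ⟨ψ.trans ψ', f.trans f', g.trans g', fun a b c => ?_⟩
        have h2 : (ψ.trans ψ').toLinearMap = ψ'.toLinearMap ∘ₗ ψ.toLinearMap := rfl
        simp only [LinearEquiv.trans_apply]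
        rw [h', h, h2, exteriorPower.map_comp]
        rfl }

end ParityRing

/-- The set of isomorphism classes of quaternion rings over `R` equipped with a parity
factorization. -/
abbrev ParityClass (R : Type u) [CommRing R] : Type (u + 1) :=
  Quotient (ParityRing.isomorphicSetoid R)

/-! ### From ternary quadratic modules to quaternion rings -/

namespace TernaryModule

variable {R : Type u} [CommRing R] (N : TernaryModule R)

/-- The module `⋀³ M ⊗ (I^∨)^{⊗2}`. -/
abbrev parityModule : Type u :=
  ⋀[R]^3 N.M ⊗[R] (Module.Dual R N.I ⊗[R] Module.Dual R N.I)

/-- The element `(x ∧ y ∧ z) ⊗ (f ⊗ g)` of `⋀³ M ⊗ (I^∨)^{⊗2}`. -/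
def parityMk (x y z : N.M) (f g : Module.Dual R N.I) : N.parityModule :=
  exteriorPower.ιMulti R 3 ![x, y, z] ⊗ₜ[R] (f ⊗ₜ[R] g)

/-- `p` is the canonical parity factorization
`(⋀³ M ⊗ (I^∨)^{⊗2})^{⊗2} ⊗ I ≅ ⋀⁴ C⁰(M,I,q)`, i.e. the composite of the canonical
isomorphisms
* `⋀⁴ C⁰ ≅ ⋀³ (C⁰/R) ≅ ⋀³ (⋀² M ⊗ I^∨)`, which takes `1 ∧ xx'f ∧ yy'g ∧ zz'h` to
  `(x ∧ x' ⊗ f) ∧ (y ∧ y' ⊗ g) ∧ (z ∧ z' ⊗ h)`,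
* `⋀³ (⋀² M ⊗ I^∨) ≅ (⋀³ M)^{⊗2} ⊗ (I^∨)^{⊗3}`, which takes this element to
  `((x ∧ x' ∧ y') ⊗ (y ∧ z ∧ z') - (x ∧ x' ∧ y) ⊗ (y' ∧ z ∧ z')) ⊗ f ⊗ g ⊗ h`,
* the contraction `d ⊗ t ↦ d(t)` of `(I^∨)^{⊗4} ⊗ I` to `(I^∨)^{⊗3}`. -/
def IsCanonicalParity
    (p : (N.parityModule ⊗[R] N.parityModule) ⊗[R] N.I ≃ₗ[R] ⋀[R]^4 (evenClifford N.q)) :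
    Prop :=
  ∀ (x x' y y' z z' : N.M) (f g h d : Module.Dual R N.I) (t : N.I),
    p ((N.parityMk x x' y' f g ⊗ₜ[R] N.parityMk y z z' h d) ⊗ₜ[R] t) -
      p ((N.parityMk x x' y f g ⊗ₜ[R] N.parityMk y' z z' h d) ⊗ₜ[R] t) =
    d t • exteriorPower.ιMulti R 4
      ![1, evenMk N.q x x' f, evenMk N.q y y' g, evenMk N.q z z' h]

/-- The quaternion ring `C⁰(M,I,q)`, with a parity factorization
`(⋀³ M ⊗ (I^∨)^{⊗2})^{⊗2} ⊗ I ≅ ⋀⁴ C⁰(M,I,q)`. -/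
def toParityRing (hP : Module.Invertible R N.parityModule)
    (p : (N.parityModule ⊗[R] N.parityModule) ⊗[R] N.I ≃ₗ[R] ⋀[R]^4 (evenClifford N.q)) :
    ParityRing R where
  B := evenClifford N.q
  isQuaternionRing := ⟨N, ⟨.refl⟩⟩
  P := N.parityModule
  Q := N.I
  invertibleP := hP
  invertibleQ := N.isTernary.invertible
  p := p

end TernaryModule

/-! ### From quaternion rings to ternary quadratic modules -/

/-- The quotient module `B/R`. -/
abbrev ModScalars (R B : Type u) [CommRing R] [Ring B] [Algebra R B] : Type u :=
  B ⧸ LinearMap.range (Algebra.linearMap R B)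

/-- `φ` is the canonical exterior form of `B`: the quadratic map `⋀²(B/R) → ⋀⁴ B` with
`φ(x ∧ y) = 1 ∧ x ∧ y ∧ xy`. -/
def IsCanonicalExteriorForm (R B : Type u) [CommRing R] [Ring B] [Algebra R B]
    (φ : QuadraticMap R (⋀[R]^2 (ModScalars R B)) (⋀[R]^4 B)) : Prop :=
  ∀ x y : B,
    φ (exteriorPower.ιMulti R 2 ![Submodule.Quotient.mk x, Submodule.Quotient.mk y]) =
      exteriorPower.ιMulti R 4 ![1, x, y, x * y]

namespace ParityRing

variable {R : Type u} [CommRing R] (X : ParityRing R)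

/-- The module `⋀²(B/R) ⊗ P^∨`. -/
abbrev twistModule : Type u := ⋀[R]^2 (ModScalars R X.B) ⊗[R] Module.Dual R X.P

/-- The map `p^*(ξ ⊗ ξ') : ⋀⁴ B → Q` defined by `ξ, ξ' ∈ P^∨`, i.e. the composite of `p⁻¹`
with the contraction `P ⊗ P ⊗ Q → Q`, `a ⊗ b ⊗ c ↦ ξ(a) ξ'(b) c`; so `p^*` is the dual
isomorphism `(P^∨)^{⊗2} ≅ (⋀⁴ B)^∨ ⊗ Q = Hom(⋀⁴ B, Q)`. -/
def dualParity (ξ ξ' : Module.Dual R X.P) : ⋀[R]^4 X.B →ₗ[R] X.Q :=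
  (TensorProduct.lid R X.Q).toLinearMap ∘ₗ
    LinearMap.rTensor X.Q (LinearMap.mul' R R ∘ₗ TensorProduct.map ξ ξ') ∘ₗ
      X.p.symm.toLinearMap

/-- `Ψ` is the twist `φ ⊗ p^* : ⋀²(B/R) ⊗ P^∨ → ⋀⁴ B ⊗ ((⋀⁴ B)^∨ ⊗ Q) ≅ Q` of the quadratic
map `φ : ⋀²(B/R) → ⋀⁴ B` by the quadratic map `ξ ↦ p^*(ξ ⊗ ξ)` on `P^∨`. -/
def IsTwist (φ : QuadraticMap R (⋀[R]^2 (ModScalars R X.B)) (⋀[R]^4 X.B))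
    (Ψ : QuadraticMap R X.twistModule X.Q) : Prop :=
  ∀ (ω : ⋀[R]^2 (ModScalars R X.B)) (ξ : Module.Dual R X.P),
    Ψ (ω ⊗ₜ[R] ξ) = X.dualParity ξ ξ (φ ω)

/-- A quadratic map `⋀²(B/R) ⊗ P^∨ → Q` as a ternary quadratic module. -/
def toTernaryModule (h : IsTernary R X.twistModule X.Q)
    (Ψ : QuadraticMap R X.twistModule X.Q) : TernaryModule R where
  M := X.twistModule
  I := X.Q
  isTernary := h
  q := Ψ

/-! ### Base change of quaternion rings with a parity factorization -/

variable (S : Type u) [CommRing S] [Algebra R S]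

/-- `pS` is the base change of the parity factorization `p`, i.e. the composite
`P_S^{⊗2} ⊗ Q_S ≅ (P^{⊗2} ⊗ Q)_S ≅ (⋀⁴ B)_S ≅ ⋀⁴ B_S`. -/
def IsParityBaseChange
    (pS : ((S ⊗[R] X.P) ⊗[S] (S ⊗[R] X.P)) ⊗[S] (S ⊗[R] X.Q) ≃ₗ[S] ⋀[S]^4 (S ⊗[R] X.B)) :
    Prop :=
  ∀ (a b : X.P) (c : X.Q),
    pS ((((1 : S) ⊗ₜ[R] a) ⊗ₜ[S] ((1 : S) ⊗ₜ[R] b)) ⊗ₜ[S] ((1 : S) ⊗ₜ[R] c)) =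
      wedgeBaseChange S 4 X.B (X.p ((a ⊗ₜ[R] b) ⊗ₜ[R] c))

/-- The base change of `B` with a parity factorization `pS`. -/
def baseChange (hS : IsQuaternionRing S (S ⊗[R] X.B))
    (pS : ((S ⊗[R] X.P) ⊗[S] (S ⊗[R] X.P)) ⊗[S] (S ⊗[R] X.Q) ≃ₗ[S] ⋀[S]^4 (S ⊗[R] X.B)) :
    ParityRing S where
  B := S ⊗[R] X.B
  isQuaternionRing := hS
  P := S ⊗[R] X.P
  Q := S ⊗[R] X.Q
  invertibleP := inferInstance
  invertibleQ := inferInstance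
  p := pS

end ParityRing

end

end TernaryQuaternion

/-! Write 𝒫 for ⋀³M ⊗ (I^∨)^{⊗2}. Locally M has a basis e₀, e₁, e₂ and I has a generator with dual
form τ. Then C⁰ has the basis 1, i = e₁e₂τ, j = e₂e₀τ, k = e₀e₁τ, and the coefficients of q are the
constants of its multiplication table. Conversely q can be read off the algebra: if n is the cross
product of the (i,j,k)-coordinates of x and y, then 1 ∧ x ∧ y ∧ xy = -q(n) · 1 ∧ i ∧ j ∧ k. The
intrinsic form of this rests on the identity (x × y) × (x' × y') = [x,y,y'] x' - [x,y,x'] y', which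
gives an isomorphism ⋀²(C⁰/R) ≅ M ⊗ 𝒫 (`exists_delta`), and on the canonical parity factorization
𝒫^{⊗2} ⊗ I ≅ ⋀⁴C⁰. Contraction with 𝒫^∨ recovers (M,I,-q), which is isometric to (M,I,q) through -1
on I (`IsModel.isometric`).

Every (B,P,Q,p) arises. The ring B is C⁰ of some (M,I,q), but 𝒫 need not be P. A twist by an
invertible module L, to M ⊗ L → I ⊗ L^{⊗2}, leaves C⁰ unchanged and replaces 𝒫 by 𝒫 ⊗ L^∨: the
factor is L^{⊗3} from ⋀³ and L^{⊗(-4)} from the two copies of the dual of I ⊗ L^{⊗2}. With L = P^∨ ⊗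
𝒫 the new module is P, and comparing p with the canonical factorization identifies I ⊗ L^{⊗2} with Q
(`TwistData.exists_isModel`, `ParityRing.exists_parity_isomorphic`).

To treat twists and base change alike, the concrete C⁰ is replaced by any algebra with a trilinear
map β(x,y,f) = xyf satisfying `IsEvenClifford`; such an algebra is isomorphic to C⁰ compatibly with
β (`IsEvenClifford.exists_algEquiv`). That C⁰ itself qualifies means C⁰ ≅ R ⊕ ⋀²M ⊗ I^∨ as a module.
It is spanned as claimed because in rank three a product of four vectors reduces to shorter ones;
there are no further relations because, over a localization, C⁰ maps to an ordinary Clifford algebra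
and from there linearly to an exterior algebra.

Localization is handled by frames: vectors and linear forms that are dual bases up to a factor r,
where the elements r generate the unit ideal. Identities are proved after multiplication by a power
of r and then glued (`eq_of_local`, `exists_eq_of_local`, `bijective_of_frames`). The exponents in
the proofs only count denominators. -/

namespace TernaryQuaternion

noncomputable section

/-! ### Frames and partitions of unity -/

section Frames

variable {R : Type*} [CommRing R]
variable {X Y H : Type*} [AddCommMonoid X] [Module R X] [AddCommMonoid Y] [Module R Y]
  [AddCommMonoid H] [Module R H]

/-- If `r^k` lies in an ideal for every `r` in a set generating the unit ideal, then the ideal is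
the unit ideal. -/
theorem ideal_eq_top_of_pow_mem {S : Set R} (hS : Ideal.span S = ⊤) (J : Ideal R)
    (h : ∀ r ∈ S, ∃ k : ℕ, r ^ k ∈ J) : J = ⊤ := by
  by_contra hJ
  obtain ⟨m, hm, hJm⟩ := Ideal.exists_le_maximal J hJ
  apply hm.ne_top
  rw [eq_top_iff, ← hS, Ideal.span_le]
  intro r hr
  obtain ⟨k, hk⟩ := h r hr
  exact hm.isPrime.mem_of_pow_mem k (hJm hk)

/-- In the applications K consists of the pairs (a, x) such that x solves a times a given linear
problem. The first coordinates form an ideal that contains a power of each r, hence contains 1. -/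
theorem exists_of_local {S : Set R} (hS : Ideal.span S = ⊤) (K : Submodule R (R × H))
    (h : ∀ r ∈ S, ∃ (k : ℕ) (x : H), (r ^ k, x) ∈ K) : ∃ x : H, ((1 : R), x) ∈ K := by
  have := ideal_eq_top_of_pow_mem hS (K.map (LinearMap.fst R R H)) fun r hr => by
    obtain ⟨k, x, hx⟩ := h r hr
    exact ⟨k, Submodule.mem_map.2 ⟨_, hx, rfl⟩⟩
  obtain ⟨⟨a, x⟩, hx, rfl : a = 1⟩ := Submodule.mem_map.1 ((Ideal.eq_top_iff_one _).1 this)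
  exact ⟨x, hx⟩

theorem mem_of_local {S : Set R}
    (hS : Ideal.span S = ⊤) (K : Submodule R Y) (y : Y)
    (h : ∀ r ∈ S, ∃ k : ℕ, r ^ k • y ∈ K) : y ∈ K := by
  have := ideal_eq_top_of_pow_mem hS (K.comap (LinearMap.toSpanSingleton R Y y)) h
  simpa using (Ideal.eq_top_iff_one _).1 this

theorem eq_zero_of_local {S : Set R} (hS : Ideal.span S = ⊤) (y : Y)
    (h : ∀ r ∈ S, ∃ k : ℕ, r ^ k • y = 0) : y = 0 :=
  mem_of_local hS ⊥ y h

theorem eq_of_local {S : Set R} (hS : Ideal.span S = ⊤) {y z : Y}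
    (h : ∀ r ∈ S, ∃ k : ℕ, r ^ k • y = r ^ k • z) : y = z := by
  let _ : AddCommGroup Y := Module.addCommMonoidToAddCommGroup R
  rw [← sub_eq_zero]
  refine eq_zero_of_local hS _ fun r hr => ?_
  obtain ⟨k, hk⟩ := h r hr
  exact ⟨k, by rw [smul_sub, hk, sub_self]⟩

/-- Vectors `e` and linear forms `ε` that would be dual bases if `r` were equal to `1`; they become
dual bases, up to the unit `r`, when `r` is inverted. -/
structure IsFrame {n : ℕ} (r : R) (e : Fin n → X) (ε : Fin n → Module.Dual R X) : Prop where
  expand : ∀ x, r • x = ∑ i, ε i x • e i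
  pair : ∀ i j, ε i (e j) = if i = j then r else 0

/-- Once r is inverted, f takes a basis to a basis up to units. The independent exponents spare the
applications any normalization of frames. -/
theorem bijective_of_frames {S : Set R} (hS : Ideal.span S = ⊤) (f : X →ₗ[R] Y)
    (h : ∀ r ∈ S, ∃ (n a b c d : ℕ) (e : Fin n → X) (ε : Fin n → Module.Dual R X)
      (y : Fin n → Y) (η : Fin n → Module.Dual R Y),
      IsFrame (r ^ a) e ε ∧ IsFrame (r ^ b) y η ∧ ∀ i, r ^ c • f (e i) = r ^ d • y i) :
    Function.Bijective f := by
  constructor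
  · let _ : AddCommGroup X := Module.addCommMonoidToAddCommGroup R
    let _ : AddCommGroup Y := Module.addCommMonoidToAddCommGroup R
    rw [injective_iff_map_eq_zero]
    intro x hx
    refine eq_zero_of_local hS x fun r hr => ?_
    obtain ⟨n, a, b, c, d, e, ε, y, η, he, hy, hf⟩ := h r hr
    -- The relation f(x) = 0 costs r^d, reading off its j-th coordinate with η costs r^b, and
    -- expanding x in the frame costs r^a.
    refine ⟨b + d + a, ?_⟩
    have h1 : ∑ i, (r ^ d * ε i x) • y i = 0 := by
      have := congrArg (fun z => r ^ c • f z) (he.expand x)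
      simp only [map_smul, hx, smul_zero, map_sum, Finset.smul_sum] at this
      rw [this]
      refine Finset.sum_congr rfl fun i _ => ?_
      rw [smul_comm, hf, smul_smul, mul_comm]
    have h2 : ∀ j, r ^ d * ε j x * r ^ b = 0 := fun j => by
      have := congrArg (η j) h1
      simpa [hy.pair, Finset.sum_ite_eq, map_sum] using this
    rw [pow_add, mul_smul, he.expand, Finset.smul_sum]
    refine Finset.sum_eq_zero fun i _ => ?_
    rw [smul_smul, show r ^ (b + d) * ε i x = r ^ d * ε i x * r ^ b by ring, h2, zero_smul]
  · intro y₀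
    suffices y₀ ∈ LinearMap.range f from this
    refine mem_of_local hS _ y₀ fun r hr => ?_
    obtain ⟨n, a, b, c, d, e, ε, y, η, he, hy, hf⟩ := h r hr
    refine ⟨d + b, ?_⟩
    rw [pow_add, mul_smul, hy.expand, Finset.smul_sum]
    refine Submodule.sum_mem _ fun i _ => ?_
    rw [smul_comm, ← hf, ← map_smul, ← map_smul]
    exact LinearMap.mem_range_self _ _

theorem IsFrame.smul {n : ℕ} {r : R} {e : Fin n → X} {ε : Fin n → Module.Dual R X}
    (h : IsFrame r e ε) (s : R) : IsFrame (s * r) (fun i => s • e i) ε where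
  expand x := by
    rw [mul_smul, h.expand, Finset.smul_sum]
    exact Finset.sum_congr rfl fun i _ => smul_comm _ _ _
  pair i j := by
    rw [map_smul, h.pair, smul_eq_mul, mul_ite, mul_zero]

/-- The dual of a frame. -/
theorem IsFrame.dual {n : ℕ} {r : R} {e : Fin n → X} {ε : Fin n → Module.Dual R X}
    (h : IsFrame r e ε) : IsFrame r ε (fun i => Module.Dual.eval R X (e i)) where
  expand f := by
    ext x
    have := congrArg f (h.expand x)
    simp only [map_smul, map_sum, smul_eq_mul] at this
    simp [this, mul_comm]
  pair i j := by
    rw [Module.Dual.eval_apply, h.pair]; simp only [eq_comm]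

theorem IsFrame.expand_one {r : R} {e : Fin 1 → X} {ε : Fin 1 → Module.Dual R X}
    (h : IsFrame r e ε) (x : X) : r • x = ε 0 x • e 0 := by simpa using h.expand x

theorem IsFrame.pair_one {r : R} {e : Fin 1 → X} {ε : Fin 1 → Module.Dual R X}
    (h : IsFrame r e ε) : ε 0 (e 0) = r := by simpa using h.pair 0 0

/-- A rank one frame. -/
theorem isFrame_one {r : R} {e : X} {ε : Module.Dual R X} (h : ∀ x, r • x = ε x • e)
    (h' : ε e = r) : IsFrame r (fun _ : Fin 1 => e) (fun _ => ε) where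
  expand x := by simpa using h x
  pair i j := by simp [h', Subsingleton.elim i j]

theorem IsFrame.tmul {n : ℕ} {r : R} {e : Fin n → X} {ε : Fin n → Module.Dual R X}
    (h : IsFrame r e ε) {s : R} {l : Y} {μ : Module.Dual R Y} (hl : ∀ y, s • y = μ y • l)
    (hμ : μ l = s) : IsFrame (r * s) (fun i => e i ⊗ₜ[R] l)
      (fun i => LinearMap.mul' R R ∘ₗ TensorProduct.map (ε i) μ) where
  expand z := by
    induction z with
    | zero => simp
    | add x y hx hy => simp only [smul_add, hx, hy, map_add, add_smul, Finset.sum_add_distrib]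
    | tmul x y =>
      rw [mul_comm, mul_smul, TensorProduct.smul_tmul', h.expand, TensorProduct.sum_tmul,
        Finset.smul_sum]
      refine Finset.sum_congr rfl fun i _ => ?_
      rw [← TensorProduct.smul_tmul', smul_comm, ← TensorProduct.tmul_smul, hl]
      simp [smul_smul]
  pair i j := by simp [h.pair, hμ]

end Frames

/-! ### Exterior powers of frames, and existence of frames -/

section Wedge

variable {R : Type*} [CommRing R]
variable {X Y H : Type*} [AddCommGroup X] [Module R X] [AddCommGroup Y] [Module R Y]
  [AddCommGroup H] [Module R H]

/-- An alternating map is determined by its values on injective families of basis vectors. Here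
these are the permutations of the standard basis, where both sides are the sign times the value at
the identity. -/
theorem alternating_eq_det_smul {n : ℕ} (g : (Fin n → R) [⋀^Fin n]→ₗ[R] Y)
    (v : Fin n → Fin n → R) :
    g v = (Matrix.of v).det • g (fun i => Pi.single i 1) := by
  have : g = (LinearMap.toSpanSingleton R Y (g fun i => Pi.single i 1)).compAlternatingMap
      Matrix.detRowAlternating := by
    refine Module.Basis.ext_alternating (Pi.basisFun R (Fin n)) fun σ hσ => ?_
    obtain ⟨τ, rfl⟩ : ∃ τ : Equiv.Perm (Fin n), ⇑τ = σ :=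
      ⟨Equiv.ofBijective σ (Finite.injective_iff_bijective.1 hσ), rfl⟩
    have h1 := AlternatingMap.map_perm g (fun i => Pi.single i 1) τ
    have h2 := AlternatingMap.map_perm (Matrix.detRowAlternating (R := R) (n := Fin n))
      (fun i => Pi.single i 1) τ
    have h3 : Matrix.detRowAlternating (R := R) (n := Fin n) (fun i => Pi.single i 1) = 1 := by
      have : (fun i => Pi.single i 1 : Fin n → Fin n → R) = (1 : Matrix (Fin n) (Fin n) R) := by
        ext i j; simp [Matrix.one_apply, Pi.single_apply, eq_comm]
      rw [this]; exact Matrix.det_one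
    simp only [Pi.basisFun_apply, LinearMap.compAlternatingMap_apply,
      LinearMap.toSpanSingleton_apply, Function.comp_def] at *
    rw [h1, h2, h3]
    rcases Int.units_eq_one_or (Equiv.Perm.sign τ) with h | h <;> simp [h]
  conv_lhs => rw [this]
  rfl

theorem alternating_linearCombination {n : ℕ} (g : X [⋀^Fin n]→ₗ[R] Y) (e : Fin n → X)
    (v : Fin n → Fin n → R) :
    g (fun i => ∑ j, v i j • e j) = (Matrix.of v).det • g e := by
  have := alternating_eq_det_smul (g.compLinearMap (Fintype.linearCombination R e)) v
  simpa [AlternatingMap.compLinearMap_apply, Fintype.linearCombination_apply] using this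

/-- The top exterior power of a frame. -/
theorem IsFrame.alternating_top {n : ℕ} {r : R} {e : Fin n → X} {ε : Fin n → Module.Dual R X}
    (h : IsFrame r e ε) (g : X [⋀^Fin n]→ₗ[R] Y) (v : Fin n → X) :
    r ^ n • g v = (Matrix.of fun i j => ε j (v i)).det • g e := by
  have h1 : r ^ n • g v = g (fun i => r • v i) := by
    have := g.toMultilinearMap.map_smul_univ (fun _ => r) v
    simpa using this.symm
  rw [h1]
  simp only [h.expand]
  exact alternating_linearCombination g e _

/-- The functional on the top exterior power attached to a frame. -/
theorem pairing_top {n : ℕ} (ε : Fin n → Module.Dual R X) (v : Fin n → X) :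
    exteriorPower.pairingDual R X n (exteriorPower.ιMulti R n ε) (exteriorPower.ιMulti R n v) =
      (Matrix.of fun i j => ε j (v i)).det := by
  simp

theorem IsFrame.det {n : ℕ} {r : R} {e : Fin n → X} {ε : Fin n → Module.Dual R X}
    (h : IsFrame r e ε) : (Matrix.of fun i j => ε j (e i)).det = r ^ n := by
  have : (Matrix.of fun i j => ε j (e i)) = Matrix.diagonal fun _ : Fin n => r := by
    ext i j; simp [h.pair, Matrix.diagonal_apply, eq_comm]
  simp [this]

/-- The flip acts trivially on X ⊗ X for an invertible X; apply f to the first factor of x ⊗ y = y ⊗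
x. -/
theorem Invertible.apply_smul_comm [Module.Invertible R X] (f : Module.Dual R X) (x y : X) :
    f x • y = f y • x := by
  simpa using congrArg (TensorProduct.lid R X ∘ LinearMap.rTensor X f)
    (Module.Invertible.tmul_comm (R := R) (m₁ := x) (m₂ := y))

/-- The contraction X^∨ ⊗ X → R is onto, so 1 is a sum of values f(x), and each value f(x) is the
denominator of the rank one frame (x, f) by `Invertible.apply_smul_comm`. -/
theorem span_frame_invertible (R X : Type*) [CommRing R] [AddCommGroup X] [Module R X]
    [Module.Invertible R X] :
    Ideal.span {r : R | ∃ (e : X) (ε : Module.Dual R X), (∀ x, r • x = ε x • e) ∧ ε e = r} = ⊤ := by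
  obtain ⟨z, hz⟩ := (Module.Invertible.linearEquiv R X).surjective 1
  rw [Ideal.eq_top_iff_one, ← hz]
  clear hz
  induction z with
  | zero => simp
  | add x y hx hy => rw [map_add]; exact add_mem hx hy
  | tmul f x =>
    refine Ideal.subset_span ⟨x, f, fun y => ?_, ?_⟩
    · exact Invertible.apply_smul_comm f x y
    · rfl

/-- A basis of the free module X_m, with its coordinate forms, is lifted to X. The vectors and the
forms lift up to denominators (X is finitely presented), and the finitely many frame identities,
true in the localization, hold after multiplication by one further element outside m. -/
theorem exists_frame_notMem [Module.Finite R X] [Module.Projective R X] {n : ℕ} (m : Ideal R)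
    [hm : m.IsPrime] (h : Module.rankAtStalk (R := R) X ⟨m, hm⟩ = n) :
    ∃ (r : R) (_ : r ∉ m) (e : Fin n → X) (ε : Fin n → Module.Dual R X), IsFrame r e ε := by
  let S := m.primeCompl
  let A := Localization S
  let XS := LocalizedModule S X
  let ι : X →ₗ[R] XS := LocalizedModule.mkLinearMap S X
  have : Module.FinitePresentation R X := Module.finitePresentation_of_projective R X
  have : Module.Free A XS := Module.free_of_flat_of_isLocalRing
  have hr : Module.finrank A XS = n := h
  let b₀ : Module.Basis (Fin n) A XS := Module.finBasisOfFinrankEq A XS hr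
  choose s hs using fun i => IsLocalizedModule.surj S ι (b₀ i)
  -- Rescaling by the denominators makes each basis vector the image of an element of X.
  let b : Module.Basis (Fin n) A XS := b₀.unitsSMul
    fun i => (IsLocalization.map_units A (s i).2).unit
  have hb : ∀ i, b i = ι (s i).1 := fun i => by
    rw [← hs]
    simp [b, Module.Basis.unitsSMul_apply, Units.smul_def, algebraMap_smul]
    rfl
  choose ε t ht using fun i => Module.FinitePresentation.exists_lift_of_isLocalizedModule S
    (Algebra.linearMap R A) ((b.coord i).restrictScalars R ∘ₗ ι)
  let s₀ : S := ∏ i, t i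
  -- The lifted forms have different denominators t i; after multiplication by the others, all of
  -- them become the coordinates times the same s₀.
  let ε' : Fin n → Module.Dual R X := fun i => (∏ j ∈ Finset.univ.erase i, (t j : R)) • ε i
  have hε' : ∀ i x, algebraMap R A (ε' i x) = algebraMap R A s₀ * b.coord i (ι x) := fun i x => by
    have h1 := LinearMap.congr_fun (ht i) x
    simp only [LinearMap.comp_apply, Algebra.linearMap_apply, LinearMap.smul_apply] at h1
    simp only [ε', LinearMap.smul_apply, smul_eq_mul, map_mul, h1]
    have : (s₀ : R) = (∏ j ∈ Finset.univ.erase i, (t j : R)) * t i := by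
      simp only [s₀, Submonoid.coe_finsetProd]
      exact (Finset.prod_erase_mul _ _ (Finset.mem_univ i)).symm
    rw [this, map_mul, mul_assoc, Submonoid.smul_def, Algebra.smul_def]
    rfl
  have hD : ι ∘ₗ (∑ i, (ε' i).smulRight (s i).1) = ι ∘ₗ ((s₀ : R) • LinearMap.id) := by
    ext x
    simp only [LinearMap.comp_apply, LinearMap.sum_apply, LinearMap.smulRight_apply, map_sum,
      map_smul, LinearMap.smul_apply, LinearMap.id_apply]
    have : ι x = ∑ i, b.coord i (ι x) • b i := by simp [b.sum_repr (ι x)]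
    conv_rhs => rw [this, Finset.smul_sum]
    refine Finset.sum_congr rfl fun i _ => ?_
    rw [← hb, ← algebraMap_smul A (ε' i x), hε', mul_smul, algebraMap_smul]
  -- As X is finite, one c clears the denominators of the expansion identity for all x at once.
  obtain ⟨c, hc⟩ := Module.Finite.exists_smul_of_comp_eq_of_isLocalizedModule S ι _ _ hD
  have hp : ∀ i j, ∃ d : S, d • ε' i (s j).1 = d • (if i = j then (s₀ : R) else 0) := fun i j => by
    refine (IsLocalization.eq_iff_exists S A).1 ?_ |>.imp fun d hd => hd
    rw [hε', ← hb, Module.Basis.coord_apply, Module.Basis.repr_self]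
    by_cases hij : i = j
    · subst hij; simp
    · simp [hij]
  choose d hd using hp
  -- A common multiple of the elements that make the pairings exact.
  let d₀ : S := ∏ i, ∏ j, d i j
  refine ⟨(c * d₀ : S) * s₀, (c * d₀ * s₀).2, fun i => (s i).1, fun i => ((c * d₀ : S) : R) • ε' i,
    ?_, ?_⟩
  · intro x
    have := LinearMap.congr_fun hc x
    simp only [LinearMap.smul_apply, LinearMap.sum_apply, LinearMap.smulRight_apply,
      LinearMap.id_apply, Submonoid.smul_def] at this
    rw [Submonoid.coe_mul, mul_comm (c : R), mul_smul, mul_smul, ← this, Finset.smul_sum,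
      Finset.smul_sum]
    simp only [LinearMap.smul_apply, smul_smul, smul_eq_mul, mul_assoc]
  · intro i j
    have h1 : ∃ g : R, (d₀ : R) = g * d i j := by
      have : d i j ∣ d₀ :=
        (Finset.dvd_prod_of_mem (fun j => d i j) (Finset.mem_univ j)).trans
          (Finset.dvd_prod_of_mem (fun i => ∏ j, d i j) (Finset.mem_univ i))
      obtain ⟨g, hg⟩ := this
      exact ⟨g, by rw [hg, Submonoid.coe_mul, mul_comm]⟩
    obtain ⟨g, hg⟩ := h1
    have h2 := hd i j
    simp only [Submonoid.smul_def, smul_eq_mul] at h2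
    rw [LinearMap.smul_apply, smul_eq_mul, Submonoid.coe_mul, hg, mul_assoc, mul_assoc, h2]
    split_ifs <;> ring

theorem update_pair {X : Type*} (x y z : X) : Function.update ![x, y] 1 z = ![x, z] := by
  ext i; fin_cases i <;> rfl

/-- The wedge product of two vectors. -/
def wedge₂ : X →ₗ[R] X →ₗ[R] ⋀[R]^2 X :=
  LinearMap.mk₂ R (fun x y => exteriorPower.ιMulti R 2 ![x, y])
    (fun x x' y => AlternatingMap.map_vecCons_add _ _ _ _)
    (fun c x y => AlternatingMap.map_vecCons_smul _ _ _ _)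
    (fun x y y' => by
      simpa only [update_pair] using
        (exteriorPower.ιMulti R 2 (M := X)).map_update_add ![x, y] 1 y y')
    (fun c x y => by
      simpa only [update_pair] using
        (exteriorPower.ιMulti R 2 (M := X)).map_update_smul ![x, y] 1 c y)

theorem wedge₂_apply (x y : X) : wedge₂ (R := R) x y = exteriorPower.ιMulti R 2 ![x, y] := rfl

@[simp]
theorem wedge₂_self (x : X) : wedge₂ (R := R) x x = 0 :=
  (exteriorPower.ιMulti R 2 (M := X)).map_eq_zero_of_eq ![x, x] (i := 0) (j := 1) rfl (by decide)

theorem wedge₂_swap (x y : X) : wedge₂ (R := R) y x = -wedge₂ x y := by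
  have := wedge₂_self (R := R) (x + y)
  simp only [map_add, LinearMap.add_apply, wedge₂_self, zero_add, add_zero] at this
  exact eq_neg_of_add_eq_zero_left this

theorem wedge₂_ext {f g : ⋀[R]^2 X →ₗ[R] Y} (h : ∀ x y, f (wedge₂ x y) = g (wedge₂ x y)) :
    f = g := by
  apply exteriorPower.linearMap_ext
  ext v
  have : v = ![v 0, v 1] := by ext i; fin_cases i <;> rfl
  rw [this]; exact h _ _

/-- The linear map on `⋀² X` induced by an alternating bilinear map. -/
def wedge₂Lift (β : X →ₗ[R] X →ₗ[R] Y) (hβ : ∀ x, β x x = 0) : ⋀[R]^2 X →ₗ[R] Y :=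
  exteriorPower.alternatingMapLinearEquiv
    { toFun := fun v => β (v 0) (v 1)
      map_update_add' := fun v i x y => by
        fin_cases i <;> simp
      map_update_smul' := fun v i c x => by
        fin_cases i <;> simp
      map_eq_zero_of_eq' := fun v i j hv hij => by
        have : v 0 = v 1 := by
          fin_cases i <;> fin_cases j <;> simp_all
        rw [this, hβ] }

@[simp]
theorem wedge₂Lift_apply (β : X →ₗ[R] X →ₗ[R] Y) (hβ : ∀ x, β x x = 0) (x y : X) :
    wedge₂Lift β hβ (wedge₂ x y) = β x y := by
  rw [wedge₂_apply, wedge₂Lift, exteriorPower.alternatingMapLinearEquiv_apply_ιMulti]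
  rfl

/-- The minor of two linear forms. -/
def minor (f g : Module.Dual R X) : Module.Dual R (⋀[R]^2 X) :=
  wedge₂Lift (LinearMap.mk₂ R (fun x y => f x * g y - g x * f y)
    (fun x x' y => by simp; ring) (fun c x y => by simp; ring)
    (fun x y y' => by simp; ring) (fun c x y => by simp; ring)) (fun x => by simp; ring)

@[simp]
theorem minor_apply (f g : Module.Dual R X) (x y : X) :
    minor f g (wedge₂ x y) = f x * g y - g x * f y := by
  simp [minor]

/-- The cyclic order e₁ ∧ e₂, e₂ ∧ e₀, e₀ ∧ e₁ avoids signs, and makes coordinates on ⋀² those of a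
cross product. It is also the order of i, j, k. -/
theorem IsFrame.exteriorPower_two {r : R} {e : Fin 3 → X} {ε : Fin 3 → Module.Dual R X}
    (h : IsFrame r e ε) : IsFrame (r ^ 2)
      ![wedge₂ (e 1) (e 2), wedge₂ (e 2) (e 0), wedge₂ (e 0) (e 1)]
      ![minor (ε 1) (ε 2), minor (ε 2) (ε 0), minor (ε 0) (ε 1)] where
  expand ω := by
    suffices r ^ 2 • LinearMap.id = (minor (ε 1) (ε 2)).smulRight (wedge₂ (R := R) (e 1) (e 2)) +
        (minor (ε 2) (ε 0)).smulRight (wedge₂ (e 2) (e 0)) +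
        (minor (ε 0) (ε 1)).smulRight (wedge₂ (e 0) (e 1)) by
      have := LinearMap.congr_fun this ω
      simpa [Fin.sum_univ_three] using this
    refine wedge₂_ext fun x y => ?_
    have h1 : r ^ 2 • wedge₂ (R := R) x y = wedge₂ (r • x) (r • y) := by
      simp [smul_smul, pow_two]
    rw [LinearMap.smul_apply, LinearMap.id_apply, h1, h.expand, h.expand]
    simp only [Fin.sum_univ_three, map_add, LinearMap.add_apply, map_smul, LinearMap.smul_apply,
      wedge₂_self, LinearMap.smulRight_apply, minor_apply, wedge₂_swap (e 0) (e 2),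
      wedge₂_swap (e 0) (e 1), wedge₂_swap (e 1) (e 2)]
    rw [wedge₂_swap (e 2) (e 0)]
    module
  pair i j := by
    fin_cases i <;> fin_cases j <;> simp [h.pair] <;> ring

/-- A frame of a module of rank three and of an invertible module. -/
structure TernaryFrame (R M I : Type*) [CommRing R] [AddCommGroup M] [Module R M]
    [AddCommGroup I] [Module R I] (r : R) where
  e : Fin 3 → M
  ε : Fin 3 → Module.Dual R M
  t : I
  τ : Module.Dual R I
  isFrame : IsFrame r e ε
  expand : ∀ s, r • s = τ s • t
  pair : τ t = r

/-- The denominators of frames of `M` and `I`. -/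
def frameSet (R M I : Type*) [CommRing R] [AddCommGroup M] [Module R M]
    [AddCommGroup I] [Module R I] : Set R := {r | Nonempty (TernaryFrame R M I r)}

end Wedge

/-- If the denominators lay in a maximal ideal m, take a frame of M and a frame of I with
denominators outside m. Multiplying the vectors of each by the denominator of the other gives both
the product as denominator, which is still outside m. -/
theorem IsTernary.span_frameSet {R : Type u} [CommRing R] {M I : Type u} [AddCommGroup M]
    [Module R M] [AddCommGroup I] [Module R I] (h : IsTernary R M I) :
    Ideal.span (frameSet R M I) = ⊤ := by
  have := h.finite
  have := h.projective
  have := h.invertible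
  by_contra hJ
  obtain ⟨m, hm, hJm⟩ := Ideal.exists_le_maximal _ hJ
  obtain ⟨r, hr, e, ε, he⟩ := exists_frame_notMem (R := R) (X := M) m (n := 3) (h.rank_eq _)
  obtain ⟨s, ⟨t, τ, ht, hτ⟩, hs⟩ : ∃ s ∈ {r : R | ∃ (e : I) (ε : Module.Dual R I),
      (∀ x, r • x = ε x • e) ∧ ε e = r}, s ∉ m := by
    by_contra! hc
    exact hm.ne_top (top_unique ((span_frame_invertible R I).symm.trans_le (Ideal.span_le.2 hc)))
  have : s * r ∈ frameSet R M I := ⟨⟨fun i => s • e i, ε, r • t, τ, he.smul s,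
    fun x => by rw [mul_comm, mul_smul, ht, smul_comm],
    by rw [map_smul, hτ, smul_eq_mul, mul_comm]⟩⟩
  rcases hm.isPrime.mem_or_mem (hJm (Ideal.subset_span this)) with h | h
  · exact hs h
  · exact hr h


end

end TernaryQuaternion

namespace TernaryQuaternion

noncomputable section

/-! ### Relations in the Clifford algebra -/

section CliffRelations

variable {R : Type u} [CommRing R]
variable {I : Type u} [AddCommGroup I] [Module R I]
variable {M : Type u} [AddCommGroup M] [Module R M]
variable (q : QuadraticMap R M I)

theorem cliffVec_sq (x : M) : cliffVec q x * cliffVec q x = cliffPos q (q x) :=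
  (map_mul ((cliffMk q).comp (Algebra.TensorProduct.includeLeft :
      TensorAlgebra R M →ₐ[R] TensorAlgebra R M ⊗[R] ReesAlg (R := R) I))
    (TensorAlgebra.ι R x) (TensorAlgebra.ι R x)).symm.trans
      (RingQuot.mkAlgHom_rel R (CliffRel.sq (q := q) x))

theorem reesPos_mul_reesNeg (s : I) (f : Module.Dual R I) :
    reesPos I s * reesNeg I f = algebraMap R _ (f s) := by
  have : reesMk (R := R) I (SymmetricAlgebra.ι R _ (s, 0) * SymmetricAlgebra.ι R _ (0, f) -
      algebraMap R _ (f s)) = 0 :=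
    Ideal.Quotient.eq_zero_iff_mem.2 (Ideal.subset_span ⟨s, f, rfl⟩)
  rw [map_sub, map_mul, AlgHom.commutes, sub_eq_zero] at this
  exact this

theorem cliffPos_mul_cliffNeg (s : I) (f : Module.Dual R I) :
    cliffPos q s * cliffNeg q f = algebraMap R _ (f s) := by
  have := congrArg (cliffRees q) (reesPos_mul_reesNeg s f)
  rwa [map_mul, AlgHom.commutes] at this

theorem cliffPos_commute (s : I) (z : Cliff q) : Commute (cliffPos q s) z :=
  cliffRees_commute q _ z

theorem cliffNeg_commute (f : Module.Dual R I) (z : Cliff q) : Commute (cliffNeg q f) z :=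
  cliffRees_commute q _ z

theorem cliffVec_swap (x y : M) : cliffVec q y * cliffVec q x =
    cliffPos q (QuadraticMap.polar q x y) - cliffVec q x * cliffVec q y := by
  have := cliffVec_sq q (x + y)
  rw [map_add, add_mul, mul_add, mul_add, cliffVec_sq, cliffVec_sq] at this
  rw [QuadraticMap.polar, map_sub, map_sub, ← this]
  abel

/-! ### Generators of the even Clifford algebra -/

theorem range_commute (N : Submodule R (Cliff q)) :
    Commute (LinearMap.range (cliffPos q)) N ∧ Commute (LinearMap.range (cliffNeg q)) N := by
  constructor <;>
  · refine le_antisymm ?_ ?_ <;> rw [Submodule.mul_le]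
    · rintro _ ⟨l, rfl⟩ y hy
      first
      | rw [(cliffPos_commute q l y).eq]; exact Submodule.mul_mem_mul hy ⟨l, rfl⟩
      | rw [(cliffNeg_commute q l y).eq]; exact Submodule.mul_mem_mul hy ⟨l, rfl⟩
    · rintro y hy _ ⟨l, rfl⟩
      first
      | rw [← (cliffPos_commute q l y).eq]; exact Submodule.mul_mem_mul ⟨l, rfl⟩ hy
      | rw [← (cliffNeg_commute q l y).eq]; exact Submodule.mul_mem_mul ⟨l, rfl⟩ hy

theorem cliffPos_mul_cliffNeg_le :
    LinearMap.range (cliffPos q) * LinearMap.range (cliffNeg q) ≤ 1 := by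
  rw [Submodule.mul_le]
  rintro _ ⟨s, rfl⟩ _ ⟨f, rfl⟩
  rw [cliffPos_mul_cliffNeg]
  exact Submodule.algebraMap_mem _

/-- The span of the products `x y s` and `s s'`, for `x, y ∈ M` and `s, s' ∈ I`. -/
abbrev cliffLow : Submodule R (Cliff q) :=
  LinearMap.range (cliffVec q) ^ 2 * LinearMap.range (cliffPos q) ⊔ LinearMap.range (cliffPos q) ^ 2

variable {q}

theorem mul_mul_cliffPos_mem_cliffLow (x y : M) (s : I) :
    cliffVec q x * cliffVec q y * cliffPos q s ∈ cliffLow q := by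
  refine Submodule.mem_sup_left (Submodule.mul_mem_mul ?_ ⟨s, rfl⟩)
  rw [pow_two]
  exact Submodule.mul_mem_mul ⟨x, rfl⟩ ⟨y, rfl⟩

theorem cliffLow_mem_iff {z w : Cliff q} (h : z + w ∈ cliffLow q) :
    z ∈ cliffLow q ↔ w ∈ cliffLow q := by
  have hneg : ∀ w ∈ cliffLow q, -w ∈ cliffLow q := fun w hw => by
    have := (cliffLow q).smul_mem (-1) hw
    rwa [Algebra.smul_def, map_neg, map_one, neg_one_mul] at this
  constructor
  · intro hz
    simpa using add_mem (hneg z hz) h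
  · intro hw
    simpa using add_mem h (hneg w hw)

theorem four_mem_01 (x z w : M) :
    cliffVec q x * cliffVec q x * cliffVec q z * cliffVec q w ∈ cliffLow q := by
  rw [cliffVec_sq, mul_assoc, (cliffPos_commute q _ _).eq]
  exact mul_mul_cliffPos_mem_cliffLow _ _ _

theorem four_mem_12 (x z w : M) :
    cliffVec q x * cliffVec q z * cliffVec q z * cliffVec q w ∈ cliffLow q := by
  rw [mul_assoc (cliffVec q x), cliffVec_sq, mul_assoc, (cliffPos_commute q _ _).eq, ← mul_assoc]
  exact mul_mul_cliffPos_mem_cliffLow _ _ _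

theorem four_mem_23 (x z w : M) :
    cliffVec q x * cliffVec q z * cliffVec q w * cliffVec q w ∈ cliffLow q := by
  rw [mul_assoc, cliffVec_sq]
  exact mul_mul_cliffPos_mem_cliffLow _ _ _

theorem four_swap_12 (x y z w : M) :
    cliffVec q x * cliffVec q y * cliffVec q z * cliffVec q w ∈ cliffLow q ↔
      cliffVec q x * cliffVec q z * cliffVec q y * cliffVec q w ∈ cliffLow q := by
  refine cliffLow_mem_iff ?_
  rw [mul_assoc (cliffVec q x), mul_assoc (cliffVec q x) (cliffVec q z), cliffVec_swap q y z,
    mul_sub, sub_mul, add_sub_cancel, mul_assoc, (cliffPos_commute q _ _).eq, ← mul_assoc]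
  exact mul_mul_cliffPos_mem_cliffLow _ _ _

theorem four_swap_23 (x y z w : M) :
    cliffVec q x * cliffVec q y * cliffVec q z * cliffVec q w ∈ cliffLow q ↔
      cliffVec q x * cliffVec q y * cliffVec q w * cliffVec q z ∈ cliffLow q := by
  refine cliffLow_mem_iff ?_
  rw [mul_assoc _ (cliffVec q z), mul_assoc _ (cliffVec q w), cliffVec_swap q z w,
    mul_sub, add_sub_cancel]
  exact mul_mul_cliffPos_mem_cliffLow _ _ _

/-- Two of four indices in `Fin 3` coincide. Vectors anticommute modulo `cliffLow`, so the equal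
ones can be made adjacent, and their square lies in I. -/
theorem four_mem_frame (e : Fin 3 → M) (i j k l : Fin 3) :
    cliffVec q (e i) * cliffVec q (e j) * cliffVec q (e k) * cliffVec q (e l) ∈ cliffLow q := by
  have : i = j ∨ j = k ∨ k = l ∨ i = k ∨ j = l ∨ i = l := by omega
  rcases this with rfl | rfl | rfl | rfl | rfl | rfl
  · exact four_mem_01 _ _ _
  · exact four_mem_12 _ _ _
  · exact four_mem_23 _ _ _
  · rw [four_swap_12]; exact four_mem_01 _ _ _
  · rw [four_swap_12]; exact four_mem_23 _ _ _
  · rw [four_swap_23, four_swap_12]; exact four_mem_01 _ _ _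

theorem IsFrame.four_mul_mem {A : Type*} [Ring A] [Algebra R A] {r : R} {e : Fin 3 → M}
    {ε : Fin 3 → Module.Dual R M} (h : IsFrame r e ε) (v : M →ₗ[R] A) (K : Submodule R A)
    (hK : ∀ i j k l, v (e i) * v (e j) * v (e k) * v (e l) ∈ K) (x y z w : M) :
    r ^ 4 • (v x * v y * v z * v w) ∈ K := by
  have : r ^ 4 • (v x * v y * v z * v w) = v (r • x) * v (r • y) * v (r • z) * v (r • w) := by
    simp only [map_smul, smul_mul_assoc, mul_smul_comm, smul_smul]
    congr 1; ring
  rw [this]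
  simp only [h.expand, map_sum, map_smul, Finset.sum_mul, Finset.mul_sum,
    smul_mul_assoc, mul_smul_comm]
  exact Submodule.sum_mem _ fun i _ => Submodule.smul_mem _ _ <| Submodule.sum_mem _ fun j _ =>
    Submodule.smul_mem _ _ <| Submodule.sum_mem _ fun k _ => Submodule.smul_mem _ _ <|
    Submodule.sum_mem _ fun l _ => Submodule.smul_mem _ _ <| hK _ _ _ _

/-- Here rank three enters: four vectors can be traded for at most two vectors and elements of I,
which bounds the even part. -/
theorem four_le_cliffLow (h : IsTernary R M I) :
    LinearMap.range (cliffVec q) ^ 4 ≤ cliffLow q := by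
  have key : ∀ x y z w : M,
      cliffVec q x * cliffVec q y * cliffVec q z * cliffVec q w ∈ cliffLow q := by
    intro x y z w
    refine mem_of_local h.span_frameSet _ _ ?_
    rintro r ⟨F⟩
    exact ⟨4, F.isFrame.four_mul_mem _ _ (four_mem_frame F.e) _ _ _ _⟩
  have h2 : LinearMap.range (cliffVec q) ^ 4 = LinearMap.range (cliffVec q) *
      LinearMap.range (cliffVec q) * LinearMap.range (cliffVec q) *
      LinearMap.range (cliffVec q) := by simp only [pow_succ, pow_zero, one_mul]
  rw [h2]
  generalize hK : cliffLow q = K at key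
  rw [Submodule.mul_le]
  rintro a ha _ ⟨w, rfl⟩
  induction ha using Submodule.mul_induction_on' with
  | add x _ y _ hx hy => rw [add_mul]; exact add_mem hx hy
  | mem_mul_mem a ha c hc =>
    obtain ⟨z, rfl⟩ := hc
    induction ha using Submodule.mul_induction_on' with
    | add x _ y _ hx hy => rw [add_mul, add_mul]; exact add_mem hx hy
    | mem_mul_mem a ha c hc =>
      obtain ⟨x, rfl⟩ := ha
      obtain ⟨y, rfl⟩ := hc
      exact key _ _ _ _

/-- Induction on the number of vectors: `four_le_cliffLow` removes two or four of them at the price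
of one or two factors from I, and factors from I cancel against I^∨. -/
theorem cliffPiece_le_low (h : IsTernary R M I) (a b c : ℕ) (habc : a + 2 * b = 2 * c) :
    cliffPiece q a b c ≤
      1 ⊔ LinearMap.range (cliffVec q) ^ 2 * LinearMap.range (cliffNeg q) := by
  have hW := fun N => (range_commute q N).1
  have hW' := fun N => (range_commute q N).2
  have hWW := cliffPos_mul_cliffNeg_le q
  have h4 := four_le_cliffLow (q := q) h
  unfold cliffPiece
  unfold cliffLow at h4
  generalize LinearMap.range (cliffVec q) = V at *
  generalize LinearMap.range (cliffPos q) = W at *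
  generalize LinearMap.range (cliffNeg q) = W' at *
  have hpow : ∀ n, W ^ n * W' ^ n ≤ 1 := fun n => by
    rw [← (hW W').mul_pow]
    exact pow_le_one' hWW n
  induction a using Nat.strong_induction_on generalizing b c with
  | _ a ih =>
    -- Degree zero forces a to be even, so only a = 0 and a = 2 remain below 4.
    rcases Nat.lt_or_ge a 4 with ha | ha
    · have : a = 0 ∨ a = 2 := by omega
      rcases this with rfl | rfl
      · obtain rfl : b = c := by omega
        rw [pow_zero, one_mul]
        exact (hpow _).trans le_sup_left
      · obtain rfl : c = b + 1 := by omega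
        refine le_trans ?_ le_sup_right
        rw [pow_succ W', ← mul_assoc (W ^ b)]
        calc V ^ 2 * (W ^ b * W' ^ b * W') ≤ V ^ 2 * (1 * W') :=
              mul_le_mul_right (mul_le_mul_left (hpow b) _) _
          _ = _ := by rw [one_mul]
    · obtain ⟨d, rfl⟩ := Nat.exists_eq_add_of_le' ha
      calc V ^ (d + 4) * (W ^ b * W' ^ c) = V ^ d * V ^ 4 * (W ^ b * W' ^ c) := by rw [pow_add]
        _ ≤ V ^ d * (V ^ 2 * W ⊔ W ^ 2) * (W ^ b * W' ^ c) :=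
            mul_le_mul_left (mul_le_mul_right h4 _) _
        _ = V ^ (d + 2) * (W ^ (b + 1) * W' ^ c) ⊔ V ^ d * (W ^ (b + 2) * W' ^ c) := by
            rw [Submodule.mul_sup, Submodule.sup_mul]
            congr 1
            · rw [pow_add V, pow_succ W]
              simp only [mul_assoc]
              rw [← mul_assoc W (W ^ b), (hW (W ^ b)).eq, mul_assoc]
            · rw [show b + 2 = 2 + b by ring]; simp only [pow_add, mul_assoc]
        _ ≤ _ := sup_le (ih _ (by omega) _ _ (by omega)) (ih _ (by omega) _ _ (by omega))

theorem evenClifford_span (h : IsTernary R M I) :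
    Submodule.span R ({1} ∪ {z : evenClifford q | ∃ x y f, z = evenMk q x y f}) = ⊤ := by
  rw [eq_top_iff]
  rintro ⟨z, hz⟩ -
  have h1 : cliffDegree q 0 ≤ (Submodule.span R
      ({1} ∪ {z : evenClifford q | ∃ x y f, z = evenMk q x y f})).map
        (evenClifford q).val.toLinearMap := by
    unfold cliffDegree
    simp only [iSup_le_iff]
    intro a b c habc
    refine (cliffPiece_le_low h a b c (by omega)).trans (sup_le ?_ ?_)
    · rw [Submodule.one_le]
      exact ⟨1, Submodule.subset_span (by simp), rfl⟩
    · rw [pow_two, Submodule.mul_le]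
      rintro a ha _ ⟨f, rfl⟩
      induction ha using Submodule.mul_induction_on' with
      | add x _ y _ hx hy => rw [add_mul]; exact add_mem hx hy
      | mem_mul_mem a ha c hc =>
        obtain ⟨x, rfl⟩ := ha
        obtain ⟨y, rfl⟩ := hc
        exact ⟨evenMk q x y f, Submodule.subset_span (Or.inr ⟨x, y, f, rfl⟩), rfl⟩
  obtain ⟨w, hw, hwz⟩ := h1 hz
  have : (⟨z, hz⟩ : evenClifford q) = w := Subtype.ext hwz.symm
  rw [this]; exact hw

end CliffRelations

end

end TernaryQuaternion

namespace TernaryQuaternion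

noncomputable section

/-! ### The module structure of the even Clifford algebra -/

section CliffStructure

variable {R : Type u} [CommRing R]
variable {I : Type u} [AddCommGroup I] [Module R I]
variable {M : Type u} [AddCommGroup M] [Module R M]
variable (q : QuadraticMap R M I)

theorem exists_rees_lift {S : Type*} [CommRing S] [Algebra R S] (p : I →ₗ[R] S)
    (n : Module.Dual R I →ₗ[R] S) (h : ∀ s f, p s * n f = algebraMap R S (f s)) :
    ∃ Φ : ReesAlg (R := R) I →ₐ[R] S, (∀ s, Φ (reesPos I s) = p s) ∧
      ∀ f, Φ (reesNeg I f) = n f := by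
  let Φ₀ : SymmetricAlgebra R (I × Module.Dual R I) →ₐ[R] S := SymmetricAlgebra.lift (p.coprod n)
  have h0 : ∀ z, Φ₀ (SymmetricAlgebra.ι R _ z) = p z.1 + n z.2 := fun z => by
    simp [Φ₀]
  have h1 : ∀ z ∈ contractionIdeal (R := R) I, Φ₀ z = 0 := by
    intro z hz
    have : contractionIdeal (R := R) I ≤ RingHom.ker Φ₀ := by
      refine Ideal.span_le.2 ?_
      rintro _ ⟨x, f, rfl⟩
      change Φ₀ _ = 0
      rw [map_sub, map_mul, h0, h0, AlgHom.commutes]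
      simp [h]
    exact this hz
  refine ⟨Ideal.Quotient.liftₐ _ Φ₀ h1, fun s => ?_, fun f => ?_⟩
  · refine (h0 (s, 0)).trans ?_
    simp
  · refine (h0 (0, f)).trans ?_
    simp

/-- The Rees algebra must act through central elements, so it is sent to a commutative ring S over
which the target A is an algebra. -/
theorem exists_cliff_lift {S A : Type*} [CommRing S] [Algebra R S] [Ring A] [Algebra R A]
    [Algebra S A] [IsScalarTower R S A] (p : I →ₗ[R] S)
    (n : Module.Dual R I →ₗ[R] S) (h : ∀ s f, p s * n f = algebraMap R S (f s))
    (v : M →ₗ[R] A) (hv : ∀ x, v x * v x = algebraMap S A (p (q x))) :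
    ∃ Φ : Cliff q →ₐ[R] A, (∀ x, Φ (cliffVec q x) = v x) ∧
      ∀ f, Φ (cliffNeg q f) = algebraMap S A (n f) := by
  obtain ⟨ρ, hρ, hρ'⟩ := exists_rees_lift p n h
  let Φ₀ : TensorAlgebra R M ⊗[R] ReesAlg (R := R) I →ₐ[R] A :=
    Algebra.TensorProduct.lift (TensorAlgebra.lift R v) ((IsScalarTower.toAlgHom R S A).comp ρ)
      fun x y => Algebra.commutes' _ _ |>.symm
  have h1 : ∀ ⦃x y⦄, CliffRel q x y → Φ₀ x = Φ₀ y := by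
    rintro _ _ ⟨x⟩
    have e1 := Algebra.TensorProduct.lift_tmul (TensorAlgebra.lift R v)
      ((IsScalarTower.toAlgHom R S A).comp ρ) (fun x y => (Algebra.commutes' _ _).symm)
      (TensorAlgebra.ι R x * TensorAlgebra.ι R x) 1
    have e2 := Algebra.TensorProduct.lift_tmul (TensorAlgebra.lift R v)
      ((IsScalarTower.toAlgHom R S A).comp ρ) (fun x y => (Algebra.commutes' _ _).symm)
      1 (reesPos I (q x))
    refine e1.trans (Eq.trans ?_ e2.symm)
    simp [hv, hρ]
  refine ⟨RingQuot.liftAlgHom R ⟨Φ₀, h1⟩, fun x => ?_, fun f => ?_⟩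
  · refine (RingQuot.liftAlgHom_mkAlgHom_apply R Φ₀ h1 _).trans ?_
    refine (Algebra.TensorProduct.lift_tmul _ _ _ _ _).trans ?_
    simp
  · refine (RingQuot.liftAlgHom_mkAlgHom_apply R Φ₀ h1 _).trans ?_
    refine (Algebra.TensorProduct.lift_tmul _ _ _ _ _).trans ?_
    simp [hρ']

/-- Linear functionals on the Clifford algebra after inverting the denominator of a frame. -/
theorem exists_cliff_functional {r : R} (F : TernaryFrame R M I r) (S : Type u) [CommRing S]
    [Algebra R S] [IsLocalization.Away r S] (b : LinearMap.BilinMap R M I)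
    (hb : ∀ x, b x x = q x) (c : S) (κ : (Fin 3 → S) [⋀^Fin 2]→ₗ[S] S) :
    ∃ Θ : Cliff q →ₗ[R] S, Θ 1 = c ∧ ∀ x y f,
      Θ (cliffVec q x * cliffVec q y * cliffNeg q f) = algebraMap R S (f (b x y)) * c +
        algebraMap R S (f F.t) * (IsLocalization.Away.invSelf r) ^ 2 *
          κ ![fun i => algebraMap R S (F.ε i x), fun i => algebraMap R S (F.ε i y)] := by
  obtain ⟨ρ, hρ⟩ : ∃ ρ : S, ρ = IsLocalization.Away.invSelf r := ⟨_, rfl⟩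
  have hr : algebraMap R S r * ρ = 1 := by rw [hρ]; exact IsLocalization.Away.mul_invSelf r
  rw [← hρ]
  -- Over S = R[1/r] the element t is a basis of I: p is the coordinate τ/r, with p(t) = 1, and n is
  -- evaluation at t. Likewise m below gives the true coordinates ε/r of a vector, and B is the
  -- matrix of b in the basis e.
  let p : I →ₗ[R] S := (LinearMap.mulRight R ρ) ∘ₗ Algebra.linearMap R S ∘ₗ F.τ
  let n : Module.Dual R I →ₗ[R] S := Algebra.linearMap R S ∘ₗ Module.Dual.eval R I F.t
  have hp : ∀ s, p s = algebraMap R S (F.τ s) * ρ := fun s => rfl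
  have hn : ∀ f, n f = algebraMap R S (f F.t) := fun f => rfl
  have hpn : ∀ s f, p s * n f = algebraMap R S (f s) := fun s f => by
    have h1 := congrArg f (F.expand s)
    simp only [map_smul, smul_eq_mul] at h1
    rw [hp, hn, mul_right_comm, ← map_mul, ← h1, map_mul, mul_right_comm, hr, one_mul]
  let m : M →ₗ[R] (Fin 3 → S) :=
    LinearMap.pi fun i => (LinearMap.mulRight R ρ) ∘ₗ Algebra.linearMap R S ∘ₗ F.ε i
  have hm : ∀ x i, m x i = algebraMap R S (F.ε i x) * ρ := fun x i => rfl
  let B : LinearMap.BilinForm S (Fin 3 → S) :=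
    Matrix.toBilin' (Matrix.of fun i j => p (b (F.e i) (F.e j)))
  have hB : ∀ x y, B (m x) (m y) = p (b x y) := fun x y => by
    have h1 : p (b (r • x) (r • y)) = algebraMap R S r * algebraMap R S r * p (b x y) := by
      simp only [map_smul, LinearMap.smul_apply, Algebra.smul_def, mul_assoc]
    have h2 : p (b x y) = ρ * ρ * p (b (r • x) (r • y)) := by
      rw [h1]; linear_combination (-(algebraMap R S r * ρ * p (b x y)) - p (b x y)) * hr
    rw [h2, F.isFrame.expand x, F.isFrame.expand y]
    simp only [B, Matrix.toBilin'_apply, Fin.sum_univ_three, hm, Matrix.of_apply, map_add,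
      LinearMap.add_apply, map_smul, LinearMap.smul_apply, Algebra.smul_def]
    ring
  let Q : QuadraticForm S (Fin 3 → S) := LinearMap.BilinMap.toQuadraticMap B
  have hQ : ∀ v, Q v = B v v := fun v => rfl
  obtain ⟨Φ, hΦ, hΦ'⟩ := exists_cliff_lift q (A := CliffordAlgebra Q) p n hpn
    ((CliffordAlgebra.ι Q).restrictScalars R ∘ₗ m) fun x => by
      simp only [LinearMap.comp_apply, LinearMap.restrictScalars_apply,
        CliffordAlgebra.ι_sq_scalar, hQ, hB, hb]
  -- Changing the form by -B turns the Clifford algebra of Q into the exterior algebra, linearly,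
  -- and takes the product of v and w to v ∧ w + B(v,w).
  have hBQ : (-B).toQuadraticMap = (0 : QuadraticForm S (Fin 3 → S)) - Q := by
    ext v; simp [hQ]
  -- The functional on the exterior algebra is c in degree 0, κ in degree 2 and zero in the other
  -- degrees.
  let g : ∀ i, (Fin 3 → S) [⋀^Fin i]→ₗ[S] S := fun i => match i with
    | 0 => AlternatingMap.constOfIsEmpty S (Fin 3 → S) (Fin 0) c
    | 2 => κ
    | _ => 0
  let Θ₀ : CliffordAlgebra Q →ₗ[S] S :=
    (ExteriorAlgebra.liftAlternating g : ExteriorAlgebra S (Fin 3 → S) →ₗ[S] S) ∘ₗ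
      CliffordAlgebra.changeForm hBQ
  have h1 : Θ₀ 1 = c := by
    simp only [Θ₀, LinearMap.comp_apply, CliffordAlgebra.changeForm_one]
    exact (ExteriorAlgebra.liftAlternating_one g)
  have h2 : ∀ v w, Θ₀ (CliffordAlgebra.ι Q v * CliffordAlgebra.ι Q w) = κ ![v, w] + B v w * c := by
    intro v w
    have e1 : ExteriorAlgebra.liftAlternating g
        (ExteriorAlgebra.ι S v * ExteriorAlgebra.ι S w) = κ ![v, w] := by
      have := ExteriorAlgebra.liftAlternating_apply_ιMulti g ![v, w]
      simpa [ExteriorAlgebra.ιMulti_apply, g] using this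
    have e2 := ExteriorAlgebra.liftAlternating_algebraMap g (-B v w)
    simp only [Θ₀, LinearMap.comp_apply, CliffordAlgebra.changeForm_ι_mul_ι]
    rw [map_sub]
    refine (congrArg₂ (· - ·) e1 e2).trans ?_
    simp [g]
  refine ⟨Θ₀.restrictScalars R ∘ₗ Φ.toLinearMap, ?_, fun x y f => ?_⟩
  · simp [h1]
  · have h3 : κ ![m x, m y] = ρ ^ 2 *
        κ ![fun i => algebraMap R S (F.ε i x), fun i => algebraMap R S (F.ε i y)] := by
      have := κ.toMultilinearMap.map_smul_univ (fun _ => ρ)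
        ![fun i => algebraMap R S (F.ε i x), fun i => algebraMap R S (F.ε i y)]
      simp only [AlternatingMap.coe_multilinearMap, Finset.prod_const, Finset.card_univ,
        Fintype.card_fin, smul_eq_mul] at this
      rw [← this]
      congr 1
      ext i j
      fin_cases i <;> simp [hm, mul_comm]
    simp only [LinearMap.comp_apply, LinearMap.restrictScalars_apply, AlgHom.toLinearMap_apply,
      map_mul, hΦ, hΦ', ← Algebra.commutes, ← Algebra.smul_def, map_smul, h2, hB, h3, hn,
      smul_eq_mul]
    have h4 := hpn (b x y) f
    rw [hn] at h4
    simp only [Algebra.smul_def]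
    rw [← h4]; ring

theorem evenMk_coe (x y : M) (f : Module.Dual R I) :
    (evenMk q x y f : Cliff q) = cliffVec q x * cliffVec q y * cliffNeg q f := rfl

/-- The trilinear map `(x, y, f) ↦ x y f`. -/
def evenTri : M →ₗ[R] M →ₗ[R] Module.Dual R I →ₗ[R] evenClifford q :=
  LinearMap.mk₂ R (fun x y =>
    { toFun := fun f => evenMk q x y f
      map_add' := fun f g => Subtype.ext <| by simp [evenMk_coe, mul_add]
      map_smul' := fun c f => Subtype.ext <| by simp [evenMk_coe] })
    (fun x x' y => LinearMap.ext fun f => Subtype.ext <| by simp [evenMk_coe, add_mul])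
    (fun c x y => LinearMap.ext fun f => Subtype.ext <| by simp [evenMk_coe])
    (fun x y y' => LinearMap.ext fun f => Subtype.ext <| by simp [evenMk_coe, add_mul, mul_add])
    (fun c x y => LinearMap.ext fun f => Subtype.ext <| by simp [evenMk_coe])

theorem evenTri_apply (x y : M) (f : Module.Dual R I) : evenTri q x y f = evenMk q x y f := rfl

/-- The relations of the even Clifford algebra, for a trilinear map `β(x, y, f) = x y f`. -/
structure IsEvenMap {A : Type*} [Ring A] [Algebra R A]
    (β : M →ₗ[R] M →ₗ[R] Module.Dual R I →ₗ[R] A) : Prop where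
  sq : ∀ x f, β x x f = algebraMap R A (f (q x))
  mul : ∀ x y z f g, β x y f * β y z g = f (q y) • β x z g

theorem evenTri_isEvenMap : IsEvenMap q (evenTri q) where
  sq x f := Subtype.ext <| by
    rw [evenTri_apply, evenMk_coe, cliffVec_sq, cliffPos_mul_cliffNeg]; rfl
  mul x y z f g := Subtype.ext <| by
    simp only [evenTri_apply, MulMemClass.coe_mul, evenMk_coe]
    have : cliffVec q x * cliffVec q y * cliffNeg q f * (cliffVec q y * cliffVec q z * cliffNeg q g)
        = (cliffPos q (q y) * cliffNeg q f) * (cliffVec q x * cliffVec q z * cliffNeg q g) := by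
      rw [← cliffVec_sq, mul_assoc _ (cliffNeg q f), (cliffNeg_commute q f _).eq]
      have h1 := (cliffPos_commute q (q y) (cliffVec q x)).eq
      rw [← cliffVec_sq] at h1
      have h2 := (cliffNeg_commute q f (cliffVec q x * cliffVec q z * cliffNeg q g)).eq
      rw [mul_assoc _ (cliffNeg q f), h2, ← mul_assoc _ _ (cliffNeg q f),
        ← mul_assoc _ _ (cliffNeg q f)]
      congr 1
      rw [← mul_assoc, ← mul_assoc, ← mul_assoc, ← mul_assoc, h1, ← mul_assoc]
    rw [this, cliffPos_mul_cliffNeg, ← Algebra.smul_def]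
    rfl

variable {q} in
theorem IsEvenMap.swap {A : Type*} [Ring A] [Algebra R A]
    {β : M →ₗ[R] M →ₗ[R] Module.Dual R I →ₗ[R] A} (h : IsEvenMap q β) (x y : M)
    (f : Module.Dual R I) :
    β y x f = algebraMap R A (f (QuadraticMap.polar q x y)) - β x y f := by
  have := h.sq (x + y) f
  simp only [map_add, LinearMap.add_apply, h.sq] at this
  rw [QuadraticMap.polar, map_sub, map_sub, map_sub, map_sub, ← this]
  abel

/-- The linear map `R ⊕ (⋀² M ⊗ I^∨) → A` attached to a bilinear map `b` with
`b(x,x) = q(x)`, which takes `(a, x ∧ y ⊗ f)` to `a + β(x,y,f) - f(b(x,y))`. -/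
def evenOfBilin {A : Type*} [Ring A] [Algebra R A]
    {β : M →ₗ[R] M →ₗ[R] Module.Dual R I →ₗ[R] A} (h : IsEvenMap q β)
    (b : LinearMap.BilinMap R M I) (hb : ∀ x, b x x = q x) :
    R × (⋀[R]^2 M ⊗[R] Module.Dual R I) →ₗ[R] A :=
  (Algebra.linearMap R A).coprod <| TensorProduct.lift <|
    wedge₂Lift (LinearMap.mk₂ R
      (fun x y => β x y - Algebra.linearMap R A ∘ₗ Module.Dual.eval R I (b x y))
      (fun x x' y => by
        ext f
        simp only [map_add, LinearMap.add_apply, LinearMap.sub_apply, LinearMap.comp_apply]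
        abel)
      (fun c x y => by
        ext f
        simp only [map_smul, LinearMap.smul_apply, LinearMap.sub_apply, LinearMap.comp_apply,
          smul_sub])
      (fun x y y' => by
        ext f
        simp only [map_add, LinearMap.add_apply, LinearMap.sub_apply, LinearMap.comp_apply]
        abel)
      (fun c x y => by
        ext f
        simp only [map_smul, LinearMap.smul_apply, LinearMap.sub_apply, LinearMap.comp_apply,
          smul_sub])) fun x => by
        ext f : 1
        change β x x f - algebraMap R _ (f (b x x)) = 0
        rw [h.sq, hb, sub_self]

theorem evenOfBilin_apply {A : Type*} [Ring A] [Algebra R A]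
    {β : M →ₗ[R] M →ₗ[R] Module.Dual R I →ₗ[R] A} (h : IsEvenMap q β)
    (b : LinearMap.BilinMap R M I) (hb : ∀ x, b x x = q x) (a : R) (x y : M)
    (f : Module.Dual R I) : evenOfBilin q h b hb (a, wedge₂ x y ⊗ₜ[R] f) =
      algebraMap R _ a + (β x y f - algebraMap R _ (f (b x y))) := by
  simp only [evenOfBilin, LinearMap.coprod_apply, TensorProduct.lift.tmul, wedge₂Lift_apply]
  rfl

theorem evenOfBilin_inl {A : Type*} [Ring A] [Algebra R A]
    {β : M →ₗ[R] M →ₗ[R] Module.Dual R I →ₗ[R] A} (h : IsEvenMap q β)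
    (b : LinearMap.BilinMap R M I) (hb : ∀ x, b x x = q x) (a : R) :
    evenOfBilin q h b hb (a, 0) = algebraMap R A a := by
  simp [evenOfBilin]

/-- The trilinear map `β` identifies `A` with the even Clifford algebra. -/
structure IsEvenClifford {A : Type*} [Ring A] [Algebra R A]
    (β : M →ₗ[R] M →ₗ[R] Module.Dual R I →ₗ[R] A) : Prop extends IsEvenMap q β where
  bijective : ∀ (b : LinearMap.BilinMap R M I) (hb : ∀ x, b x x = q x),
    Function.Bijective (evenOfBilin q toIsEvenMap b hb)

theorem evenOfBilin_surjective (h : IsTernary R M I) (b : LinearMap.BilinMap R M I)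
    (hb : ∀ x, b x x = q x) :
    Function.Surjective (evenOfBilin q (evenTri_isEvenMap q) b hb) := by
  rw [← LinearMap.range_eq_top, eq_top_iff]
  refine (evenClifford_span h).symm.trans_le (Submodule.span_le.2 ?_)
  rintro _ (rfl | ⟨x, y, f, rfl⟩)
  · exact ⟨(1, 0), by simp [evenOfBilin]⟩
  · exact ⟨(f (b x y), wedge₂ x y ⊗ₜ[R] f), by
      rw [evenOfBilin_apply, evenTri_apply, add_sub_cancel]⟩

/-- The functionals of `exists_cliff_functional` separate the summands: c = 1, κ = 0 reads off a,
and c = 0 with κ a 2 × 2 minor reads off a coordinate of ω. So for each r some power of r kills (a,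
ω). -/
theorem evenOfBilin_injective (h : IsTernary R M I) (b : LinearMap.BilinMap R M I)
    (hb : ∀ x, b x x = q x) : Function.Injective (evenOfBilin q (evenTri_isEvenMap q) b hb) := by
  rw [injective_iff_map_eq_zero]
  rintro ⟨a, ω⟩ hz
  refine eq_zero_of_local (R := R) (Y := R × (⋀[R]^2 M ⊗[R] Module.Dual R I)) h.span_frameSet
    (a, ω) ?_
  rintro r ⟨F⟩
  let S := Localization.Away r
  have hI := (isFrame_one F.expand F.pair).dual
  have hW := F.isFrame.exteriorPower_two.tmul hI.expand_one hI.pair_one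
  -- The value f(b(x,y)) c of the functional on xyf cancels against the correction term in
  -- `evenOfBilin`, so the contributions of a and ω are decoupled.
  have key : ∀ (c d : S) (i j : Fin 3), ∃ Θ : evenClifford q →ₗ[R] S,
      ∀ (a' : R) (ω' : ⋀[R]^2 M ⊗[R] Module.Dual R I),
      Θ (evenOfBilin q (evenTri_isEvenMap q) b hb (a', ω')) = algebraMap R S a' * c +
        d * (IsLocalization.Away.invSelf r : S) ^ 2 * algebraMap R S ((LinearMap.mul' R R ∘ₗ
          TensorProduct.map (minor (F.ε i) (F.ε j)) (Module.Dual.eval R I F.t)) ω') := by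
    intro c d i j
    obtain ⟨Θ, hΘ1, hΘ⟩ := exists_cliff_functional q F S b hb c
      (d • (minor (LinearMap.proj i) (LinearMap.proj j)).compAlternatingMap
        (exteriorPower.ιMulti S 2 (M := Fin 3 → S)))
    refine ⟨Θ ∘ₗ (evenClifford q).val.toLinearMap, fun a' ω' => ?_⟩
    have h1 : (Θ ∘ₗ (evenClifford q).val.toLinearMap) ∘ₗ evenOfBilin q (evenTri_isEvenMap q) b hb ∘ₗ
        LinearMap.inr R R _ = LinearMap.mulLeft R (d * IsLocalization.Away.invSelf r ^ 2 : S) ∘ₗ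
          Algebra.linearMap R S ∘ₗ LinearMap.mul' R R ∘ₗ
            TensorProduct.map (minor (F.ε i) (F.ε j)) (Module.Dual.eval R I F.t) := by
      refine TensorProduct.ext (wedge₂_ext (R := R) fun x y => LinearMap.ext fun f => ?_)
      have h2 : Θ (algebraMap R (Cliff q) (f (b x y))) = algebraMap R S (f (b x y)) * c := by
        rw [Algebra.algebraMap_eq_smul_one, map_smul, hΘ1, Algebra.smul_def]
      have h3 : Θ ((evenOfBilin q (evenTri_isEvenMap q) b hb (0, wedge₂ x y ⊗ₜ[R] f) : evenClifford q) : Cliff q) =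
          Θ (cliffVec q x * cliffVec q y * cliffNeg q f) -
            Θ (algebraMap R (Cliff q) (f (b x y))) := by
        rw [evenOfBilin_apply, map_zero, zero_add, ← map_sub]
        rfl
      refine h3.trans ?_
      rw [hΘ, h2, add_sub_cancel_left, AlternatingMap.smul_apply,
        LinearMap.compAlternatingMap_apply, ← wedge₂_apply,
        minor_apply]
      change _ = d * IsLocalization.Away.invSelf r ^ 2 *
        algebraMap R S (minor (F.ε i) (F.ε j) (wedge₂ x y) * f F.t)
      rw [minor_apply]
      simp only [LinearMap.coe_proj, Function.eval, map_mul, map_sub, smul_eq_mul]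
      ring
    have h4 := LinearMap.congr_fun h1 ω'
    have h5 : (a', ω') = a' • (1, 0) + (LinearMap.inr R R _) ω' := by simp
    rw [h5, map_add, map_add, map_smul, map_smul]
    refine congrArg₂ (· + ·) ?_ h4
    have : evenOfBilin q (evenTri_isEvenMap q) b hb (1, 0) = 1 := by simp [evenOfBilin]
    rw [this, ← hΘ1, ← Algebra.smul_def]
    rfl
  have hu : IsUnit (IsLocalization.Away.invSelf r ^ 2 : S) :=
    (IsUnit.of_mul_eq_one _ ((mul_comm _ _).trans (IsLocalization.Away.mul_invSelf r))).pow 2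
  have hpow : ∀ x : R, algebraMap R S x = 0 → ∃ k : ℕ, r ^ k * x = 0 := fun x hx => by
    obtain ⟨⟨_, k, rfl⟩, hk⟩ := (IsLocalization.map_eq_zero_iff (Submonoid.powers r) S x).1 hx
    exact ⟨k, hk⟩
  have h0 : ∃ k : ℕ, r ^ k * a = 0 := by
    obtain ⟨Θ, hΘ⟩ := key 1 0 0 0
    refine hpow _ ?_
    simpa [hz] using (hΘ a ω).symm
  have h1 : ∀ i j, ∃ k : ℕ, r ^ k * (LinearMap.mul' R R ∘ₗ
      TensorProduct.map (minor (F.ε i) (F.ε j)) (Module.Dual.eval R I F.t)) ω = 0 := by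
    intro i j
    obtain ⟨Θ, hΘ⟩ := key 0 1 i j
    refine hpow _ ?_
    have := hΘ a ω
    rw [hz, map_zero, mul_zero, zero_add, one_mul] at this
    exact (hu.mul_right_eq_zero).1 this.symm
  obtain ⟨k, hk⟩ := h0
  choose l hl using h1
  -- The exponent k kills a, the exponents l kill the three coordinates of ω, and 3 is the cost of
  -- expanding ω in the frame of ⋀²M ⊗ I^∨, with denominator r² · r.
  refine ⟨k + (l 1 2 + l 2 0 + l 0 1) + 3, ?_⟩
  rw [Prod.smul_mk, Prod.mk_eq_zero]
  constructor
  · rw [smul_eq_mul, show r ^ (k + (l 1 2 + l 2 0 + l 0 1) + 3) * a =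
      r ^ (l 1 2 + l 2 0 + l 0 1 + 3) * (r ^ k * a) by ring, hk, mul_zero]
  · have h2 := hW.expand ω
    rw [← pow_succ] at h2
    rw [pow_add, mul_smul, h2]
    have h3 : ∀ i j, ∀ n, l i j ≤ n → ∀ w : ⋀[R]^2 M ⊗[R] Module.Dual R I,
        r ^ n • (LinearMap.mul' R R ∘ₗ
          TensorProduct.map (minor (F.ε i) (F.ε j)) (Module.Dual.eval R I F.t)) ω • w = 0 := by
      intro i j n hn w
      rw [smul_smul, ← Nat.sub_add_cancel hn, pow_add, mul_assoc, hl, mul_zero, zero_smul]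
    simp only [Fin.sum_univ_three, smul_add]
    refine (congrArg₂ (· + ·) (congrArg₂ (· + ·) (h3 1 2 _ ?_ _) (h3 2 0 _ ?_ _))
      (h3 0 1 _ ?_ _)).trans (by simp) <;> omega

theorem evenTri_isEvenClifford (h : IsTernary R M I) : IsEvenClifford q (evenTri q) where
  toIsEvenMap := evenTri_isEvenMap q
  bijective b hb := ⟨evenOfBilin_injective q h b hb, evenOfBilin_surjective q h b hb⟩

end CliffStructure

end

end TernaryQuaternion

namespace TernaryQuaternion

noncomputable section

/-! ### Multiplication tables and frames of quaternion rings -/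

section Frames

variable {R : Type*} [CommRing R]
variable {X Y Z : Type*} [AddCommMonoid X] [Module R X] [AddCommMonoid Y] [Module R Y]
  [AddCommMonoid Z] [Module R Z]

theorem IsFrame.ext₂ {n m : ℕ} {r s : R} {e : Fin n → X} {ε : Fin n → Module.Dual R X}
    (h : IsFrame r e ε) {e' : Fin m → Y} {ε' : Fin m → Module.Dual R Y} (h' : IsFrame s e' ε')
    (f g : X →ₗ[R] Y →ₗ[R] Z) (hfg : ∀ i j, f (e i) (e' j) = g (e i) (e' j)) (x : X) (y : Y) :
    (r * s) • f x y = (r * s) • g x y := by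
  have : ∀ f : X →ₗ[R] Y →ₗ[R] Z, (r * s) • f x y = f (r • x) (s • y) := fun f => by
    simp [smul_smul, mul_comm]
  rw [this, this, h.expand, h'.expand]
  simp only [map_sum, map_smul, LinearMap.sum_apply, LinearMap.smul_apply, hfg]

theorem IsFrame.ext {n : ℕ} {r : R} {e : Fin n → X} {ε : Fin n → Module.Dual R X}
    (h : IsFrame r e ε) (f g : X →ₗ[R] Y) (hfg : ∀ i, f (e i) = g (e i)) (x : X) :
    r • f x = r • g x := by
  rw [← map_smul, ← map_smul, h.expand]
  simp only [map_sum, map_smul, hfg]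

end Frames

/-- The multiplication table of a quaternion ring with basis `1, i, j, k`. -/
structure QuatTable {R B : Type*} [CommRing R] [Ring B] [Algebra R B] (i j k : B)
    (a b c u v w : R) : Prop where
  ii : i * i = u • i - (b * c) • (1 : B)
  jj : j * j = v • j - (a * c) • (1 : B)
  kk : k * k = w • k - (a * b) • (1 : B)
  jk : j * k = (a * u) • (1 : B) - a • i
  ki : k * i = (b * v) • (1 : B) - b • j
  ij : i * j = (c * w) • (1 : B) - c • k
  kj : k * j = a • i + w • j + v • k - (v * w) • (1 : B)
  ik : i * k = b • j + u • k + w • i - (w * u) • (1 : B)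
  ji : j * i = c • k + v • i + u • j - (u * v) • (1 : B)

section Even

variable {R : Type u} [CommRing R]
variable {I : Type u} [AddCommGroup I] [Module R I]
variable {M : Type u} [AddCommGroup M] [Module R M]
variable {q : QuadraticMap R M I}
variable {A : Type*} [Ring A] [Algebra R A]
variable {β : M →ₗ[R] M →ₗ[R] Module.Dual R I →ₗ[R] A}

/-- Replace one factor xyf by its conjugate, using xyf = f(polar) - yxf; the product of xyf and yxf
is the scalar f(q(x)) f(q(y)). -/
theorem IsEvenMap.mul_self (h : IsEvenMap q β) (x y : M) (f : Module.Dual R I) :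
    β x y f * β x y f = f (QuadraticMap.polar q x y) • β x y f - (f (q x) * f (q y)) • (1 : A) := by
  have h1 : β x y f = f (QuadraticMap.polar q x y) • (1 : A) - β y x f := by
    rw [h.swap x y, Algebra.algebraMap_eq_smul_one, sub_sub_cancel]
  conv_lhs => rhs; rw [h1]
  rw [mul_sub, h.mul, h.sq, mul_smul_comm, mul_one, Algebra.algebraMap_eq_smul_one, smul_smul,
    mul_comm (f (q y))]

theorem IsEvenMap.mul_next (h : IsEvenMap q β) (x y z : M) (f : Module.Dual R I) :
    β x y f * β y z f = (f (q y) * f (QuadraticMap.polar q z x)) • (1 : A) - f (q y) • β z x f := by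
  rw [h.mul, h.swap z x, Algebra.algebraMap_eq_smul_one, smul_sub, smul_smul]

/-- Swapping the vectors in both factors brings the two y's next to each other, where they multiply
to q(y). -/
theorem IsEvenMap.mul_prev (h : IsEvenMap q β) (x y z : M) (f : Module.Dual R I) :
    β y z f * β x y f = f (q y) • β z x f + f (QuadraticMap.polar q y z) • β x y f +
      f (QuadraticMap.polar q x y) • β y z f -
        (f (QuadraticMap.polar q x y) * f (QuadraticMap.polar q y z)) • (1 : A) := by
  have h1 : ∀ x y, β x y f = f (QuadraticMap.polar q x y) • (1 : A) - β y x f := fun x y => by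
    rw [h.swap x y, Algebra.algebraMap_eq_smul_one, sub_sub_cancel]
  rw [h1 y z, h1 x y]
  simp only [mul_sub, sub_mul, h.mul, smul_mul_assoc, mul_smul_comm, mul_one, one_mul]
  module

theorem IsEvenMap.table (h : IsEvenMap q β) (e : Fin 3 → M) (τ : Module.Dual R I) :
    QuatTable (β (e 1) (e 2) τ) (β (e 2) (e 0) τ) (β (e 0) (e 1) τ)
      (τ (q (e 0))) (τ (q (e 1))) (τ (q (e 2)))
      (τ (QuadraticMap.polar q (e 1) (e 2))) (τ (QuadraticMap.polar q (e 2) (e 0)))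
      (τ (QuadraticMap.polar q (e 0) (e 1))) where
  ii := h.mul_self _ _ _
  jj := by rw [h.mul_self, mul_comm]
  kk := h.mul_self _ _ _
  jk := h.mul_next _ _ _ _
  ki := h.mul_next _ _ _ _
  ij := h.mul_next _ _ _ _
  kj := by rw [h.mul_prev]
  ik := by rw [h.mul_prev]
  ji := by rw [h.mul_prev]

/-- The elements `1, i, j, k` attached to a frame. -/
abbrev quatBasis {B : Type*} [One B] (i j k : B) : Fin 4 → B := ![1, i, j, k]

/-- Transport of the frame of R ⊕ (⋀²M ⊗ I^∨) along `evenOfBilin`. The auxiliary b affects only θ₀;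
the other three forms are the cross product coordinates. -/
theorem IsEvenClifford.exists_frame [Module.Projective R M] (h : IsEvenClifford q β) {r : R}
    (F : TernaryFrame R M I r) : ∃ θ : Fin 4 → Module.Dual R A,
      IsFrame (r ^ 3)
        (quatBasis (β (F.e 1) (F.e 2) F.τ) (β (F.e 2) (F.e 0) F.τ) (β (F.e 0) (F.e 1) F.τ)) θ ∧
      ∀ x y f, θ 1 (β x y f) = (F.ε 1 x * F.ε 2 y - F.ε 2 x * F.ε 1 y) * f F.t ∧
        θ 2 (β x y f) = (F.ε 2 x * F.ε 0 y - F.ε 0 x * F.ε 2 y) * f F.t ∧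
        θ 3 (β x y f) = (F.ε 0 x * F.ε 1 y - F.ε 1 x * F.ε 0 y) * f F.t := by
  obtain ⟨b, hb⟩ := exists_bilinMap q
  replace hb : ∀ x, b x x = q x := fun x => by rw [← hb]; rfl
  let σ := LinearEquiv.ofBijective _ (h.bijective b hb)
  have hσ : ∀ a x y f, σ (a, wedge₂ x y ⊗ₜ[R] f) =
      algebraMap R _ a + (β x y f - algebraMap R _ (f (b x y))) := evenOfBilin_apply q h.toIsEvenMap b hb
  have hI := (isFrame_one F.expand F.pair).dual
  have hW := F.isFrame.exteriorPower_two.tmul hI.expand_one hI.pair_one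
  rw [← pow_succ] at hW
  generalize hμ : (fun i => LinearMap.mul' R R ∘ₗ
    TensorProduct.map (![minor (F.ε 1) (F.ε 2), minor (F.ε 2) (F.ε 0), minor (F.ε 0) (F.ε 1)] i)
      ((Module.Dual.eval R I) F.t)) = μ at hW
  have hsymm : ∀ x y f, σ.symm (β x y f) = (f (b x y), wedge₂ x y ⊗ₜ[R] f) := fun x y f => by
    rw [LinearEquiv.symm_apply_eq, hσ, add_sub_cancel]
  have hone : ∀ a, σ (a, 0) = algebraMap R A a := evenOfBilin_inl q h.toIsEvenMap b hb
  have hsymm1 : σ.symm 1 = (1, 0) := by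
    rw [LinearEquiv.symm_apply_eq, hone, map_one]
  have hμ0 : ∀ x y f, μ 0 (wedge₂ x y ⊗ₜ f) = (F.ε 1 x * F.ε 2 y - F.ε 2 x * F.ε 1 y) * f F.t :=
    fun x y f => by simp [← hμ]
  have hμ1 : ∀ x y f, μ 1 (wedge₂ x y ⊗ₜ f) = (F.ε 2 x * F.ε 0 y - F.ε 0 x * F.ε 2 y) * f F.t :=
    fun x y f => by simp [← hμ]
  have hμ2 : ∀ x y f, μ 2 (wedge₂ x y ⊗ₜ f) = (F.ε 0 x * F.ε 1 y - F.ε 1 x * F.ε 0 y) * f F.t :=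
    fun x y f => by simp [← hμ]
  -- In R ⊕ (⋀²M ⊗ I^∨) the elements i, j, k have the scalar parts τ(b(e₁,e₂)), τ(b(e₂,e₀)),
  -- τ(b(e₀,e₁)). The subtracted terms make θ₀ vanish on them.
  let θ₀ : Module.Dual R A := (r ^ 3 • LinearMap.fst R R _ -
    (F.τ (b (F.e 1) (F.e 2)) • μ 0 + F.τ (b (F.e 2) (F.e 0)) • μ 1 +
      F.τ (b (F.e 0) (F.e 1)) • μ 2) ∘ₗ LinearMap.snd R R _) ∘ₗ σ.symm.toLinearMap
  have hθ₀ : ∀ x, θ₀ x = r ^ 3 * (σ.symm x).1 - (F.τ (b (F.e 1) (F.e 2)) * μ 0 (σ.symm x).2 +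
    F.τ (b (F.e 2) (F.e 0)) * μ 1 (σ.symm x).2 + F.τ (b (F.e 0) (F.e 1)) * μ 2 (σ.symm x).2) :=
    fun x => rfl
  let θ : Fin 3 → Module.Dual R A := fun i => μ i ∘ₗ LinearMap.snd R R _ ∘ₗ σ.symm.toLinearMap
  have hθ : ∀ i x, θ i x = μ i (σ.symm x).2 := fun i x => rfl
  have hp := F.isFrame.pair
  refine ⟨![θ₀, θ 0, θ 1, θ 2], ⟨fun x => ?_, fun m n => ?_⟩, fun x y f => ?_⟩
  · obtain ⟨⟨a, ω⟩, rfl⟩ := σ.surjective x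
    have h1 : r ^ 3 • σ (a, ω) = σ (r ^ 3 * a, 0) + σ (0, r ^ 3 • ω) := by
      rw [← map_smul, ← map_add]; simp
    have h2 : ∀ (c : R) (x y : M), σ (0, c • (wedge₂ (R := R) x y ⊗ₜ[R] F.τ)) =
        c • β x y F.τ - (c * F.τ (b x y)) • (1 : A) := fun c x y => by
      have : ((0 : R), c • (wedge₂ (R := R) x y ⊗ₜ[R] F.τ)) =
          c • ((0 : R), wedge₂ (R := R) x y ⊗ₜ[R] F.τ) := by simp
      rw [this, map_smul, hσ, map_zero, zero_add, Algebra.algebraMap_eq_smul_one, smul_sub,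
        smul_smul]
    have h3 : ∀ ω₁ ω₂, σ (0, ω₁ + ω₂) = σ (0, ω₁) + σ (0, ω₂) := fun ω₁ ω₂ => by
      rw [← map_add]; simp
    rw [h1, hW.expand, Fin.sum_univ_three, Fin.sum_univ_four]
    simp only [Matrix.cons_val_zero, Matrix.cons_val_one, Matrix.cons_val, h3, h2, hθ₀, hθ, hone,
      LinearEquiv.symm_apply_apply, Algebra.algebraMap_eq_smul_one]
    module
  · fin_cases m <;> fin_cases n <;>
      simp [hθ₀, hθ, hsymm, hsymm1, hμ0, hμ1, hμ2, hp, F.pair] <;> ring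
  · refine ⟨?_, ?_, ?_⟩
    · exact (hθ 0 _).trans (by rw [hsymm, hμ0])
    · exact (hθ 1 _).trans (by rw [hsymm, hμ1])
    · exact (hθ 2 _).trans (by rw [hsymm, hμ2])

end Even

end

end TernaryQuaternion

namespace TernaryQuaternion

noncomputable section

/-! ### The canonical parity factorization -/

section RankOne

variable {R : Type*} [CommRing R]
variable {X Y H : Type*} [AddCommMonoid X] [Module R X] [AddCommMonoid Y] [Module R Y]
  [AddCommMonoid H] [Module R H]

/-- The pairs (a, x) with L i x = a • y i for all i form a submodule, so local solutions combine by
a partition of unity, and agreement on overlaps never has to be checked. The canonical maps (parity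
factorization, exterior form, twists) are constructed this way. -/
theorem exists_eq_of_local {ι : Type*} {S : Set R} (hS : Ideal.span S = ⊤) (L : ι → H →ₗ[R] Y)
    (y : ι → Y) (h : ∀ r ∈ S, ∃ (k : ℕ) (x : H), ∀ i, L i x = r ^ k • y i) :
    ∃ x : H, ∀ i, L i x = y i := by
  let K : Submodule R (R × H) :=
    { carrier := {z | ∀ i, L i z.2 = z.1 • y i}
      add_mem' := fun {a b} ha hb i => by
        simp only [Prod.snd_add, Prod.fst_add, map_add, ha i, hb i, add_smul]
      zero_mem' := fun i => by simp
      smul_mem' := fun c z hz i => by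
        simp only [Prod.smul_snd, Prod.smul_fst, map_smul, hz i, smul_smul, smul_eq_mul] }
  obtain ⟨x, hx⟩ := exists_of_local hS K h
  exact ⟨x, fun i => by simpa using hx i⟩

/-- A frame of rank one. -/
def IsFrame₁ (r : R) (e : X) (ε : Module.Dual R X) : Prop := (∀ x, r • x = ε x • e) ∧ ε e = r

theorem IsFrame₁.isFrame {r : R} {e : X} {ε : Module.Dual R X} (h : IsFrame₁ r e ε) :
    IsFrame r (fun _ : Fin 1 => e) (fun _ => ε) := isFrame_one h.1 h.2

theorem IsFrame.isFrame₁ {r : R} {e : Fin 1 → X} {ε : Fin 1 → Module.Dual R X}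
    (h : IsFrame r e ε) : IsFrame₁ r (e 0) (ε 0) := ⟨h.expand_one, h.pair_one⟩

theorem IsFrame₁.dual {r : R} {e : X} {ε : Module.Dual R X} (h : IsFrame₁ r e ε) :
    IsFrame₁ r ε (Module.Dual.eval R X e) := h.isFrame.dual.isFrame₁

/-- The tensor product of two linear forms. -/
abbrev tensorForm (ε : Module.Dual R X) (η : Module.Dual R Y) : Module.Dual R (X ⊗[R] Y) :=
  LinearMap.mul' R R ∘ₗ TensorProduct.map ε η

theorem IsFrame₁.tmul {r s : R} {e : X} {ε : Module.Dual R X} {l : Y} {μ : Module.Dual R Y}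
    (h : IsFrame₁ r e ε) (h' : IsFrame₁ s l μ) :
    IsFrame₁ (r * s) (e ⊗ₜ[R] l) (tensorForm ε μ) :=
  (h.isFrame.tmul h'.1 h'.2).isFrame₁

theorem bijective_of_frames₁ {S : Set R} (hS : Ideal.span S = ⊤) (f : X →ₗ[R] Y)
    (h : ∀ r ∈ S, ∃ (a b c d : ℕ) (e : X) (ε : Module.Dual R X) (y : Y) (η : Module.Dual R Y),
      IsFrame₁ (r ^ a) e ε ∧ IsFrame₁ (r ^ b) y η ∧ r ^ c • f e = r ^ d • y) :
    Function.Bijective f :=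
  bijective_of_frames hS f fun r hr => by
    obtain ⟨a, b, c, d, e, ε, y, η, he, hy, hf⟩ := h r hr
    exact ⟨1, a, b, c, d, _, _, _, _, he.isFrame, hy.isFrame, fun _ => hf⟩

/-- The contraction X^∨ ⊗ X → R takes the generator ε ⊗ e to r^k, a unit once r is inverted. -/
theorem module_invertible_of_frames {S : Set R} (hS : Ideal.span S = ⊤)
    (h : ∀ r ∈ S, ∃ (k : ℕ) (e : X) (ε : Module.Dual R X), IsFrame₁ (r ^ k) e ε) :
    Module.Invertible R X := by
  refine ⟨bijective_of_frames₁ hS (contractLeft R X) fun r hr => ?_⟩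
  obtain ⟨k, e, ε, he⟩ := h r hr
  refine ⟨k + k, 0, 0, k, _, _, 1, LinearMap.id, pow_add r k k ▸ he.dual.tmul he, ?_, ?_⟩
  · constructor <;> simp
  · simp [he.2]

end RankOne

/-! ### Top exterior powers of frames -/

section Wedge

variable {R : Type*} [CommRing R]
variable {X Y : Type*} [AddCommGroup X] [Module R X] [AddCommGroup Y] [Module R Y]

/-- The determinant of linear forms, on the exterior power. -/
abbrev wedgeForm {n : ℕ} (ε : Fin n → Module.Dual R X) : Module.Dual R (⋀[R]^n X) :=
  exteriorPower.pairingDual R X n (exteriorPower.ιMulti R n ε)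

theorem IsFrame.wedge {n : ℕ} {r : R} {e : Fin n → X} {ε : Fin n → Module.Dual R X}
    (h : IsFrame r e ε) :
    IsFrame₁ (r ^ n) (exteriorPower.ιMulti R n e) (wedgeForm ε) := by
  constructor
  · intro x
    suffices r ^ n • LinearMap.id =
        (wedgeForm ε).smulRight (exteriorPower.ιMulti R n e) from LinearMap.congr_fun this x
    apply exteriorPower.linearMap_ext
    ext1 v
    simp only [LinearMap.compAlternatingMap_apply, LinearMap.smul_apply, LinearMap.id_apply,
      LinearMap.smulRight_apply, pairing_top]
    exact h.alternating_top (exteriorPower.ιMulti R n) v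
  · rw [pairing_top, h.det]

theorem wedge_rotate_three (g : X [⋀^Fin 3]→ₗ[R] Y) (x y z : X) : g ![y, z, x] = g ![x, y, z] := by
  have h1 : ![y, z, x] = (![x, y, z] ∘ Equiv.swap 0 1) ∘ Equiv.swap (1 : Fin 3) 2 := by
    ext i; fin_cases i <;> rfl
  rw [h1, g.map_swap _ (by decide), g.map_swap _ (by decide), neg_neg]

theorem wedge_rotate_four (g : X [⋀^Fin 4]→ₗ[R] Y) (w x y z : X) :
    g ![w, z, x, y] = g ![w, x, y, z] := by
  have h1 : ![w, z, x, y] = (![w, x, y, z] ∘ Equiv.swap 1 3) ∘ Equiv.swap (2 : Fin 4) 3 := by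
    ext i; fin_cases i <;> rfl
  rw [h1, g.map_swap _ (by decide), g.map_swap _ (by decide), neg_neg]

end Wedge

/-- Meant for families starting with the element 1, whose coordinates along i, j, k vanish. -/
theorem det_four_of_row {R : Type*} [CommRing R] (A : Matrix (Fin 4) (Fin 4) R) (h1 : A 0 1 = 0)
    (h2 : A 0 2 = 0) (h3 : A 0 3 = 0) : A.det = A 0 0 * (A 1 1 * A 2 2 * A 3 3 -
      A 1 1 * A 2 3 * A 3 2 - A 1 2 * A 2 1 * A 3 3 + A 1 2 * A 2 3 * A 3 1 + A 1 3 * A 2 1 * A 3 2 -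
        A 1 3 * A 2 2 * A 3 1) := by
  rw [Matrix.det_succ_row_zero, Fin.sum_univ_four, h1, h2, h3, Matrix.det_fin_three]
  simp only [Fin.val_zero, pow_zero, one_mul, mul_zero, zero_mul, add_zero]
  rfl

section Parity

variable {R : Type u} [CommRing R] (N : TernaryModule R)

theorem TernaryModule.span_frameSet : Ideal.span (frameSet R N.M N.I) = ⊤ :=
  N.isTernary.span_frameSet

variable {N} {r : R} (F : TernaryFrame R N.M N.I r)

theorem TernaryFrame.isFrame₁ : IsFrame₁ r F.t F.τ := ⟨F.expand, F.pair⟩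

/-- The generator of `⋀³ M ⊗ (I^∨)^{⊗2}` attached to a frame. -/
def parityGen : N.parityModule := N.parityMk (F.e 0) (F.e 1) (F.e 2) F.τ F.τ

/-- The linear form on `⋀³ M ⊗ (I^∨)^{⊗2}` attached to a frame. -/
def parityForm : Module.Dual R N.parityModule :=
  tensorForm (wedgeForm F.ε)
    (tensorForm (Module.Dual.eval R N.I F.t) (Module.Dual.eval R N.I F.t))

theorem parityForm_mk (x y z : N.M) (f g : Module.Dual R N.I) :
    parityForm F (N.parityMk x y z f g) =
      (F.ε 0 x * F.ε 1 y * F.ε 2 z - F.ε 0 x * F.ε 2 y * F.ε 1 z - F.ε 1 x * F.ε 0 y * F.ε 2 z +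
        F.ε 1 x * F.ε 2 y * F.ε 0 z + F.ε 2 x * F.ε 0 y * F.ε 1 z -
          F.ε 2 x * F.ε 1 y * F.ε 0 z) * (f F.t * g F.t) := by
  simp only [parityForm, TernaryModule.parityMk, LinearMap.comp_apply, TensorProduct.map_tmul,
    LinearMap.mul'_apply, pairing_top, Matrix.det_fin_three, Matrix.of_apply,
    Module.Dual.eval_apply, Matrix.cons_val_zero, Matrix.cons_val_one, Matrix.cons_val]

theorem parity_isFrame₁ : IsFrame₁ (r ^ 5) (parityGen F) (parityForm F) := by
  have h1 := F.isFrame.wedge.tmul (F.isFrame₁.dual.tmul F.isFrame₁.dual)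
  have h2 : r ^ 3 * (r * r) = r ^ 5 := by ring
  rw [h2] at h1
  have h3 : parityGen F = exteriorPower.ιMulti R 3 F.e ⊗ₜ[R] (F.τ ⊗ₜ[R] F.τ) := by
    have : F.e = ![F.e 0, F.e 1, F.e 2] := by ext i; fin_cases i <;> rfl
    rw [parityGen, TernaryModule.parityMk, ← this]
  rw [h3]; exact h1

variable (N) in
theorem parityModule_invertible : Module.Invertible R N.parityModule := by
  refine module_invertible_of_frames N.span_frameSet ?_
  rintro r ⟨F⟩
  exact ⟨5, _, _, parity_isFrame₁ F⟩

theorem parityMk_rotate (x y z : N.M) (f g : Module.Dual R N.I) :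
    N.parityMk y z x f g = N.parityMk x y z f g := by
  rw [TernaryModule.parityMk, TernaryModule.parityMk,
    wedge_rotate_three (exteriorPower.ιMulti R 3 (M := N.M))]

theorem parityMk_self (x y : N.M) (f g : Module.Dual R N.I) :
    N.parityMk x y y f g = 0 := by
  rw [TernaryModule.parityMk, (exteriorPower.ιMulti R 3 (M := N.M)).map_eq_zero_of_eq ![x, y, y]
    (i := 1) (j := 2) rfl (by decide), TensorProduct.zero_tmul]

variable {A : Type u} [Ring A] [Algebra R A]

variable (N) in
/-- `p` satisfies the formula that defines the canonical parity factorization. -/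
def IsParity (β : N.M →ₗ[R] N.M →ₗ[R] Module.Dual R N.I →ₗ[R] A)
    (p : (N.parityModule ⊗[R] N.parityModule) ⊗[R] N.I →ₗ[R] ⋀[R]^4 A) : Prop :=
  ∀ (x x' y y' z z' : N.M) (f g h d : Module.Dual R N.I) (t : N.I),
    p ((N.parityMk x x' y' f g ⊗ₜ[R] N.parityMk y z z' h d) ⊗ₜ[R] t) -
      p ((N.parityMk x x' y f g ⊗ₜ[R] N.parityMk y' z z' h d) ⊗ₜ[R] t) =
    d t • exteriorPower.ιMulti R 4 ![1, β x x' f, β y y' g, β z z' h]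

variable {β : N.M →ₗ[R] N.M →ₗ[R] Module.Dual R N.I →ₗ[R] A}

/-- The generator of `⋀⁴ A` attached to a frame. -/
def quatTop {A : Type u} [Ring A] [Algebra R A]
    (β : N.M →ₗ[R] N.M →ₗ[R] Module.Dual R N.I →ₗ[R] A) : ⋀[R]^4 A :=
  exteriorPower.ιMulti R 4 (quatBasis (β (F.e 1) (F.e 2) F.τ) (β (F.e 2) (F.e 0) F.τ)
    (β (F.e 0) (F.e 1) F.τ))

/-- In the defining formula, take xx', yy', zz' to be e₀e₁, e₁e₂, e₂e₀. The subtracted term contains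
e₀ ∧ e₁ ∧ e₁ = 0 and the rest is symmetric up to even permutations. Hence p is determined on a local
generator. -/
theorem IsParity.apply_gen {p : (N.parityModule ⊗[R] N.parityModule) ⊗[R] N.I →ₗ[R] ⋀[R]^4 A}
    (hp : IsParity N β p) (s : N.I) :
    p ((parityGen F ⊗ₜ[R] parityGen F) ⊗ₜ[R] s) = F.τ s • quatTop F β := by
  have := hp (F.e 0) (F.e 1) (F.e 1) (F.e 2) (F.e 2) (F.e 0) F.τ F.τ F.τ F.τ s
  rw [parityMk_self, TensorProduct.zero_tmul, TensorProduct.zero_tmul, map_zero, sub_zero,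
    parityMk_rotate (F.e 0) (F.e 1) (F.e 2),
    wedge_rotate_four] at this
  exact this

theorem parity_total_isFrame₁ : IsFrame₁ (r ^ 11) ((parityGen F ⊗ₜ[R] parityGen F) ⊗ₜ[R] F.t)
    (tensorForm (tensorForm (parityForm F) (parityForm F)) F.τ) := by
  have := ((parity_isFrame₁ F).tmul (parity_isFrame₁ F)).tmul F.isFrame₁
  have h2 : r ^ 5 * r ^ 5 * r = r ^ 11 := by ring
  rwa [h2] at this

theorem IsParity.ext {p p' : (N.parityModule ⊗[R] N.parityModule) ⊗[R] N.I →ₗ[R] ⋀[R]^4 A}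
    (hp : IsParity N β p) (hp' : IsParity N β p') : p = p' := by
  refine LinearMap.ext fun x => eq_of_local N.span_frameSet ?_
  rintro r ⟨F⟩
  refine ⟨11, (parity_total_isFrame₁ F).isFrame.ext p p' (fun _ => ?_) x⟩
  rw [hp.apply_gen, hp'.apply_gen]

/-- `IsParity.apply_gen` dictates p on the generator. The general formula then says that the
determinant of three cross products x × x', y × y', z × z' is [x,x',y'][y,z,z'] - [x,x',y][y',z,z'].
-/
theorem exists_parity_linearMap (h : IsEvenClifford N.q β) : ∃ p, IsParity N β p := by
  let ι := (Fin 6 → N.M) × (Fin 4 → Module.Dual R N.I) × N.I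
  obtain ⟨p, hp⟩ := exists_eq_of_local (Y := ⋀[R]^4 A)
    (H := (N.parityModule ⊗[R] N.parityModule) ⊗[R] N.I →ₗ[R] ⋀[R]^4 A) N.span_frameSet
    (fun i : ι => LinearMap.applyₗ
      ((N.parityMk (i.1 0) (i.1 1) (i.1 3) (i.2.1 0) (i.2.1 1) ⊗ₜ[R]
        N.parityMk (i.1 2) (i.1 4) (i.1 5) (i.2.1 2) (i.2.1 3)) ⊗ₜ[R] i.2.2) - LinearMap.applyₗ
      ((N.parityMk (i.1 0) (i.1 1) (i.1 2) (i.2.1 0) (i.2.1 1) ⊗ₜ[R]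
        N.parityMk (i.1 3) (i.1 4) (i.1 5) (i.2.1 2) (i.2.1 3)) ⊗ₜ[R] i.2.2))
    (fun i => i.2.1 3 i.2.2 • exteriorPower.ιMulti R 4 ![1, β (i.1 0) (i.1 1) (i.2.1 0),
        β (i.1 2) (i.1 3) (i.2.1 1), β (i.1 4) (i.1 5) (i.2.1 2)]) (by
      rintro r ⟨F⟩
      obtain ⟨θ, hθ, hθ'⟩ := h.exists_frame F
      -- The exponent 12 = 4 · 3 comes from expanding ⋀⁴A in a frame with denominator r³. The factor
      -- r² balances θ₀(1) = r³ in the determinant against f₃(t) τ(s) = r f₃(s).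
      refine ⟨12, LinearMap.smulRight (r ^ 2 • tensorForm
        (tensorForm (parityForm F) (parityForm F)) F.τ) (quatTop F β), ?_⟩
      rintro ⟨x, f, s⟩
      have h1 := hθ.alternating_top (exteriorPower.ιMulti R 4 (M := A)) ![1, β (x 0) (x 1) (f 0),
        β (x 2) (x 3) (f 1), β (x 4) (x 5) (f 2)]
      rw [← pow_mul] at h1
      have h2 : f 3 F.t * F.τ s = r * f 3 s := by
        have := congrArg (f 3) (F.expand s)
        simp only [map_smul, smul_eq_mul] at this
        rw [this, mul_comm]
      simp only [LinearMap.sub_apply, LinearMap.applyₗ_apply_apply, LinearMap.smulRight_apply]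
      rw [smul_comm, h1, smul_smul, ← sub_smul]
      refine congrArg₂ (· • ·) ?_ rfl
      have h4 : ∀ j, θ j 1 = if j = 0 then r ^ 3 else 0 := fun j => hθ.pair j 0
      rw [det_four_of_row _ ((h4 1).trans rfl) ((h4 2).trans rfl) ((h4 3).trans rfl)]
      simp only [Matrix.of_apply, Matrix.cons_val_zero, Matrix.cons_val_one, Matrix.cons_val,
        LinearMap.smul_apply, LinearMap.comp_apply, TensorProduct.map_tmul,
        LinearMap.mul'_apply, parityForm_mk, smul_eq_mul, fun x y f => (hθ' x y f).1,
        fun x y f => (hθ' x y f).2.1, fun x y f => (hθ' x y f).2.2, h4, if_true]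
      -- The coefficient of h2 is the difference of products of 3 × 3 determinants; what remains is
      -- the polynomial identity for cross products.
      linear_combination (r ^ 2 * f 0 F.t * f 1 F.t * f 2 F.t * (
        (F.ε 0 (x 0) * F.ε 1 (x 1) * F.ε 2 (x 3) - F.ε 0 (x 0) * F.ε 2 (x 1) * F.ε 1 (x 3) -
          F.ε 1 (x 0) * F.ε 0 (x 1) * F.ε 2 (x 3) + F.ε 1 (x 0) * F.ε 2 (x 1) * F.ε 0 (x 3) +
          F.ε 2 (x 0) * F.ε 0 (x 1) * F.ε 1 (x 3) - F.ε 2 (x 0) * F.ε 1 (x 1) * F.ε 0 (x 3)) *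
        (F.ε 0 (x 2) * F.ε 1 (x 4) * F.ε 2 (x 5) - F.ε 0 (x 2) * F.ε 2 (x 4) * F.ε 1 (x 5) -
          F.ε 1 (x 2) * F.ε 0 (x 4) * F.ε 2 (x 5) + F.ε 1 (x 2) * F.ε 2 (x 4) * F.ε 0 (x 5) +
          F.ε 2 (x 2) * F.ε 0 (x 4) * F.ε 1 (x 5) - F.ε 2 (x 2) * F.ε 1 (x 4) * F.ε 0 (x 5)) -
        (F.ε 0 (x 0) * F.ε 1 (x 1) * F.ε 2 (x 2) - F.ε 0 (x 0) * F.ε 2 (x 1) * F.ε 1 (x 2) -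
          F.ε 1 (x 0) * F.ε 0 (x 1) * F.ε 2 (x 2) + F.ε 1 (x 0) * F.ε 2 (x 1) * F.ε 0 (x 2) +
          F.ε 2 (x 0) * F.ε 0 (x 1) * F.ε 1 (x 2) - F.ε 2 (x 0) * F.ε 1 (x 1) * F.ε 0 (x 2)) *
        (F.ε 0 (x 3) * F.ε 1 (x 4) * F.ε 2 (x 5) - F.ε 0 (x 3) * F.ε 2 (x 4) * F.ε 1 (x 5) -
          F.ε 1 (x 3) * F.ε 0 (x 4) * F.ε 2 (x 5) + F.ε 1 (x 3) * F.ε 2 (x 4) * F.ε 0 (x 5) +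
          F.ε 2 (x 3) * F.ε 0 (x 4) * F.ε 1 (x 5) - F.ε 2 (x 3) * F.ε 1 (x 4) * F.ε 0 (x 5)))) * h2)
  exact ⟨p, fun x x' y y' z z' f g h d t => by
    simpa using hp (![x, x', y, y', z, z'], ![f, g, h, d], t)⟩

theorem IsParity.bijective (h : IsEvenClifford N.q β)
    {p : (N.parityModule ⊗[R] N.parityModule) ⊗[R] N.I →ₗ[R] ⋀[R]^4 A} (hp : IsParity N β p) :
    Function.Bijective p := by
  refine bijective_of_frames₁ N.span_frameSet p ?_
  rintro r ⟨F⟩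
  obtain ⟨θ, hθ, -⟩ := h.exists_frame F
  refine ⟨11, 12, 0, 1, _, _, _, _, parity_total_isFrame₁ F, pow_mul r 3 4 ▸ hθ.wedge, ?_⟩
  rw [hp.apply_gen, F.pair, pow_zero, pow_one, one_smul]
  rfl

end Parity

end

end TernaryQuaternion

namespace TernaryQuaternion

noncomputable section

/-! ### Quadratic maps and frames -/

section Quadratic

variable {R : Type*} [CommRing R]
variable {X Y : Type*} [AddCommGroup X] [Module R X] [AddCommGroup Y] [Module R Y]

/-- The values on e i and e i + e j determine the polar form on the frame. -/
theorem IsFrame.quadratic_ext {n : ℕ} {r : R} {e : Fin n → X} {ε : Fin n → Module.Dual R X}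
    (h : IsFrame r e ε) (Q Q' : QuadraticMap R X Y) (h₁ : ∀ i, Q (e i) = Q' (e i))
    (h₂ : ∀ i j, i ≠ j → Q (e i + e j) = Q' (e i + e j)) (x : X) :
    r ^ 2 • Q x = r ^ 2 • Q' x := by
  have key : ∀ Q : QuadraticMap R X Y, r ^ 2 • Q x = Q (r • x) := fun Q => by
    rw [QuadraticMap.map_smul, pow_two]
  rw [key, key, h.expand, QuadraticMap.map_sum, QuadraticMap.map_sum]
  congr 1
  · exact Finset.sum_congr rfl fun i _ => by
      rw [QuadraticMap.map_smul, QuadraticMap.map_smul, h₁]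
  · refine Finset.sum_congr rfl fun z hz => ?_
    induction z with
    | _ i j =>
      have hij : i ≠ j := by simpa using (Finset.mem_filter.1 hz).2
      simp only [Sym2.map_mk, QuadraticMap.polarSym2_sym2Mk, QuadraticMap.polar_smul_left,
        QuadraticMap.polar_smul_right]
      rw [QuadraticMap.polar, QuadraticMap.polar, h₁, h₁, h₂ i j hij]

/-- Evaluation of quadratic maps. -/
def quadraticEval (x : X) : QuadraticMap R X Y →ₗ[R] Y where
  toFun Q := Q x
  map_add' _ _ := rfl
  map_smul' _ _ := rfl

@[simp]
theorem quadraticEval_apply (x : X) (Q : QuadraticMap R X Y) : quadraticEval x Q = Q x := rfl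

/-- A ternary quadratic form in three linear forms. -/
def ternaryForm (a b c u v w : R) (n₁ n₂ n₃ : Module.Dual R X) : QuadraticMap R X R :=
  a • QuadraticMap.linMulLin n₁ n₁ + b • QuadraticMap.linMulLin n₂ n₂ +
    c • QuadraticMap.linMulLin n₃ n₃ + u • QuadraticMap.linMulLin n₂ n₃ +
    v • QuadraticMap.linMulLin n₃ n₁ + w • QuadraticMap.linMulLin n₁ n₂

theorem ternaryForm_apply (a b c u v w : R) (n₁ n₂ n₃ : Module.Dual R X) (x : X) :
    ternaryForm a b c u v w n₁ n₂ n₃ x = a * (n₁ x * n₁ x) + b * (n₂ x * n₂ x) +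
      c * (n₃ x * n₃ x) + u * (n₂ x * n₃ x) + v * (n₃ x * n₁ x) + w * (n₁ x * n₂ x) := by
  simp [ternaryForm]

end Quadratic

/-! ### Frames of quaternion rings and the canonical exterior form -/

section QuatFrame

variable {R : Type u} [CommRing R] {B : Type u} [Ring B] [Algebra R B]

/-- A frame `1, i, j, k` of a quaternion ring, with its multiplication table. -/
structure QuatFrame (B : Type u) [Ring B] [Algebra R B] (r : R) where
  i : B
  j : B
  k : B
  θ : Fin 4 → Module.Dual R B
  a : R
  b : R
  c : R
  u : R
  v : R
  w : R
  table : QuatTable i j k a b c u v w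
  isFrame : IsFrame (r ^ 3) (quatBasis i j k) θ

variable {r : R} (G : QuatFrame B r)

theorem QuatFrame.θ_one (m : Fin 3) : G.θ m.succ 1 = 0 := G.isFrame.pair m.succ 0

/-- The linear forms on `B/R` attached to a frame. -/
def QuatFrame.θBar (m : Fin 3) : Module.Dual R (ModScalars R B) :=
  (LinearMap.range (Algebra.linearMap R B)).liftQ (G.θ m.succ) (by
    rintro _ ⟨s, rfl⟩
    rw [LinearMap.mem_ker, Algebra.linearMap_apply, Algebra.algebraMap_eq_smul_one, map_smul,
      G.θ_one, smul_zero])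

theorem QuatFrame.θBar_mk (m : Fin 3) (x : B) :
    G.θBar m (Submodule.Quotient.mk x) = G.θ m.succ x := rfl

theorem QuatFrame.isFrame_bar : IsFrame (r ^ 3)
    ![(Submodule.Quotient.mk G.i : ModScalars R B), Submodule.Quotient.mk G.j,
      Submodule.Quotient.mk G.k] G.θBar where
  expand x := by
    obtain ⟨x, rfl⟩ := Submodule.Quotient.mk_surjective _ x
    have h1 : (Submodule.Quotient.mk (1 : B) : ModScalars R B) = 0 :=
      (Submodule.Quotient.mk_eq_zero _).2 ⟨1, by simp⟩
    rw [← Submodule.Quotient.mk_smul, G.isFrame.expand, Fin.sum_univ_four, Fin.sum_univ_three]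
    simp only [Submodule.Quotient.mk_add, Submodule.Quotient.mk_smul, Matrix.cons_val_zero, h1,
      smul_zero, zero_add]
    rfl
  pair m n := by
    have := G.isFrame.pair m.succ n.succ
    simp only [Fin.succ_inj] at this
    rw [← this]
    fin_cases n <;> rfl

/-- The coordinates on `⋀²(B/R)` attached to a frame. -/
def QuatFrame.coord : Fin 3 → Module.Dual R (⋀[R]^2 (ModScalars R B)) :=
  ![minor (G.θBar 1) (G.θBar 2), minor (G.θBar 2) (G.θBar 0), minor (G.θBar 0) (G.θBar 1)]

/-- The vectors `j ∧ k`, `k ∧ i`, `i ∧ j` of `⋀²(B/R)`. -/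
def QuatFrame.basis : Fin 3 → ⋀[R]^2 (ModScalars R B) :=
  ![wedge₂ (Submodule.Quotient.mk G.j) (Submodule.Quotient.mk G.k),
    wedge₂ (Submodule.Quotient.mk G.k) (Submodule.Quotient.mk G.i),
    wedge₂ (Submodule.Quotient.mk G.i) (Submodule.Quotient.mk G.j)]

theorem QuatFrame.isFrame_basis : IsFrame (r ^ 6) G.basis G.coord := by
  have := G.isFrame_bar.exteriorPower_two
  rw [← pow_mul] at this
  exact this

/-- The generator of `⋀⁴ B`. -/
def QuatFrame.top : ⋀[R]^4 B := exteriorPower.ιMulti R 4 ![1, G.i, G.j, G.k]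

theorem QuatFrame.θ_mul (x y : B) (m : Fin 4) :
    r ^ 6 * G.θ m (x * y) = G.θ m ((∑ a, G.θ a x • quatBasis G.i G.j G.k a) *
      ∑ a, G.θ a y • quatBasis G.i G.j G.k a) := by
  rw [← G.isFrame.expand, ← G.isFrame.expand, smul_mul_smul_comm, map_smul, smul_eq_mul]
  ring

/-- The determinant of 1, x, y, xy is r³ times the pairing of n, the cross product of the
coordinates of x and y, with those of xy. The multiplication table expresses xy; the multiples of x
and y in it are orthogonal to n and drop out, and the rest is the negative of the ternary form at n.
The exponent is 12 for ⋀⁴ plus 6 for expanding both factors of xy. -/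
theorem QuatFrame.exteriorForm_local (x y : B) :
    r ^ 18 • exteriorPower.ιMulti R 4 ![1, x, y, x * y] =
      (-(r ^ 6 * ternaryForm G.a G.b G.c G.u G.v G.w (G.coord 0) (G.coord 1) (G.coord 2)
        (wedge₂ (Submodule.Quotient.mk x) (Submodule.Quotient.mk y)))) • G.top := by
  have h1 := G.isFrame.alternating_top (exteriorPower.ιMulti R 4 (M := B)) ![1, x, y, x * y]
  rw [← pow_mul] at h1
  have h4 : ∀ m, G.θ m 1 = if m = 0 then r ^ 3 else 0 := fun m => G.isFrame.pair m 0
  have hi : ∀ m, G.θ m G.i = if m = 1 then r ^ 3 else 0 := fun m => G.isFrame.pair m 1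
  have hj : ∀ m, G.θ m G.j = if m = 2 then r ^ 3 else 0 := fun m => G.isFrame.pair m 2
  have hk : ∀ m, G.θ m G.k = if m = 3 then r ^ 3 else 0 := fun m => G.isFrame.pair m 3
  rw [det_four_of_row _ ((h4 1).trans rfl) ((h4 2).trans rfl) ((h4 3).trans rfl)] at h1
  rw [show r ^ 18 = r ^ 6 * r ^ (3 * 4) by ring, mul_smul, h1, smul_smul]
  have e1 := G.θ_mul x y 1
  have e2 := G.θ_mul x y 2
  have e3 := G.θ_mul x y 3
  simp only [Fin.sum_univ_four, Matrix.cons_val_zero, Matrix.cons_val_one, Matrix.cons_val,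
    add_mul, mul_add, smul_mul_assoc, mul_smul_comm, one_mul, mul_one, G.table.ii, G.table.ij,
    G.table.ik, G.table.ji, G.table.jj, G.table.jk, G.table.ki, G.table.kj, G.table.kk,
    map_add, map_sub, map_smul, smul_eq_mul, h4, hi, hj, hk, Fin.reduceEq, if_true, if_false,
    mul_zero, add_zero, zero_add, sub_zero, zero_sub] at e1 e2 e3
  refine congrArg₂ (· • ·) ?_ rfl
  simp only [Matrix.of_apply, Matrix.cons_val_zero, Matrix.cons_val_one, Matrix.cons_val, h4,
    ternaryForm_apply, QuatFrame.coord, minor_apply, QuatFrame.θBar_mk]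
  change r ^ 6 * ((if True then r ^ 3 else 0) * _) = -(r ^ 6 *
    (G.a * ((G.θ 2 x * G.θ 3 y - G.θ 3 x * G.θ 2 y) * (G.θ 2 x * G.θ 3 y - G.θ 3 x * G.θ 2 y)) +
    G.b * ((G.θ 3 x * G.θ 1 y - G.θ 1 x * G.θ 3 y) * (G.θ 3 x * G.θ 1 y - G.θ 1 x * G.θ 3 y)) +
    G.c * ((G.θ 1 x * G.θ 2 y - G.θ 2 x * G.θ 1 y) * (G.θ 1 x * G.θ 2 y - G.θ 2 x * G.θ 1 y)) +
    G.u * ((G.θ 3 x * G.θ 1 y - G.θ 1 x * G.θ 3 y) * (G.θ 1 x * G.θ 2 y - G.θ 2 x * G.θ 1 y)) +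
    G.v * ((G.θ 1 x * G.θ 2 y - G.θ 2 x * G.θ 1 y) * (G.θ 2 x * G.θ 3 y - G.θ 3 x * G.θ 2 y)) +
    G.w * ((G.θ 2 x * G.θ 3 y - G.θ 3 x * G.θ 2 y) * (G.θ 3 x * G.θ 1 y - G.θ 1 x * G.θ 3 y))))
  rw [if_true]
  linear_combination r ^ 3 * (G.θ 2 x * G.θ 3 y - G.θ 3 x * G.θ 2 y) * e1 +
    r ^ 3 * (G.θ 3 x * G.θ 1 y - G.θ 1 x * G.θ 3 y) * e2 +
    r ^ 3 * (G.θ 1 x * G.θ 2 y - G.θ 2 x * G.θ 1 y) * e3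

theorem exists_exteriorForm {S : Set R} (hS : Ideal.span S = ⊤)
    (h : ∀ r ∈ S, Nonempty (QuatFrame B r)) : 
    ∃ φ : QuadraticMap R (⋀[R]^2 (ModScalars R B)) (⋀[R]^4 B), ∀ x y : B,
      φ (wedge₂ (Submodule.Quotient.mk x : ModScalars R B) (Submodule.Quotient.mk y)) =
        exteriorPower.ιMulti R 4 ![1, x, y, x * y] := by
  obtain ⟨φ, hφ⟩ := exists_eq_of_local hS
    (H := QuadraticMap R (⋀[R]^2 (ModScalars R B)) (⋀[R]^4 B))
    (fun i : B × B => quadraticEval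
      (wedge₂ (Submodule.Quotient.mk i.1 : ModScalars R B) (Submodule.Quotient.mk i.2)))
    (fun i => exteriorPower.ιMulti R 4 ![1, i.1, i.2, i.1 * i.2]) (by
      intro r hr
      obtain ⟨G⟩ := h r hr
      refine ⟨18, -(r ^ 6 • (LinearMap.toSpanSingleton R _ G.top).compQuadraticMap
        (ternaryForm G.a G.b G.c G.u G.v G.w (G.coord 0) (G.coord 1) (G.coord 2))), ?_⟩
      rintro ⟨x, y⟩
      rw [G.exteriorForm_local]
      simp only [quadraticEval_apply, _root_.neg_apply, _root_.smul_apply,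
        LinearMap.compQuadraticMap_apply, LinearMap.toSpanSingleton_apply, smul_smul]
      exact (neg_smul _ _).symm)
  exact ⟨φ, fun x y => hφ (x, y)⟩

/-- Decomposable elements suffice because in rank three the sum of any two of j ∧ k, k ∧ i, i ∧ j is
again decomposable. -/
theorem exteriorForm_ext {S : Set R} (hS : Ideal.span S = ⊤)
    (h : ∀ r ∈ S, Nonempty (QuatFrame B r)) {Y : Type*} [AddCommGroup Y] [Module R Y]
    {φ φ' : QuadraticMap R (⋀[R]^2 (ModScalars R B)) Y}
    (hφ : ∀ x y, φ (wedge₂ x y) = φ' (wedge₂ x y)) : φ = φ' := by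
  ext ω
  refine eq_of_local hS fun r hr => ?_
  obtain ⟨G⟩ := h r hr
  refine ⟨12, ?_⟩
  rw [show r ^ 12 = (r ^ 6) ^ 2 by ring]
  refine G.isFrame_basis.quadratic_ext φ φ' (fun m => ?_) (fun m n hmn => ?_) ω
  · fin_cases m <;> exact hφ _ _
  · suffices ∃ x y, G.basis m + G.basis n = wedge₂ x y by
      obtain ⟨x, y, hxy⟩ := this
      rw [hxy, hφ]
    generalize hx : (Submodule.Quotient.mk G.i : ModScalars R B) = x
    generalize hy : (Submodule.Quotient.mk G.j : ModScalars R B) = y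
    generalize hz : (Submodule.Quotient.mk G.k : ModScalars R B) = z
    have hb : G.basis = ![wedge₂ y z, wedge₂ z x, wedge₂ x y] := by
      rw [QuatFrame.basis, hx, hy, hz]
    have h1 : wedge₂ (R := R) y z + wedge₂ z x = wedge₂ (y - x) z := by
      rw [wedge₂_swap x z, map_sub, LinearMap.sub_apply]; abel
    have h2 : wedge₂ (R := R) z x + wedge₂ x y = wedge₂ (z - y) x := by
      rw [wedge₂_swap y x, map_sub, LinearMap.sub_apply]; abel
    have h3 : wedge₂ (R := R) y z + wedge₂ x y = wedge₂ (x - z) y := by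
      rw [wedge₂_swap z y, map_sub, LinearMap.sub_apply]; abel
    rw [hb]
    fin_cases m <;> fin_cases n
    · exact absurd rfl hmn
    · exact ⟨_, _, h1⟩
    · exact ⟨_, _, h3⟩
    · exact ⟨_, _, (add_comm _ _).trans h1⟩
    · exact absurd rfl hmn
    · exact ⟨_, _, h2⟩
    · exact ⟨_, _, (add_comm _ _).trans h3⟩
    · exact ⟨_, _, (add_comm _ _).trans h2⟩
    · exact absurd rfl hmn

end QuatFrame

section Even

variable {R : Type u} [CommRing R] {M I : Type u} [AddCommGroup M] [Module R M] [AddCommGroup I]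
  [Module R I] [Module.Projective R M] {q : QuadraticMap R M I}
variable {A : Type u} [Ring A] [Algebra R A]
variable {β : M →ₗ[R] M →ₗ[R] Module.Dual R I →ₗ[R] A}

/-- The frame of the even Clifford algebra attached to a frame of the quadratic module. -/
def IsEvenClifford.quatFrame (h : IsEvenClifford q β) {r : R} (F : TernaryFrame R M I r) :
    QuatFrame A r where
  i := β (F.e 1) (F.e 2) F.τ
  j := β (F.e 2) (F.e 0) F.τ
  k := β (F.e 0) (F.e 1) F.τ
  θ := (h.exists_frame F).choose
  a := F.τ (q (F.e 0))
  b := F.τ (q (F.e 1))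
  c := F.τ (q (F.e 2))
  u := F.τ (QuadraticMap.polar q (F.e 1) (F.e 2))
  v := F.τ (QuadraticMap.polar q (F.e 2) (F.e 0))
  w := F.τ (QuadraticMap.polar q (F.e 0) (F.e 1))
  table := h.toIsEvenMap.table F.e F.τ
  isFrame := (h.exists_frame F).choose_spec.1

end Even

end

end TernaryQuaternion

namespace TernaryQuaternion

noncomputable section

/-! ### Twists of quadratic maps by invertible modules -/

section Twist

variable {R : Type*} [CommRing R]
variable {X Y Z L : Type*} [AddCommGroup X] [Module R X] [AddCommGroup Y] [Module R Y]
  [AddCommGroup Z] [Module R Z] [AddCommGroup L] [Module R L] [Module.Invertible R L]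

/-- Where L has a generator l with coordinate form μ, the map is Q on X followed by B(l,l), after
contraction of X ⊗ L with μ. -/
theorem exists_twist (Q : QuadraticMap R X Y) (B : L →ₗ[R] L →ₗ[R] Y →ₗ[R] Z) :
    ∃ Ψ : QuadraticMap R (X ⊗[R] L) Z, ∀ x l, Ψ (x ⊗ₜ l) = B l l (Q x) := by
  obtain ⟨Ψ, hΨ⟩ := exists_eq_of_local (span_frame_invertible R L)
    (H := QuadraticMap R (X ⊗[R] L) Z) (fun i : X × L => quadraticEval (i.1 ⊗ₜ i.2))
    (fun i => B i.2 i.2 (Q i.1)) (by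
      rintro r ⟨l, μ, hl, -⟩
      refine ⟨2, (B l l).compQuadraticMap
        (Q.comp ((TensorProduct.rid R X).toLinearMap ∘ₗ LinearMap.lTensor X μ)), ?_⟩
      rintro ⟨x, m⟩
      simp only [quadraticEval_apply, LinearMap.compQuadraticMap_apply, QuadraticMap.comp_apply,
        LinearMap.comp_apply, LinearMap.lTensor_tmul, LinearEquiv.coe_coe, TensorProduct.rid_tmul,
        QuadraticMap.map_smul, map_smul]
      have : r ^ 2 • B m m (Q x) = B (r • m) (r • m) (Q x) := by
        simp [smul_smul, pow_two]
      rw [this, hl]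
      simp [smul_smul])
  exact ⟨Ψ, fun x l => hΨ (x, l)⟩

/-- A multiple r • z is a pure tensor x ⊗ l, because L is locally generated by l. -/
theorem twist_ext {Ψ Ψ' : QuadraticMap R (X ⊗[R] L) Z} (h : ∀ x l, Ψ (x ⊗ₜ l) = Ψ' (x ⊗ₜ l)) :
    Ψ = Ψ' := by
  ext z
  refine eq_of_local (span_frame_invertible R L) ?_
  rintro r ⟨l, μ, hl, -⟩
  have key : ∃ x : X, r • z = x ⊗ₜ l := by
    induction z with
    | zero => exact ⟨0, by simp⟩
    | add a b ha hb =>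
      obtain ⟨x, hx⟩ := ha
      obtain ⟨y, hy⟩ := hb
      exact ⟨x + y, by rw [smul_add, hx, hy, TensorProduct.add_tmul]⟩
    | tmul x m => exact ⟨μ m • x, by rw [← TensorProduct.tmul_smul, hl, TensorProduct.smul_tmul]⟩
  obtain ⟨x, hx⟩ := key
  refine ⟨2, ?_⟩
  have : ∀ Ψ : QuadraticMap R (X ⊗[R] L) Z, r ^ 2 • Ψ z = Ψ (r • z) := fun Ψ => by
    rw [QuadraticMap.map_smul, pow_two]
  rw [this, this, hx, h]

end Twist

/-! ### The isomorphism ⋀²(A/R) ≅ M ⊗ (⋀³M ⊗ (I^∨)^{⊗2}), and the exterior form in coordinates -/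

section Delta

variable {R : Type u} [CommRing R] {N : TernaryModule R}
variable {A : Type u} [Ring A] [Algebra R A]
variable {β : N.M →ₗ[R] N.M →ₗ[R] Module.Dual R N.I →ₗ[R] A}

/-- In coordinates xyf is a cross product, so this is (x × y) × (x' × y') = [x,y,y'] x' - [x,y,x']
y'. -/
theorem IsEvenClifford.coord_apply (h : IsEvenClifford N.q β) {r : R}
    (F : TernaryFrame R N.M N.I r) (x y x' y' : N.M) (f g : Module.Dual R N.I) (m : Fin 3) :
    r ^ 5 * (h.quatFrame F).coord m (wedge₂ (Submodule.Quotient.mk (β x y f))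
      (Submodule.Quotient.mk (β x' y' g))) =
    r ^ 5 * (F.ε m x' * parityForm F (N.parityMk x y y' f g) -
      F.ε m y' * parityForm F (N.parityMk x y x' f g)) := by
  congr 1
  have hθ := (h.exists_frame F).choose_spec.2
  have e1 : ∀ x y f, (h.quatFrame F).θBar 0 (Submodule.Quotient.mk (β x y f)) = _ :=
    fun x y f => (hθ x y f).1
  have e2 : ∀ x y f, (h.quatFrame F).θBar 1 (Submodule.Quotient.mk (β x y f)) = _ :=
    fun x y f => (hθ x y f).2.1
  have e3 : ∀ x y f, (h.quatFrame F).θBar 2 (Submodule.Quotient.mk (β x y f)) = _ :=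
    fun x y f => (hθ x y f).2.2
  simp only [parityForm_mk]
  fin_cases m <;> simp only [QuatFrame.coord, Fin.zero_eta, Fin.mk_one, Fin.reduceFinMk,
    Matrix.cons_val_zero, Matrix.cons_val_one, Matrix.cons_val, minor_apply, e1, e2, e3] <;> ring

variable (N β) in
/-- `δ` is the isomorphism `⋀²(A/R) ≅ M ⊗ (⋀³ M ⊗ (I^∨)^{⊗2})`. -/
def IsDelta (δ : ⋀[R]^2 (ModScalars R A) →ₗ[R] N.M ⊗[R] N.parityModule) : Prop :=
  ∀ (x y x' y' : N.M) (f g : Module.Dual R N.I),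
    δ (wedge₂ (Submodule.Quotient.mk (β x y f)) (Submodule.Quotient.mk (β x' y' g))) =
      x' ⊗ₜ N.parityMk x y y' f g - y' ⊗ₜ N.parityMk x y x' f g

theorem parity_tmul_isFrame {r : R} (F : TernaryFrame R N.M N.I r) :
    IsFrame (r ^ 6) (fun m => F.e m ⊗ₜ[R] parityGen F)
      (fun m => tensorForm (F.ε m) (parityForm F)) := by
  have := F.isFrame.tmul (parity_isFrame₁ F).1 (parity_isFrame₁ F).2
  rwa [← pow_succ'] at this

theorem exists_delta (h : IsEvenClifford N.q β) : ∃ δ, IsDelta N β δ := by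
  let ι := (Fin 4 → N.M) × (Fin 2 → Module.Dual R N.I)
  obtain ⟨δ, hδ⟩ := exists_eq_of_local (Y := N.M ⊗[R] N.parityModule)
    (H := ⋀[R]^2 (ModScalars R A) →ₗ[R] N.M ⊗[R] N.parityModule) N.span_frameSet
    (fun i : ι => LinearMap.applyₗ (wedge₂ (Submodule.Quotient.mk (β (i.1 0) (i.1 1) (i.2 0)))
      (Submodule.Quotient.mk (β (i.1 2) (i.1 3) (i.2 1)))))
    (fun i => i.1 2 ⊗ₜ N.parityMk (i.1 0) (i.1 1) (i.1 3) (i.2 0) (i.2 1) -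
      i.1 3 ⊗ₜ N.parityMk (i.1 0) (i.1 1) (i.1 2) (i.2 0) (i.2 1)) (by
      rintro r ⟨F⟩
      refine ⟨11, r ^ 5 • ∑ m, ((h.quatFrame F).coord m).smulRight (F.e m ⊗ₜ[R] parityGen F), ?_⟩
      rintro ⟨x, f⟩
      rw [show r ^ 11 = r ^ 5 * r ^ 6 by ring, mul_smul, (parity_tmul_isFrame F).expand]
      simp only [LinearMap.applyₗ_apply_apply, LinearMap.smul_apply, LinearMap.sum_apply,
        LinearMap.smulRight_apply, Finset.smul_sum, smul_smul, h.coord_apply]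
      refine Finset.sum_congr rfl fun m _ => ?_
      simp only [map_sub, LinearMap.comp_apply, TensorProduct.map_tmul, LinearMap.mul'_apply])
  exact ⟨δ, fun x y x' y' f g => hδ (![x, y, x', y'], ![f, g])⟩

theorem IsDelta.apply_basis {δ : ⋀[R]^2 (ModScalars R A) →ₗ[R] N.M ⊗[R] N.parityModule}
    (hδ : IsDelta N β δ) (h : IsEvenClifford N.q β) {r : R} (F : TernaryFrame R N.M N.I r)
    (m : Fin 3) : δ ((h.quatFrame F).basis m) = F.e m ⊗ₜ parityGen F := by
  have h1 := hδ (F.e 2) (F.e 0) (F.e 0) (F.e 1) F.τ F.τ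
  have h2 := hδ (F.e 0) (F.e 1) (F.e 1) (F.e 2) F.τ F.τ
  have h3 := hδ (F.e 1) (F.e 2) (F.e 2) (F.e 0) F.τ F.τ
  rw [parityMk_self, TensorProduct.tmul_zero, sub_zero] at h1 h2 h3
  rw [← parityMk_rotate (F.e 2) (F.e 0) (F.e 1)] at h1
  rw [parityMk_rotate (F.e 0) (F.e 1) (F.e 2)] at h3
  fin_cases m
  · exact h1
  · exact h2
  · exact h3

theorem IsDelta.bijective {δ : ⋀[R]^2 (ModScalars R A) →ₗ[R] N.M ⊗[R] N.parityModule}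
    (hδ : IsDelta N β δ) (h : IsEvenClifford N.q β) : Function.Bijective δ := by
  refine bijective_of_frames N.span_frameSet δ ?_
  rintro r ⟨F⟩
  refine ⟨3, 6, 6, 0, 0, _, _, _, _, (h.quatFrame F).isFrame_basis, parity_tmul_isFrame F,
    fun m => ?_⟩
  rw [hδ.apply_basis h]

theorem TernaryFrame.q_apply {r : R} (F : TernaryFrame R N.M N.I r) (n : Fin 3 → R) :
    F.τ (N.q (∑ m, n m • F.e m)) = F.τ (N.q (F.e 0)) * (n 0 * n 0) +
      F.τ (N.q (F.e 1)) * (n 1 * n 1) + F.τ (N.q (F.e 2)) * (n 2 * n 2) +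
      F.τ (QuadraticMap.polar N.q (F.e 1) (F.e 2)) * (n 1 * n 2) +
      F.τ (QuadraticMap.polar N.q (F.e 2) (F.e 0)) * (n 2 * n 0) +
      F.τ (QuadraticMap.polar N.q (F.e 0) (F.e 1)) * (n 0 * n 1) := by
  rw [Fin.sum_univ_three, QuadraticMap.map_add N.q, QuadraticMap.map_add N.q]
  simp only [QuadraticMap.polar_add_left, QuadraticMap.polar_smul_left,
    QuadraticMap.polar_smul_right, QuadraticMap.map_smul, map_add, map_smul, smul_eq_mul]
  rw [QuadraticMap.polar_comm N.q (F.e 0) (F.e 2)]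
  ring

/-- Thus the canonical exterior form is -q up to the choice of generators. Both sides are quadratic
in ω, so `exteriorForm_ext` reduces to decomposable ω. -/
theorem IsEvenClifford.exteriorForm_apply (h : IsEvenClifford N.q β)
    {φ : QuadraticMap R (⋀[R]^2 (ModScalars R A)) (⋀[R]^4 A)}
    (hφ : IsCanonicalExteriorForm R A φ) {r : R} (F : TernaryFrame R N.M N.I r)
    (ω : ⋀[R]^2 (ModScalars R A)) : r ^ 18 • φ ω =
      (-(r ^ 6 * F.τ (N.q (∑ m, (h.quatFrame F).coord m ω • F.e m)))) • quatTop F β := by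
  have h1 : r ^ 18 • φ = -(r ^ 6 • (LinearMap.toSpanSingleton R _ (quatTop F β)).compQuadraticMap
      (ternaryForm (h.quatFrame F).a (h.quatFrame F).b (h.quatFrame F).c (h.quatFrame F).u
        (h.quatFrame F).v (h.quatFrame F).w ((h.quatFrame F).coord 0) ((h.quatFrame F).coord 1)
        ((h.quatFrame F).coord 2))) := by
    refine exteriorForm_ext N.span_frameSet (fun s ⟨F⟩ => ⟨h.quatFrame F⟩) fun x y => ?_
    obtain ⟨x, rfl⟩ := Submodule.Quotient.mk_surjective _ x
    obtain ⟨y, rfl⟩ := Submodule.Quotient.mk_surjective _ y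
    have := (h.quatFrame F).exteriorForm_local x y
    rw [← hφ x y] at this
    refine this.trans ?_
    simp only [_root_.neg_apply, _root_.smul_apply,
      LinearMap.compQuadraticMap_apply, LinearMap.toSpanSingleton_apply, smul_smul]
    exact neg_smul (M := ⋀[R]^4 A) _ _
  have h2 := DFunLike.congr_fun h1 ω
  rw [F.q_apply]
  refine h2.trans ?_
  simp only [_root_.neg_apply, _root_.smul_apply, LinearMap.compQuadraticMap_apply,
    LinearMap.toSpanSingleton_apply, smul_smul, ternaryForm_apply]
  exact (neg_smul _ _).symm

end Delta

end

end TernaryQuaternion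

namespace TernaryQuaternion

noncomputable section

/-! ### The twisted exterior form -/

section Transport

variable {R : Type u} [CommRing R] {M I : Type u} [AddCommGroup M] [Module R M] [AddCommGroup I]
  [Module R I] {q : QuadraticMap R M I}
variable {A A' : Type u} [Ring A] [Algebra R A] [Ring A'] [Algebra R A']

/-- The composite of a trilinear map with a linear map. -/
def triComp (β : M →ₗ[R] M →ₗ[R] Module.Dual R I →ₗ[R] A) (ψ : A →ₗ[R] A') :
    M →ₗ[R] M →ₗ[R] Module.Dual R I →ₗ[R] A' :=
  β.compr₂ (LinearMap.compRight R ψ)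

@[simp]
theorem triComp_apply (β : M →ₗ[R] M →ₗ[R] Module.Dual R I →ₗ[R] A) (ψ : A →ₗ[R] A') (x y : M)
    (f : Module.Dual R I) : triComp β ψ x y f = ψ (β x y f) := rfl

theorem IsEvenMap.map {β : M →ₗ[R] M →ₗ[R] Module.Dual R I →ₗ[R] A} (h : IsEvenMap q β)
    (ψ : A →ₐ[R] A') : IsEvenMap q (triComp β ψ.toLinearMap) where
  sq x f := by simp [h.sq]
  mul x y z f g := by simp [← map_mul, h.mul]

theorem IsEvenClifford.map {β : M →ₗ[R] M →ₗ[R] Module.Dual R I →ₗ[R] A}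
    (h : IsEvenClifford q β) (ψ : A ≃ₐ[R] A') :
    IsEvenClifford q (triComp β (ψ : A →ₐ[R] A').toLinearMap) where
  toIsEvenMap := h.toIsEvenMap.map (ψ : A →ₐ[R] A')
  bijective b hb := by
    have : evenOfBilin q (h.toIsEvenMap.map (ψ : A →ₐ[R] A')) b hb =
        ψ.toLinearMap ∘ₗ evenOfBilin q h.toIsEvenMap b hb := by
      refine LinearMap.prod_ext (LinearMap.ext fun a => ?_) (TensorProduct.ext ?_)
      · simp [evenOfBilin_inl]
      · refine wedge₂_ext fun x y => LinearMap.ext fun f => ?_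
        have h1 := evenOfBilin_apply q (h.toIsEvenMap.map (ψ : A →ₐ[R] A')) b hb 0 x y f
        have h2 := congrArg ψ (evenOfBilin_apply q h.toIsEvenMap b hb 0 x y f)
        refine h1.trans (Eq.trans ?_ h2.symm)
        simp
    rw [this]
    exact ψ.bijective.comp (h.bijective b hb)

end Transport

section Invertible

variable {R : Type*} [CommRing R]

/-- The rank is multiplicative and X^∨ ⊗ X ≅ R. -/
theorem rankAtStalk_invertible (X : Type*) [AddCommGroup X] [Module R X] [Module.Invertible R X]
    (𝔭 : PrimeSpectrum R) : Module.rankAtStalk X 𝔭 = 1 := by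
  have : Nontrivial R := 𝔭.nontrivial
  have h := congrFun (Module.rankAtStalk_eq_of_equiv (M := Module.Dual R X ⊗[R] X) (N := R)
    (Module.Invertible.linearEquiv R X)) 𝔭
  rw [Module.rankAtStalk_tensorProduct, Module.rankAtStalk_self, Pi.mul_apply, Pi.one_apply] at h
  exact Nat.eq_one_of_mul_eq_one_left h

theorem isTernary_of_equiv {R : Type u} [CommRing R] {D M P L I I' : Type u} [AddCommGroup D]
    [Module R D] [AddCommGroup M] [Module R M] [AddCommGroup P] [Module R P] [AddCommGroup L]
    [Module R L] [AddCommGroup I] [Module R I] [AddCommGroup I'] [Module R I']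
    (h : IsTernary R M I) [Module.Invertible R P] [Module.Invertible R L] [Module.Invertible R I']
    (e : D ≃ₗ[R] M ⊗[R] P) : IsTernary R (D ⊗[R] L) I' := by
  have := h.finite
  have := h.projective
  have : Module.Finite R D := Module.Finite.equiv e.symm
  have : Module.Projective R D := Module.Projective.of_equiv e.symm
  refine ⟨inferInstance, inferInstance, fun 𝔭 => ?_, inferInstance⟩
  rw [Module.rankAtStalk_tensorProduct, Pi.mul_apply, Module.rankAtStalk_eq_of_equiv e,
    Module.rankAtStalk_tensorProduct, Pi.mul_apply, rankAtStalk_invertible P,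
    rankAtStalk_invertible L, h.rank_eq]

end Invertible

/-! ### Recovering the quadratic module from its quaternion ring -/

section Model

variable {R : Type u} [CommRing R]

theorem ParityRing.exists_isEvenClifford (X : ParityRing R) :
    ∃ (N : TernaryModule R) (β : N.M →ₗ[R] N.M →ₗ[R] Module.Dual R N.I →ₗ[R] X.B),
      IsEvenClifford N.q β := by
  obtain ⟨N, ⟨ψ⟩⟩ := X.isQuaternionRing
  exact ⟨N, _, (evenTri_isEvenClifford N.q N.isTernary).map ψ.symm⟩

theorem ParityRing.isTernary (X : ParityRing R) : IsTernary R X.twistModule X.Q := by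
  obtain ⟨N, β, h⟩ := X.exists_isEvenClifford
  obtain ⟨δ, hδ⟩ := exists_delta h
  have := parityModule_invertible N
  exact isTernary_of_equiv (P := N.parityModule) N.isTernary
    (LinearEquiv.ofBijective δ (hδ.bijective h))

theorem ParityRing.exists_exteriorForm (X : ParityRing R) :
    ∃ φ, IsCanonicalExteriorForm R X.B φ := by
  obtain ⟨N, β, h⟩ := X.exists_isEvenClifford
  exact TernaryQuaternion.exists_exteriorForm N.span_frameSet fun r ⟨F⟩ => ⟨h.quatFrame F⟩

theorem ParityRing.exteriorForm_unique (X : ParityRing R)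
    {φ φ' : QuadraticMap R (⋀[R]^2 (ModScalars R X.B)) (⋀[R]^4 X.B)}
    (h : IsCanonicalExteriorForm R X.B φ) (h' : IsCanonicalExteriorForm R X.B φ') : φ = φ' := by
  obtain ⟨N, β, hβ⟩ := X.exists_isEvenClifford
  refine exteriorForm_ext N.span_frameSet (fun r ⟨F⟩ => ⟨hβ.quatFrame F⟩) fun x y => ?_
  obtain ⟨x, rfl⟩ := Submodule.Quotient.mk_surjective _ x
  obtain ⟨y, rfl⟩ := Submodule.Quotient.mk_surjective _ y
  exact (h x y).trans (h' x y).symm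

/-- The canonical exterior form of `B`. -/
def ParityRing.exteriorForm (X : ParityRing R) :
    QuadraticMap R (⋀[R]^2 (ModScalars R X.B)) (⋀[R]^4 X.B) := X.exists_exteriorForm.choose

theorem ParityRing.exteriorForm_spec (X : ParityRing R) :
    IsCanonicalExteriorForm R X.B X.exteriorForm := X.exists_exteriorForm.choose_spec

theorem ParityRing.dualParity_p (X : ParityRing R) (ξ ξ' : Module.Dual R X.P) (a b : X.P)
    (c : X.Q) : X.dualParity ξ ξ' (X.p ((a ⊗ₜ b) ⊗ₜ c)) = (ξ a * ξ' b) • c := by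
  simp [ParityRing.dualParity]

/-- The contraction `p^*(ξ ⊗ ξ')` as a bilinear map in `ξ` and `ξ'`. -/
def ParityRing.dualParityₗ (X : ParityRing R) :
    Module.Dual R X.P →ₗ[R] Module.Dual R X.P →ₗ[R] ⋀[R]^4 X.B →ₗ[R] X.Q :=
  LinearMap.mk₂ R X.dualParity
    (fun ξ₁ ξ₂ ξ' => by
      simp only [ParityRing.dualParity, TensorProduct.map_add_left, LinearMap.comp_add,
        LinearMap.rTensor_add, LinearMap.add_comp])
    (fun c ξ ξ' => by
      simp only [ParityRing.dualParity, TensorProduct.map_smul_left, LinearMap.comp_smul,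
        LinearMap.rTensor_smul, LinearMap.smul_comp])
    (fun ξ ξ₁ ξ₂ => by
      simp only [ParityRing.dualParity, TensorProduct.map_add_right, LinearMap.comp_add,
        LinearMap.rTensor_add, LinearMap.add_comp])
    (fun c ξ ξ' => by
      simp only [ParityRing.dualParity, TensorProduct.map_smul_right, LinearMap.comp_smul,
        LinearMap.rTensor_smul, LinearMap.smul_comp])

theorem ParityRing.exists_isTwist (X : ParityRing R)
    (φ : QuadraticMap R (⋀[R]^2 (ModScalars R X.B)) (⋀[R]^4 X.B)) : ∃ Ψ, X.IsTwist φ Ψ :=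
  exists_twist φ X.dualParityₗ

/-- The twist of the canonical exterior form by the parity factorization. -/
def ParityRing.twistForm (X : ParityRing R) : QuadraticMap R X.twistModule X.Q :=
  (X.exists_isTwist X.exteriorForm).choose

theorem ParityRing.twistForm_spec (X : ParityRing R) : X.IsTwist X.exteriorForm X.twistForm :=
  (X.exists_isTwist X.exteriorForm).choose_spec

theorem ParityRing.isTwist_unique (X : ParityRing R)
    {φ : QuadraticMap R (⋀[R]^2 (ModScalars R X.B)) (⋀[R]^4 X.B)}
    {Ψ Ψ' : QuadraticMap R X.twistModule X.Q} (h : X.IsTwist φ Ψ) (h' : X.IsTwist φ Ψ') : Ψ = Ψ' :=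
  twist_ext fun ω ξ => (h ω ξ).trans (h' ω ξ).symm

/-- The ternary quadratic module attached to a quaternion ring with a parity factorization. -/
def ParityRing.ternary (X : ParityRing R) : TernaryModule R :=
  X.toTernaryModule X.isTernary X.twistForm

/-- The maps `β`, `u`, `v` identify `X` with the even Clifford algebra of `N` and its canonical
parity factorization. -/
structure IsModel (N : TernaryModule R) (X : ParityRing R)
    (β : N.M →ₗ[R] N.M →ₗ[R] Module.Dual R N.I →ₗ[R] X.B) (u : N.parityModule ≃ₗ[R] X.P)
    (v : N.I ≃ₗ[R] X.Q) : Prop where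
  isEvenClifford : IsEvenClifford N.q β
  isParity : IsParity N β
    (X.p.toLinearMap ∘ₗ TensorProduct.map (TensorProduct.map u.toLinearMap u.toLinearMap)
      v.toLinearMap)

variable {N : TernaryModule R} {X : ParityRing R}
  {β : N.M →ₗ[R] N.M →ₗ[R] Module.Dual R N.I →ₗ[R] X.B} {u : N.parityModule ≃ₗ[R] X.P}
  {v : N.I ≃ₗ[R] X.Q}

theorem IsModel.dualParity_top (h : IsModel N X β u v) {r : R} (F : TernaryFrame R N.M N.I r)
    (ξ : Module.Dual R X.P) : r • X.dualParity ξ ξ (quatTop F β) =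
      (ξ (u (parityGen F)) * ξ (u (parityGen F))) • v F.t := by
  have h1 := h.isParity.apply_gen F F.t
  rw [F.pair] at h1
  rw [← map_smul, ← h1]
  exact X.dualParity_p ξ ξ _ _ _

/-- The isomorphism δ turns ⋀²(B/R) ⊗ P^∨ into M ⊗ P ⊗ P^∨ ≅ M, and the twisted exterior form
becomes -q. It is enough to compare on ω ⊗ ξ, locally. -/
theorem IsModel.isometric (h : IsModel N X β u v) : TernaryModule.Isometric X.ternary N := by
  obtain ⟨δ, hδ⟩ := exists_delta h.isEvenClifford
  have := parityModule_invertible N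
  let c : N.parityModule ⊗[R] Module.Dual R X.P ≃ₗ[R] R :=
    TensorProduct.comm R _ _ ≪≫ₗ TensorProduct.congr (LinearEquiv.refl R _) u ≪≫ₗ
      Module.Invertible.linearEquiv R X.P
  have hc : ∀ a ξ, c (a ⊗ₜ ξ) = ξ (u a) := fun a ξ => rfl
  let γ : X.twistModule ≃ₗ[R] N.M :=
    TensorProduct.congr (LinearEquiv.ofBijective δ (hδ.bijective h.isEvenClifford))
      (LinearEquiv.refl R _) ≪≫ₗ TensorProduct.assoc R _ _ _ ≪≫ₗ
      TensorProduct.congr (LinearEquiv.refl R _) c ≪≫ₗ TensorProduct.rid R N.M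
  -- For fixed ξ the isomorphism γ is δ followed by contraction with ξ ∘ u.
  let κ : Module.Dual R X.P → N.M ⊗[R] N.parityModule →ₗ[R] N.M := fun ξ =>
    (TensorProduct.rid R N.M).toLinearMap ∘ₗ LinearMap.lTensor N.M (ξ ∘ₗ u.toLinearMap)
  have hκ : ∀ m a ξ, κ ξ (m ⊗ₜ a) = ξ (u a) • m := fun m a ξ => by simp [κ]
  have hγ : ∀ ω ξ, γ (ω ⊗ₜ ξ) = κ ξ (δ ω) := fun ω ξ => by
    change TensorProduct.rid R N.M (TensorProduct.congr (LinearEquiv.refl R _) c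
      (TensorProduct.assoc R _ _ _ (δ ω ⊗ₜ ξ))) = _
    generalize δ ω = z
    induction z with
    | zero => simp
    | add a b ha hb => simp only [TensorProduct.add_tmul, map_add, ha, hb]
    | tmul m a => rw [hκ]; simp [hc]
  -- The sign in φ(ω) = -q(n) · 1 ∧ i ∧ j ∧ k is absorbed by the isomorphism on values.
  refine ⟨γ, v.symm.trans (LinearEquiv.neg R), ?_⟩
  suffices key : N.q.comp γ.toLinearMap =
      (v.symm.trans (LinearEquiv.neg R)).toLinearMap.compQuadraticMap X.twistForm from
    fun x => DFunLike.congr_fun key x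
  refine twist_ext fun ω ξ => ?_
  change N.q (γ (ω ⊗ₜ ξ)) = -v.symm (X.twistForm (ω ⊗ₜ ξ))
  rw [X.twistForm_spec, hγ]
  refine eq_of_local N.span_frameSet ?_
  rintro r ⟨F⟩
  have h1 := congrArg (X.dualParity ξ ξ)
    (h.isEvenClifford.exteriorForm_apply X.exteriorForm_spec F ω)
  have h2 : r ^ 6 • κ ξ (δ ω) = ξ (u (parityGen F)) •
      ∑ m, (h.isEvenClifford.quatFrame F).coord m ω • F.e m := by
    rw [← map_smul, ← map_smul, (h.isEvenClifford.quatFrame F).isFrame_basis.expand, map_sum,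
      map_sum, Finset.smul_sum]
    refine Finset.sum_congr rfl fun m _ => ?_
    rw [map_smul, map_smul, hδ.apply_basis h.isEvenClifford, hκ, smul_comm]
  generalize ∑ m, (h.isEvenClifford.quatFrame F).coord m ω • F.e m = n at h1 h2
  have h3 := congrArg N.q h2
  rw [QuadraticMap.map_smul, QuadraticMap.map_smul] at h3
  have h4 := h.dualParity_top F ξ
  rw [map_smul, map_smul] at h1
  have h5 := F.expand (N.q n)
  -- 18 from `IsEvenClifford.exteriorForm_apply` and 1 from τ(t) = r. On the other side 12 comes
  -- from r⁶ inside q, 6 from the factor r⁶ in front of q, and 1 from expanding in t.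
  refine ⟨19, ?_⟩
  have h6 : r ^ 19 • X.dualParity ξ ξ (X.exteriorForm ω) =
      -(r ^ 19 • v (N.q (κ ξ (δ ω)))) := by
    have e1 : r ^ 19 • X.dualParity ξ ξ (X.exteriorForm ω) =
        r • (r ^ 18 • X.dualParity ξ ξ (X.exteriorForm ω)) := by rw [smul_smul]; ring_nf
    have e2 : r ^ 19 • v (N.q (κ ξ (δ ω))) = r ^ 6 • r • v ((r ^ 6 * r ^ 6) • N.q (κ ξ (δ ω))) := by
      rw [map_smul, smul_smul, smul_smul]; ring_nf
    have e3 : r • v (N.q n) = F.τ (N.q n) • v F.t := by rw [← map_smul, h5, map_smul]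
    rw [e1, h1, e2, h3, map_smul, smul_comm r, h4, smul_comm r, e3]
    module
  rw [smul_neg, ← map_smul v.symm (r ^ 19), h6, map_neg, neg_neg, map_smul, LinearEquiv.symm_apply_apply]

end Model

end

end TernaryQuaternion

namespace TernaryQuaternion

noncomputable section

/-! ### The universal property of the even Clifford algebra -/

section Universal

variable {R : Type u} [CommRing R] {M I : Type u} [AddCommGroup M] [Module R M] [AddCommGroup I]
  [Module R I] {q : QuadraticMap R M I}
variable {A A' : Type u} [Ring A] [Algebra R A] [Ring A'] [Algebra R A']
variable {β : M →ₗ[R] M →ₗ[R] Module.Dual R I →ₗ[R] A}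
variable {β' : M →ₗ[R] M →ₗ[R] Module.Dual R I →ₗ[R] A'}

/-- Both products are bilinear and agree on 1, i, j, k, since the two multiplication tables have the
same coefficients. -/
theorem QuatFrame.map_mul {r : R} (G : QuatFrame A r) {G' : QuatFrame A' r} (ψ : A →ₗ[R] A')
    (h1 : ψ 1 = 1) (hi : ψ G.i = G'.i) (hj : ψ G.j = G'.j) (hk : ψ G.k = G'.k)
    (ha : G.a = G'.a) (hb : G.b = G'.b) (hc : G.c = G'.c) (hu : G.u = G'.u) (hv : G.v = G'.v)
    (hw : G.w = G'.w) (x y : A) :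
    r ^ 6 • ψ (x * y) = r ^ 6 • (ψ x * ψ y) := by
  have := G.isFrame.ext₂ G.isFrame ((LinearMap.mul R A).compr₂ ψ)
    ((LinearMap.mul R A').compl₁₂ ψ ψ) (fun m n => ?_) x y
  · rwa [← pow_add] at this
  · have t := G.table
    have t' := G'.table
    rw [← ha, ← hb, ← hc, ← hu, ← hv, ← hw] at t'
    fin_cases m <;> fin_cases n <;>
      simp [h1, hi, hj, hk, t.ii, t.ij, t.ik, t.ji, t.jj, t.jk, t.ki, t.kj, t.kk,
        t'.ii, t'.ij, t'.ik, t'.ji, t'.jj, t'.jk, t'.ki, t'.kj, t'.kk]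

/-- The scalar parts are chosen so that `evenOfBilin` takes these vectors exactly to 1, i, j, k. -/
theorem TernaryFrame.isFrame_prod {r : R} (F : TernaryFrame R M I r)
    (b : LinearMap.BilinMap R M I) : ∃ ε : Fin 4 → Module.Dual R (R × (⋀[R]^2 M ⊗[R] Module.Dual R I)),
      IsFrame (r ^ 3) ![(1, 0), (F.τ (b (F.e 1) (F.e 2)), wedge₂ (F.e 1) (F.e 2) ⊗ₜ F.τ),
        (F.τ (b (F.e 2) (F.e 0)), wedge₂ (F.e 2) (F.e 0) ⊗ₜ F.τ),
        (F.τ (b (F.e 0) (F.e 1)), wedge₂ (F.e 0) (F.e 1) ⊗ₜ F.τ)] ε := by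
  have hI := (isFrame_one F.expand F.pair).dual
  have hW := F.isFrame.exteriorPower_two.tmul hI.expand_one hI.pair_one
  rw [← pow_succ] at hW
  generalize hμ : (fun i => LinearMap.mul' R R ∘ₗ
    TensorProduct.map (![minor (F.ε 1) (F.ε 2), minor (F.ε 2) (F.ε 0), minor (F.ε 0) (F.ε 1)] i)
      ((Module.Dual.eval R I) F.t)) = μ at hW
  have hp : ∀ i j, μ i (![wedge₂ (F.e 1) (F.e 2), wedge₂ (F.e 2) (F.e 0), wedge₂ (F.e 0) (F.e 1)] j
    ⊗ₜ F.τ) = if i = j then r ^ 3 else 0 := hW.pair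
  have hp1 := fun i => hp i 0
  have hp2 := fun i => hp i 1
  have hp3 := fun i => hp i 2
  simp only [Matrix.cons_val_zero, Matrix.cons_val_one, Matrix.cons_val] at hp1 hp2 hp3
  let θ₀ : Module.Dual R (R × (⋀[R]^2 M ⊗[R] Module.Dual R I)) := r ^ 3 • LinearMap.fst R R _ -
    (F.τ (b (F.e 1) (F.e 2)) • μ 0 + F.τ (b (F.e 2) (F.e 0)) • μ 1 +
      F.τ (b (F.e 0) (F.e 1)) • μ 2) ∘ₗ LinearMap.snd R R _
  have hθ₀ : ∀ x, θ₀ x = r ^ 3 * x.1 - (F.τ (b (F.e 1) (F.e 2)) * μ 0 x.2 +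
    F.τ (b (F.e 2) (F.e 0)) * μ 1 x.2 + F.τ (b (F.e 0) (F.e 1)) * μ 2 x.2) := fun x => rfl
  refine ⟨![θ₀, μ 0 ∘ₗ LinearMap.snd R R _, μ 1 ∘ₗ LinearMap.snd R R _,
    μ 2 ∘ₗ LinearMap.snd R R _], ⟨fun ⟨a, ω⟩ => ?_, fun m n => ?_⟩⟩
  · have h1 := hW.expand ω
    rw [Fin.sum_univ_three] at h1
    rw [Fin.sum_univ_four, Prod.smul_mk, h1]
    simp only [Matrix.cons_val_zero, Matrix.cons_val_one, Matrix.cons_val, hθ₀, Prod.smul_mk,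
      Prod.mk_add_mk, LinearMap.comp_apply, LinearMap.snd_apply, smul_zero, zero_add, smul_eq_mul]
    congr 1
    ring
  · fin_cases m <;> fin_cases n <;> simp [hθ₀, hp1, hp2, hp3] <;> ring

/-- A local criterion for the even Clifford algebra: 1, i, j, k form a basis. The exponents m and n
are independent because a twist changes the two denominators differently. -/
theorem IsEvenMap.of_frames (hβ : IsEvenMap q β) {S : Set R}
    (hS : Ideal.span S = ⊤) (hF : ∀ r ∈ S, ∃ (m n : ℕ) (F : TernaryFrame R M I (r ^ m))
      (θ : Fin 4 → Module.Dual R A), IsFrame (r ^ n)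
        (quatBasis (β (F.e 1) (F.e 2) F.τ) (β (F.e 2) (F.e 0) F.τ) (β (F.e 0) (F.e 1) F.τ)) θ) :
    IsEvenClifford q β where
  toIsEvenMap := hβ
  bijective b hb := by
    refine bijective_of_frames hS _ fun r hr => ?_
    obtain ⟨m, n, F, θ, hθ⟩ := hF r hr
    obtain ⟨ε, hε⟩ := F.isFrame_prod b
    rw [← pow_mul] at hε
    refine ⟨4, m * 3, n, 0, 0, _, ε, _, θ, hε, hθ, fun i => ?_⟩
    rw [pow_zero, one_smul, one_smul]
    fin_cases i
    · exact (evenOfBilin_inl q hβ b hb 1).trans (map_one _)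
    · exact (evenOfBilin_apply q hβ b hb _ _ _ _).trans (add_sub_cancel _ _)
    · exact (evenOfBilin_apply q hβ b hb _ _ _ _).trans (add_sub_cancel _ _)
    · exact (evenOfBilin_apply q hβ b hb _ _ _ _).trans (add_sub_cancel _ _)

/-- Both algebras are R ⊕ (⋀²M ⊗ I^∨) through the same b. The resulting linear isomorphism matches β
with β'; multiplicativity is local and follows from the common multiplication table. -/
theorem IsEvenClifford.exists_algEquiv (hM : IsTernary R M I) (h : IsEvenClifford q β)
    (h' : IsEvenClifford q β') : ∃ ψ : A ≃ₐ[R] A', ∀ x y f, ψ (β x y f) = β' x y f := by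
  have := hM.projective
  obtain ⟨b, hb⟩ := exists_bilinMap q
  replace hb : ∀ x, b x x = q x := fun x => by rw [← hb]; rfl
  let σ := LinearEquiv.ofBijective _ (h.bijective b hb)
  let σ' := LinearEquiv.ofBijective _ (h'.bijective b hb)
  let ψ : A ≃ₗ[R] A' := σ.symm.trans σ'
  have h1 : ψ 1 = 1 := by
    have e1 : σ (1, 0) = 1 := (evenOfBilin_inl q h.toIsEvenMap b hb 1).trans (map_one _)
    have e2 : σ' (1, 0) = 1 := (evenOfBilin_inl q h'.toIsEvenMap b hb 1).trans (map_one _)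
    rw [← e1, ← e2]
    exact congrArg σ' (σ.symm_apply_apply _)
  have h2 : ∀ x y f, ψ (β x y f) = β' x y f := fun x y f => by
    have e1 : σ (f (b x y), wedge₂ x y ⊗ₜ[R] f) = β x y f :=
      (evenOfBilin_apply q h.toIsEvenMap b hb _ _ _ _).trans (add_sub_cancel _ _)
    have e2 : σ' (f (b x y), wedge₂ x y ⊗ₜ[R] f) = β' x y f :=
      (evenOfBilin_apply q h'.toIsEvenMap b hb _ _ _ _).trans (add_sub_cancel _ _)
    rw [← e1, ← e2]
    exact congrArg σ' (σ.symm_apply_apply _)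
  refine ⟨AlgEquiv.ofLinearEquiv ψ h1 fun x y => eq_of_local hM.span_frameSet ?_, h2⟩
  rintro r ⟨F⟩
  exact ⟨6, (h.quatFrame F).map_mul (G' := h'.quatFrame F) ψ.toLinearMap h1 (h2 _ _ _) (h2 _ _ _)
    (h2 _ _ _) rfl rfl rfl rfl rfl rfl x y⟩

end Universal

/-! ### The quaternion ring with its canonical parity factorization, and its models -/

section Canonical

variable {R : Type u} [CommRing R] (N : TernaryModule R)

theorem IsEvenClifford.exists_parity {N : TernaryModule R} {A : Type u} [Ring A] [Algebra R A]
    {β : N.M →ₗ[R] N.M →ₗ[R] Module.Dual R N.I →ₗ[R] A} (h : IsEvenClifford N.q β) :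
    ∃ p : (N.parityModule ⊗[R] N.parityModule) ⊗[R] N.I ≃ₗ[R] ⋀[R]^4 A,
      ∀ p' : (N.parityModule ⊗[R] N.parityModule) ⊗[R] N.I ≃ₗ[R] ⋀[R]^4 A,
        IsParity N β p'.toLinearMap ↔ p' = p := by
  obtain ⟨p, hp⟩ := exists_parity_linearMap h
  refine ⟨LinearEquiv.ofBijective p (hp.bijective h), fun p' => ⟨fun h' => ?_, ?_⟩⟩
  · exact LinearEquiv.toLinearMap_injective (h'.ext hp)
  · rintro rfl
    exact hp

theorem exists_canonicalParity :
    ∃ p : (N.parityModule ⊗[R] N.parityModule) ⊗[R] N.I ≃ₗ[R] ⋀[R]^4 (evenClifford N.q),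
      ∀ p', N.IsCanonicalParity p' ↔ p' = p :=
  (evenTri_isEvenClifford N.q N.isTernary).exists_parity

/-- The canonical parity factorization of `C⁰(M,I,q)`. -/
def canonicalParity :
    (N.parityModule ⊗[R] N.parityModule) ⊗[R] N.I ≃ₗ[R] ⋀[R]^4 (evenClifford N.q) :=
  (exists_canonicalParity N).choose

theorem isCanonicalParity_iff
    (p : (N.parityModule ⊗[R] N.parityModule) ⊗[R] N.I ≃ₗ[R] ⋀[R]^4 (evenClifford N.q)) :
    N.IsCanonicalParity p ↔ p = canonicalParity N :=
  (exists_canonicalParity N).choose_spec p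

theorem canonicalParity_isParity : IsParity N (evenTri N.q) (canonicalParity N).toLinearMap :=
  (isCanonicalParity_iff N _).2 rfl

/-- `C⁰(M,I,q)` with its canonical parity factorization. -/
def TernaryModule.parity : ParityRing R :=
  N.toParityRing (parityModule_invertible N) (canonicalParity N)

theorem parity_isModel :
    IsModel N N.parity (evenTri N.q) (LinearEquiv.refl R _) (LinearEquiv.refl R _) where
  isEvenClifford := evenTri_isEvenClifford N.q N.isTernary
  isParity := by
    have := canonicalParity_isParity N
    intro x x' y y' z z' f g h d t
    exact this x x' y y' z z' f g h d t

variable {N}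

theorem IsParity.map {A A' : Type u} [Ring A] [Algebra R A] [Ring A'] [Algebra R A']
    {β : N.M →ₗ[R] N.M →ₗ[R] Module.Dual R N.I →ₗ[R] A}
    {p : (N.parityModule ⊗[R] N.parityModule) ⊗[R] N.I →ₗ[R] ⋀[R]^4 A} (hp : IsParity N β p)
    (ψ : A →ₐ[R] A') :
    IsParity N (triComp β ψ.toLinearMap) (exteriorPower.map 4 ψ.toLinearMap ∘ₗ p) := by
  intro x x' y y' z z' f g h d t
  have := congrArg (exteriorPower.map 4 ψ.toLinearMap) (hp x x' y y' z z' f g h d t)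
  rw [map_sub, map_smul, exteriorPower.map_apply_ιMulti] at this
  refine this.trans (congrArg (d t • ·) (congrArg _ ?_))
  ext i
  fin_cases i
  · exact map_one ψ
  all_goals rfl

/-- The algebra is pinned down by `IsEvenClifford.exists_algEquiv` and the factorization by
`IsParity.ext`. -/
theorem IsModel.isomorphic {X : ParityRing R}
    {β : N.M →ₗ[R] N.M →ₗ[R] Module.Dual R N.I →ₗ[R] X.B} {u : N.parityModule ≃ₗ[R] X.P}
    {v : N.I ≃ₗ[R] X.Q} (h : IsModel N X β u v) : ParityRing.Isomorphic N.parity X := by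
  obtain ⟨ψ, hψ⟩ := (evenTri_isEvenClifford N.q N.isTernary).exists_algEquiv N.isTernary
    h.isEvenClifford
  refine ⟨ψ, u, v, fun a b c => ?_⟩
  have h1 := (canonicalParity_isParity N).map (ψ : evenClifford N.q →ₐ[R] X.B)
  have h2 : triComp (evenTri N.q) (ψ : evenClifford N.q →ₐ[R] X.B).toLinearMap = β := by
    ext x y f
    exact hψ x y f
  rw [h2] at h1
  exact LinearMap.congr_fun (h.isParity.ext h1) ((a ⊗ₜ b) ⊗ₜ c)

theorem IsModel.of_isomorphic {X : ParityRing R} (h : ParityRing.Isomorphic N.parity X) :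
    ∃ β u v, IsModel N X β u v := by
  obtain ⟨(ψ : evenClifford N.q ≃ₐ[R] X.B), u, v, h⟩ := h
  refine ⟨_, u, v, (evenTri_isEvenClifford N.q N.isTernary).map ψ, ?_⟩
  have h1 := (canonicalParity_isParity N).map (ψ : evenClifford N.q →ₐ[R] X.B)
  convert h1 using 1
  refine TensorProduct.ext_threefold fun a b c => ?_
  exact h a b c

end Canonical

end

end TernaryQuaternion

namespace TernaryQuaternion

noncomputable section

/-! ### Twists of ternary quadratic modules -/

theorem Invertible.smul_comm_map {R L Z : Type*} [CommRing R] [AddCommGroup L] [Module R L]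
    [Module.Invertible R L] [AddCommGroup Z] [Module R Z] (a : Module.Dual R L) (b : L →ₗ[R] Z)
    (l m : L) : a l • b m = a m • b l := by
  rw [← map_smul, ← map_smul, Invertible.apply_smul_comm]

theorem span_mul_eq_top {R : Type*} [CommRing R] {S T : Set R} (hS : Ideal.span S = ⊤)
    (hT : Ideal.span T = ⊤) : Ideal.span {d | ∃ r ∈ S, ∃ s ∈ T, d = r * s} = ⊤ := by
  have h := Ideal.span_mul_span' S T
  rw [hS, hT, Ideal.top_mul] at h
  rw [h]
  congr 1
  ext d
  simp only [Set.mem_ofPred_eq, Set.mem_mul, eq_comm]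

variable {R : Type u} [CommRing R]

/-- The data that exhibit `(M',I',q')` as the twist of `(M,I,q)` by an invertible module `L`. -/
structure TwistData (N N' : TernaryModule R) (L : Type u) [AddCommGroup L] [Module R L] where
  f : N.M ⊗[R] L ≃ₗ[R] N'.M
  g : N.I ⊗[R] (L ⊗[R] L) ≃ₗ[R] N'.I
  hq : ∀ x l, N'.q (f (x ⊗ₜ l)) = g (N.q x ⊗ₜ (l ⊗ₜ l))

section TwistData

variable {N N' : TernaryModule R} {L : Type u} [AddCommGroup L] [Module R L]
variable (T : TwistData N N' L)

/-- The contraction of linear forms on `I'` with elements of `L ⊗ L`. -/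
def TwistData.contract : L →ₗ[R] L →ₗ[R] Module.Dual R N'.I →ₗ[R] Module.Dual R N.I :=
  LinearMap.mk₂ R (fun l m => (LinearMap.lcomp R R (T.g.toLinearMap ∘ₗ
      (TensorProduct.mk R N.I (L ⊗[R] L)).flip (l ⊗ₜ m))))
    (fun l l' m => by ext; simp [TensorProduct.add_tmul])
    (fun c l m => by ext; simp [← TensorProduct.smul_tmul'])
    (fun l m m' => by ext; simp [TensorProduct.tmul_add])
    (fun c l m => by ext; simp)

theorem TwistData.contract_apply (l m : L) (F : Module.Dual R N'.I) (s : N.I) :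
    T.contract l m F s = F (T.g (s ⊗ₜ (l ⊗ₜ m))) := rfl

variable {A : Type u} [Ring A] [Algebra R A] (β : N.M →ₗ[R] N.M →ₗ[R] Module.Dual R N.I →ₗ[R] A)

/-- The trilinear map of the twist, before the identification of `M'` with `M ⊗ L`. -/
def TwistData.preTri : N.M ⊗[R] L →ₗ[R] N.M ⊗[R] L →ₗ[R] Module.Dual R N'.I →ₗ[R] A :=
  TensorProduct.lift (LinearMap.mk₂ R
    (fun x l => TensorProduct.lift (LinearMap.mk₂ R
      (fun y m => β x y ∘ₗ T.contract l m)
      (fun y y' m => by ext; simp) (fun c y m => by ext; simp)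
      (fun y m m' => by ext; simp) (fun c y m => by ext; simp)))
    (fun x x' l => by ext; simp) (fun c x l => by ext; simp)
    (fun x l l' => by ext; simp) (fun c x l => by ext; simp))

/-- The trilinear map of the twist. -/
def TwistData.tri : N'.M →ₗ[R] N'.M →ₗ[R] Module.Dual R N'.I →ₗ[R] A :=
  (T.preTri β).compl₁₂ T.f.symm.toLinearMap T.f.symm.toLinearMap

theorem TwistData.tri_apply (x y : N.M) (l m : L) (F : Module.Dual R N'.I) :
    T.tri β (T.f (x ⊗ₜ l)) (T.f (y ⊗ₜ m)) F = β x y (T.contract l m F) := by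
  simp [TwistData.tri, TwistData.preTri]

variable {β}

theorem TwistData.quadratic_ext {Z : Type*} [AddCommGroup Z] [Module R Z] [Module.Invertible R L]
    {Q Q' : QuadraticMap R N'.M Z} (h : ∀ x l, Q (T.f (x ⊗ₜ l)) = Q' (T.f (x ⊗ₜ l))) (z : N'.M) :
    Q z = Q' z := by
  have : Q.comp T.f.toLinearMap = Q'.comp T.f.toLinearMap := twist_ext fun x l => h x l
  simpa using DFunLike.congr_fun this (T.f.symm z)

theorem TwistData.induction {p : N'.M → Prop} (h0 : p 0) (ht : ∀ x l, p (T.f (x ⊗ₜ l)))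
    (ha : ∀ x y, p x → p y → p (x + y)) (z : N'.M) : p z := by
  obtain ⟨z, rfl⟩ := T.f.surjective z
  induction z with
  | zero => simpa using h0
  | tmul x l => exact ht x l
  | add x y hx hy => rw [map_add]; exact ha _ _ hx hy

/-- Each relation is linear or quadratic in each variable, so it is enough to check it on pure
tensors, by linearity or by `twist_ext`. -/
theorem TwistData.isEvenMap [Module.Invertible R L] (h : IsEvenMap N.q β) :
    IsEvenMap N'.q (T.tri β) where
  sq z F := by
    have := T.quadratic_ext
      (Q := LinearMap.BilinMap.toQuadraticMap ((T.tri β).compr₂ (LinearMap.applyₗ F)))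
      (Q' := (Algebra.linearMap R A ∘ₗ F).compQuadraticMap N'.q) (fun x l => ?_) z
    · exact this
    · change T.tri β (T.f (x ⊗ₜ l)) (T.f (x ⊗ₜ l)) F = algebraMap R A (F (N'.q (T.f (x ⊗ₜ l))))
      rw [T.tri_apply, h.sq, T.hq, T.contract_apply]
  mul x y z F G := by
    induction x using T.induction with
    | h0 => simp
    | ha x x' hx hx' => simp only [map_add, LinearMap.add_apply, add_mul, hx, hx', smul_add]
    | ht x l =>
    induction z using T.induction with
    | h0 => simp
    | ha z z' hz hz' => simp only [map_add, LinearMap.add_apply, mul_add, hz, hz', smul_add]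
    | ht z n =>
    have := T.quadratic_ext
      (Q := LinearMap.BilinMap.toQuadraticMap ((LinearMap.mul R A).compl₁₂
        ((LinearMap.applyₗ F) ∘ₗ T.tri β (T.f (x ⊗ₜ l)))
        ((LinearMap.applyₗ G) ∘ₗ (T.tri β).flip (T.f (z ⊗ₜ n)))))
      (Q' := (F.smulRight (T.tri β (T.f (x ⊗ₜ l)) (T.f (z ⊗ₜ n)) G)).compQuadraticMap N'.q)
      (fun y m => ?_) y
    · exact this
    · change T.tri β (T.f (x ⊗ₜ l)) (T.f (y ⊗ₜ m)) F * T.tri β (T.f (y ⊗ₜ m)) (T.f (z ⊗ₜ n)) G =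
        F (N'.q (T.f (y ⊗ₜ m))) • T.tri β (T.f (x ⊗ₜ l)) (T.f (z ⊗ₜ n)) G
      rw [T.tri_apply, T.tri_apply, T.tri_apply, h.mul, T.hq, T.contract_apply]
      -- The two sides differ by an exchange of l and m, which is harmless because L is invertible.
      exact Invertible.smul_comm_map
        (F ∘ₗ T.g.toLinearMap ∘ₗ TensorProduct.mk R N.I (L ⊗[R] L) (N.q y) ∘ₗ
          (TensorProduct.mk R L L).flip m)
        (β x z ∘ₗ LinearMap.applyₗ G ∘ₗ T.contract.flip n) l m

/-- The frame of the twist attached to frames of the quadratic module and of `L`. -/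
def TwistData.frame {d : R} (F : TernaryFrame R N.M N.I d) {l : L} {μ : Module.Dual R L}
    (hL : IsFrame₁ d l μ) : TernaryFrame R N'.M N'.I (d ^ 3) where
  -- M ⊗ L has denominator d² and I ⊗ L ⊗ L has d³; the extra d makes them agree.
  e i := d • T.f (F.e i ⊗ₜ l)
  ε i := tensorForm (F.ε i) μ ∘ₗ T.f.symm.toLinearMap
  t := T.g (F.t ⊗ₜ (l ⊗ₜ l))
  τ := tensorForm F.τ (tensorForm μ μ) ∘ₗ T.g.symm.toLinearMap
  isFrame := by
    have h := (F.isFrame.tmul hL.1 hL.2).smul d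
    rw [show d * (d * d) = d ^ 3 by ring] at h
    refine ⟨fun x => ?_, fun i j => ?_⟩
    · have := congrArg T.f (h.expand (T.f.symm x))
      simp only [map_smul, map_sum, LinearEquiv.apply_symm_apply] at this
      exact this
    · have := h.pair i j
      simpa only [map_smul, LinearMap.comp_apply, LinearEquiv.coe_coe,
        LinearEquiv.symm_apply_apply] using this
  expand s := by
    have h := (F.isFrame₁.tmul (hL.tmul hL)).1 (T.g.symm s)
    rw [show d * (d * d) = d ^ 3 by ring] at h
    have := congrArg T.g h
    simp only [map_smul, LinearEquiv.apply_symm_apply] at this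
    exact this
  pair := by
    have h := (F.isFrame₁.tmul (hL.tmul hL)).2
    rw [show d * (d * d) = d ^ 3 by ring] at h
    simpa only [LinearMap.comp_apply, LinearEquiv.coe_coe, LinearEquiv.symm_apply_apply] using h

theorem TwistData.contract_frame {d : R} (F : TernaryFrame R N.M N.I d) {l : L}
    {μ : Module.Dual R L} (hL : IsFrame₁ d l μ) :
    T.contract l l (T.frame F hL).τ = d ^ 2 • F.τ := by
  ext s
  rw [T.contract_apply]
  simp [TwistData.frame, hL.2, pow_two, mul_comm]

/-- Each of the two vectors contributes d and the contraction with l ⊗ l contributes d². -/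
theorem TwistData.tri_frame {d : R} (F : TernaryFrame R N.M N.I d) {l : L}
    {μ : Module.Dual R L} (hL : IsFrame₁ d l μ) (i j : Fin 3) :
    T.tri β ((T.frame F hL).e i) ((T.frame F hL).e j) (T.frame F hL).τ =
      d ^ 4 • β (F.e i) (F.e j) F.τ := by
  have : ∀ i, (T.frame F hL).e i = d • T.f (F.e i ⊗ₜ l) := fun i => rfl
  simp only [this, map_smul, LinearMap.smul_apply, T.tri_apply, T.contract_frame, smul_smul]
  congr 1
  ring

/-- The element 1 cannot be rescaled, so its coordinate form is rescaled instead. -/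
theorem IsFrame.quatBasis_smul {d : R} {n : ℕ} {i j k : A} {θ : Fin 4 → Module.Dual R A}
    (h : IsFrame (d ^ n) (quatBasis i j k) θ) (m : ℕ) :
    IsFrame (d ^ (m + n)) (quatBasis (d ^ m • i) (d ^ m • j) (d ^ m • k))
      ![d ^ m • θ 0, θ 1, θ 2, θ 3] where
  expand x := by
    rw [pow_add, mul_smul, h.expand, Fin.sum_univ_four, Fin.sum_univ_four]
    simp only [Matrix.cons_val_zero, Matrix.cons_val_one, Matrix.cons_val, LinearMap.smul_apply]
    module
  pair a b := by
    have h0 := fun a => h.pair a 0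
    have h1 := fun a => h.pair a 1
    have h2 := fun a => h.pair a 2
    have h3 := fun a => h.pair a 3
    simp only [Matrix.cons_val_zero, Matrix.cons_val_one, Matrix.cons_val] at h0 h1 h2 h3
    fin_cases a <;> fin_cases b <;> simp [h0, h1, h2, h3, pow_add]

/-- A frame with a larger denominator. -/
def TernaryFrame.smul {M I : Type*} [AddCommGroup M] [Module R M] [AddCommGroup I] [Module R I]
    {r : R} (F : TernaryFrame R M I r) (s : R) : TernaryFrame R M I (s * r) where
  e i := s • F.e i
  ε := F.ε
  t := s • F.t
  τ := F.τ
  isFrame := F.isFrame.smul s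
  expand x := by rw [mul_smul, F.expand, smul_comm]
  pair := by rw [map_smul, F.pair, smul_eq_mul]

theorem IsFrame₁.smul {X : Type*} [AddCommGroup X] [Module R X] {r : R} {e : X}
    {ε : Module.Dual R X} (h : IsFrame₁ r e ε) (s : R) : IsFrame₁ (s * r) (s • e) ε :=
  ⟨fun x => by rw [mul_smul, h.1, smul_comm], by rw [map_smul, h.2, smul_eq_mul]⟩

variable (N L) in
/-- The common denominators of frames of a quadratic module and of an invertible module. -/
def twistFrameSet : Set R :=
  {d | ∃ (_ : TernaryFrame R N.M N.I d) (l : L) (μ : Module.Dual R L), IsFrame₁ d l μ}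

variable (N L) in
theorem span_twistFrameSet [Module.Invertible R L] : Ideal.span (twistFrameSet N L) = ⊤ := by
  refine top_unique ((span_mul_eq_top N.span_frameSet
    (span_frame_invertible R L)).symm.trans_le (Ideal.span_mono ?_))
  rintro _ ⟨r, ⟨F⟩, s, ⟨l, μ, hl⟩, rfl⟩
  exact ⟨mul_comm s r ▸ F.smul s, r • l, μ, IsFrame₁.smul hl r⟩

/-- Twisting multiplies the local i, j, k by d⁴, a unit once d is inverted. So the same algebra
serves the twist. -/
theorem TwistData.isEvenClifford [Module.Invertible R L] (h : IsEvenClifford N.q β) :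
    IsEvenClifford N'.q (T.tri β) := by
  refine (T.isEvenMap h.toIsEvenMap).of_frames (span_twistFrameSet N L) ?_
  rintro d ⟨F, l, μ, hL⟩
  obtain ⟨θ, hθ, -⟩ := h.exists_frame F
  refine ⟨3, 4 + 3, T.frame F hL, ![d ^ 4 • θ 0, θ 1, θ 2, θ 3], ?_⟩
  simp only [T.tri_frame]
  exact hθ.quatBasis_smul 4

/-- The contraction of `P ⊗ L` with a linear form on `L`. -/
abbrev slant {P : Type*} [AddCommGroup P] [Module R P] (μ : Module.Dual R L) : P ⊗[R] L →ₗ[R] P :=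
  (TensorProduct.rid R P).toLinearMap ∘ₗ LinearMap.lTensor P μ

theorem slant_tmul {P : Type*} [AddCommGroup P] [Module R P] (μ : Module.Dual R L) (a : P)
    (k : L) : slant μ (a ⊗ₜ k) = μ k • a := by simp

theorem IsFrame₁.slant_tmul_self {P : Type*} [AddCommGroup P] [Module R P] {d : R} {l : L}
    {μ : Module.Dual R L} (hL : IsFrame₁ d l μ) (z : P ⊗[R] L) : slant μ z ⊗ₜ l = d • z := by
  induction z with
  | zero => simp
  | tmul a k => rw [slant_tmul, TensorProduct.smul_tmul, ← hL.1, TensorProduct.tmul_smul]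
  | add x y hx hy => rw [map_add, TensorProduct.add_tmul, hx, hy, smul_add]

section Parity

variable {P : Type u} [AddCommGroup P] [Module R P] (ρ : P ⊗[R] L ≃ₗ[R] N.parityModule)

/-- Three factors of L come from ⋀³(M ⊗ L), and the two forms on I ⊗ L^{⊗2} consume four. The
missing one is the k in P ⊗ L ≅ 𝒫, so the module attached to the twist is P. -/
theorem TwistData.exists_parityMap [Module.Invertible R L] : ∃ u : N'.parityModule →ₗ[R] P,
    ∀ (x y z : N.M) (l m n k : L) (F G : Module.Dual R N'.I),
      ρ (u (N'.parityMk (T.f (x ⊗ₜ l)) (T.f (y ⊗ₜ m)) (T.f (z ⊗ₜ n)) F G) ⊗ₜ k) =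
        N.parityMk x y z (T.contract l m F) (T.contract n k G) := by
  obtain ⟨u, hu⟩ := exists_eq_of_local (Y := N.parityModule)
    (H := N'.parityModule →ₗ[R] P) (span_twistFrameSet N L)
    (fun i : (Fin 3 → N.M) × (Fin 4 → L) × (Fin 2 → Module.Dual R N'.I) =>
      ρ.toLinearMap ∘ₗ (TensorProduct.mk R P L).flip (i.2.1 3) ∘ₗ LinearMap.applyₗ
        (N'.parityMk (T.f (i.1 0 ⊗ₜ i.2.1 0)) (T.f (i.1 1 ⊗ₜ i.2.1 1)) (T.f (i.1 2 ⊗ₜ i.2.1 2))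
          (i.2.2 0) (i.2.2 1)))
    (fun i => N.parityMk (i.1 0) (i.1 1) (i.1 2) (T.contract (i.2.1 0) (i.2.1 1) (i.2.2 0))
      (T.contract (i.2.1 2) (i.2.1 3) (i.2.2 1))) (by
      rintro d ⟨F, l, μ, hL⟩
      let a : P := slant μ (ρ.symm (parityGen F))
      have ha : ρ (a ⊗ₜ l) = d • parityGen F := by
        rw [hL.slant_tmul_self, map_smul, LinearEquiv.apply_symm_apply]
      -- 5 is the denominator of the generator of 𝒫. The other 5 splits as 2 + 2 for the two
      -- contractions and 1 for ρ(a ⊗ l) = d • `parityGen F`.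
      refine ⟨10, d • (parityForm (T.frame F hL)).smulRight a, ?_⟩
      rintro ⟨x, k, f⟩
      have h1 : d • ρ (a ⊗ₜ k 3) = (μ (k 3) * d) • parityGen F := by
        rw [← map_smul, ← TensorProduct.tmul_smul, hL.1, TensorProduct.tmul_smul, map_smul, ha,
          smul_smul]
      have h2 : ∀ (i j : L) (G : Module.Dual R N'.I), d ^ 2 * T.contract i j G F.t =
          μ i * μ j * G (T.frame F hL).t := fun i j G => by
        have : d ^ 2 * T.contract i j G F.t = T.contract (d • i) (d • j) G F.t := by
          simp; ring
        rw [this, hL.1, hL.1]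
        simp only [map_smul, LinearMap.smul_apply, T.contract_apply, smul_eq_mul]
        simp only [TwistData.frame]
        ring
      have h3 : ∀ i x l, (T.frame F hL).ε i (T.f (x ⊗ₜ l)) = F.ε i x * μ l := fun i x l => by
        simp [TwistData.frame]
      have h4 := (parity_isFrame₁ F).1 (N.parityMk (x 0) (x 1) (x 2)
        (T.contract (k 0) (k 1) (f 0)) (T.contract (k 2) (k 3) (f 1)))
      have h5 : ∀ w : N.parityModule, d ^ 10 • w = d ^ 5 • d ^ 5 • w := fun w => by
        rw [smul_smul]; ring_nf
      rw [h5, h4]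
      simp only [LinearMap.comp_apply, LinearMap.applyₗ_apply_apply,
        LinearMap.smulRight_apply, map_smul, LinearEquiv.coe_coe, LinearMap.flip_apply,
        TensorProduct.mk_apply]
      rw [smul_comm d, h1, smul_smul, smul_smul]
      refine congrArg (· • parityGen F) ?_
      simp only [parityForm_mk, h3]
      have e1 := h2 (k 0) (k 1) (f 0)
      have e2 := h2 (k 2) (k 3) (f 1)
      generalize T.contract (k 0) (k 1) (f 0) F.t = c1 at e1 ⊢
      generalize T.contract (k 2) (k 3) (f 1) F.t = c2 at e2 ⊢
      have e3 : d ^ 5 * (c1 * c2) = d * ((μ (k 0) * μ (k 1) * f 0 (T.frame F hL).t) *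
        (μ (k 2) * μ (k 3) * f 1 (T.frame F hL).t)) := by rw [← e1, ← e2]; ring
      rw [mul_left_comm (d ^ 5), e3]
      ring)
  exact ⟨u, fun x y z l m n k F G => hu (![x, y, z], ![l, m, n, k], ![F, G])⟩

end Parity

end TwistData

end

end TernaryQuaternion

namespace TernaryQuaternion

noncomputable section

/-! ### The bijection between ternary quadratic modules and quaternion rings -/

section Bijection

variable {R : Type u} [CommRing R] {N N' : TernaryModule R} {L : Type u} [AddCommGroup L]
  [Module R L] (T : TwistData N N' L)

section ParityMap

variable {P : Type u} [AddCommGroup P] [Module R P] (ρ : P ⊗[R] L ≃ₗ[R] N.parityModule)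
  {u : N'.parityModule →ₗ[R] P}

/-- The factor d⁷ is d³ from the three frame vectors times d² from each of the two contracted forms;
the d on the left is μ(l). -/
theorem TwistData.parityMap_gen (hu : ∀ (x y z : N.M) (l m n k : L) (F G : Module.Dual R N'.I),
      ρ (u (N'.parityMk (T.f (x ⊗ₜ l)) (T.f (y ⊗ₜ m)) (T.f (z ⊗ₜ n)) F G) ⊗ₜ k) =
        N.parityMk x y z (T.contract l m F) (T.contract n k G)) {d : R}
    (F : TernaryFrame R N.M N.I d) {l : L} {μ : Module.Dual R L} (hL : IsFrame₁ d l μ) :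
    d • u (parityGen (T.frame F hL)) = d ^ 7 • slant μ (ρ.symm (parityGen F)) := by
  have h1 : parityGen (T.frame F hL) = d ^ 3 • N'.parityMk (T.f (F.e 0 ⊗ₜ l)) (T.f (F.e 1 ⊗ₜ l))
      (T.f (F.e 2 ⊗ₜ l)) (T.frame F hL).τ (T.frame F hL).τ := by
    have h2 := (exteriorPower.ιMulti R 3 (M := N'.M)).toMultilinearMap.map_smul_univ
      (fun _ => d) ![T.f (F.e 0 ⊗ₜ l), T.f (F.e 1 ⊗ₜ l), T.f (F.e 2 ⊗ₜ l)]
    rw [Finset.prod_const, Finset.card_univ, Fintype.card_fin] at h2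
    have h3 : (fun i => d • ![T.f (F.e 0 ⊗ₜ l), T.f (F.e 1 ⊗ₜ l), T.f (F.e 2 ⊗ₜ l)] i) =
        ![(T.frame F hL).e 0, (T.frame F hL).e 1, (T.frame F hL).e 2] := by
      ext i; fin_cases i <;> rfl
    rw [h3] at h2
    rw [parityGen, TernaryModule.parityMk, TernaryModule.parityMk, TensorProduct.smul_tmul']
    exact congrArg (· ⊗ₜ[R] _) h2
  have h2 := hu (F.e 0) (F.e 1) (F.e 2) l l l l (T.frame F hL).τ (T.frame F hL).τ
  have h3 : ρ (u (parityGen (T.frame F hL)) ⊗ₜ l) = d ^ 7 • parityGen F := by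
    rw [h1, map_smul, ← TensorProduct.smul_tmul', map_smul, h2, T.contract_frame]
    simp only [TernaryModule.parityMk, parityGen, TensorProduct.tmul_smul,
      ← TensorProduct.smul_tmul', smul_smul]
    congr 1
    ring
  have h4 := congrArg (fun z => slant μ (ρ.symm z)) h3
  simp only [LinearEquiv.symm_apply_apply, slant_tmul, hL.2, map_smul] at h4
  exact h4

theorem slant_isFrame₁ {d : R} (F : TernaryFrame R N.M N.I d) {l : L} {μ : Module.Dual R L}
    (hL : IsFrame₁ d l μ) : IsFrame₁ (d ^ 6) (slant μ (ρ.symm (parityGen F)))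
      (parityForm F ∘ₗ ρ.toLinearMap ∘ₗ (TensorProduct.mk R P L).flip l) := by
  have h := parity_isFrame₁ F
  constructor
  · intro b
    have h1 := h.1 (ρ (b ⊗ₜ l))
    have h2 := congrArg (fun z => slant μ (ρ.symm z)) h1
    simp only [map_smul, LinearEquiv.symm_apply_apply, slant_tmul, hL.2, smul_smul,
      ← pow_succ] at h2
    exact h2
  · change parityForm F (ρ (slant μ (ρ.symm (parityGen F)) ⊗ₜ l)) = _
    rw [hL.slant_tmul_self, map_smul, LinearEquiv.apply_symm_apply, map_smul, h.2, smul_eq_mul]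
    ring

theorem TwistData.parityMap_bijective [Module.Invertible R L]
    (hu : ∀ (x y z : N.M) (l m n k : L) (F G : Module.Dual R N'.I),
      ρ (u (N'.parityMk (T.f (x ⊗ₜ l)) (T.f (y ⊗ₜ m)) (T.f (z ⊗ₜ n)) F G) ⊗ₜ k) =
        N.parityMk x y z (T.contract l m F) (T.contract n k G)) : Function.Bijective u := by
  refine bijective_of_frames₁ (span_twistFrameSet N L) u ?_
  rintro d ⟨F, l, μ, hL⟩
  exact ⟨3 * 5, 6, 1, 7, _, _, _, _, pow_mul d 3 5 ▸ parity_isFrame₁ (T.frame F hL),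
    slant_isFrame₁ ρ F hL, by rw [pow_one, T.parityMap_gen ρ hu F hL]⟩

end ParityMap

variable {X : ParityRing R} {β : N.M →ₗ[R] N.M →ₗ[R] Module.Dual R N.I →ₗ[R] X.B}

theorem TwistData.quatTop_frame {d : R} (F : TernaryFrame R N.M N.I d) {l : L}
    {μ : Module.Dual R L} (hL : IsFrame₁ d l μ) :
    quatTop (T.frame F hL) (T.tri β) = d ^ 12 • quatTop F β := by
  have h := (exteriorPower.ιMulti R 4 (M := X.B)).toMultilinearMap.map_smul_univ
    ![1, d ^ 4, d ^ 4, d ^ 4] (quatBasis (β (F.e 1) (F.e 2) F.τ) (β (F.e 2) (F.e 0) F.τ)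
      (β (F.e 0) (F.e 1) F.τ))
  have h1 : ∏ i, ![1, d ^ 4, d ^ 4, d ^ 4] i = d ^ 12 := by
    rw [Fin.prod_univ_four]; simp; ring
  rw [h1] at h
  rw [quatTop, T.tri_frame, T.tri_frame, T.tri_frame]
  refine Eq.trans (congrArg _ ?_) h
  ext i
  fin_cases i <;> simp

/-- The algebra and β are already those of the twist, so only the parity factorizations must be
compared. Each is determined by its value on the local generator, where hX gives X.p and
`IsParity.apply_gen` the canonical one. -/
theorem TwistData.exists_isModel [Module.Invertible R L] (h : IsEvenClifford N.q β)
    {p : (N.parityModule ⊗[R] N.parityModule) ⊗[R] N.I →ₗ[R] ⋀[R]^4 X.B} (hp : IsParity N β p)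
    (ρ : X.P ⊗[R] L ≃ₗ[R] N.parityModule) (v : N'.I ≃ₗ[R] X.Q)
    (hX : ∀ (a b : X.P) (s : N.I) (l m : L), X.p ((a ⊗ₜ b) ⊗ₜ v (T.g (s ⊗ₜ (l ⊗ₜ m)))) =
      p ((ρ (a ⊗ₜ l) ⊗ₜ ρ (b ⊗ₜ m)) ⊗ₜ s)) :
    ∃ u, IsModel N' X (T.tri β) u v := by
  obtain ⟨u, hu⟩ := T.exists_parityMap ρ
  have h' := T.isEvenClifford h
  refine ⟨LinearEquiv.ofBijective u (T.parityMap_bijective ρ hu), h', ?_⟩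
  obtain ⟨p', hp'⟩ := exists_parity_linearMap h'
  convert hp' using 1
  refine LinearMap.ext fun z => eq_of_local (span_twistFrameSet N L) ?_
  rintro d ⟨F, l, μ, hL⟩
  -- 33 = 3 · 11 for the frame with denominator d³, and 2 because `TwistData.parityMap_gen`
  -- determines u(gen) only up to a factor d and u(gen) occurs twice.
  refine ⟨35, ?_⟩
  have hf := parity_total_isFrame₁ (T.frame F hL)
  rw [← pow_mul] at hf
  have key : d ^ 2 • X.p ((u (parityGen (T.frame F hL)) ⊗ₜ u (parityGen (T.frame F hL))) ⊗ₜ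
      v (T.frame F hL).t) = d ^ 2 • p' ((parityGen (T.frame F hL) ⊗ₜ parityGen (T.frame F hL)) ⊗ₜ
        (T.frame F hL).t) := by
    have h1 := T.parityMap_gen ρ hu F hL
    have h2 := hp'.apply_gen (T.frame F hL) (T.frame F hL).t
    rw [(T.frame F hL).pair, T.quatTop_frame] at h2
    rw [h2]
    have h3 : ∀ b c, d ^ 2 • X.p ((b ⊗ₜ b) ⊗ₜ c) = X.p (((d • b) ⊗ₜ (d • b)) ⊗ₜ c) :=
      fun b c => by
        simp only [← TensorProduct.smul_tmul', TensorProduct.tmul_smul, map_smul, smul_smul,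
          pow_two]
    have h4 := hX (slant μ (ρ.symm (parityGen F))) (slant μ (ρ.symm (parityGen F))) F.t l l
    rw [hL.slant_tmul_self, map_smul, LinearEquiv.apply_symm_apply] at h4
    rw [h3, h1]
    simp only [← TensorProduct.smul_tmul', TensorProduct.tmul_smul, map_smul] at h4 ⊢
    rw [hp.apply_gen, F.pair] at h4
    refine (congrArg (fun z => d ^ 7 • d ^ 7 • z) h4).trans ?_
    simp only [smul_smul]
    congr 1
    ring
  have h5 := hf.isFrame.ext (d ^ 2 • (X.p.toLinearMap ∘ₗ TensorProduct.map (TensorProduct.map u u)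
    v.toLinearMap)) (d ^ 2 • p') (fun _ => key) z
  rw [show d ^ 35 = d ^ (3 * 11) * d ^ 2 by ring, mul_smul, mul_smul]
  exact h5

/-- An isometry is a twist by the trivial module L = R. -/
theorem parity_isomorphic_of_isometric (h : TernaryModule.Isometric N N') :
    ParityRing.Isomorphic N.parity N'.parity := by
  obtain ⟨f, g, h⟩ := h
  let T : TwistData N N' R :=
    { f := (TensorProduct.rid R N.M).trans f
      g := TensorProduct.congr (LinearEquiv.refl R _) (TensorProduct.lid R R) ≪≫ₗ
        TensorProduct.rid R N.I ≪≫ₗ g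
      hq := fun x l => by simp [h, QuadraticMap.map_smul] }
  obtain ⟨u, hu⟩ := T.exists_isModel (parity_isModel N).isEvenClifford (X := N.parity)
    (canonicalParity_isParity N) (TensorProduct.rid R N.parityModule) g.symm (fun a b s l m => by
      have : g.symm (T.g (s ⊗ₜ (l ⊗ₜ m))) = (l * m) • s := by simp [T]
      have key : ∀ a b : N.parityModule, canonicalParity N ((a ⊗ₜ b) ⊗ₜ ((l * m) • s)) =
          canonicalParity N ((TensorProduct.rid R N.parityModule (a ⊗ₜ l) ⊗ₜ
            TensorProduct.rid R N.parityModule (b ⊗ₜ m)) ⊗ₜ s) := fun a b => by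
        simp only [TensorProduct.rid_tmul, ← TensorProduct.smul_tmul', TensorProduct.tmul_smul,
          smul_smul, map_smul, mul_comm]
      exact (congrArg (fun z => canonicalParity N ((a ⊗ₜ b) ⊗ₜ z)) this).trans (key a b))
  exact (ParityRing.isomorphicSetoid R).iseqv.symm hu.isomorphic

theorem ParityRing.p_dualParity (X : ParityRing R) (a b : X.P) (ξ ξ' : Module.Dual R X.P)
    (w : ⋀[R]^4 X.B) : X.p ((a ⊗ₜ b) ⊗ₜ X.dualParity ξ ξ' w) = (ξ a * ξ' b) • w := by
  obtain ⟨z, rfl⟩ := X.p.surjective w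
  induction z with
  | zero => simp
  | add x y hx hy => simp only [map_add, TensorProduct.tmul_add, hx, hy, smul_add]
  | tmul z c =>
  induction z with
  | zero => simp
  | add x y hx hy =>
    simp only [map_add, TensorProduct.tmul_add, TensorProduct.add_tmul, hx, hy, smul_add]
  | tmul a' b' =>
    rw [X.dualParity_p, ← map_smul, TensorProduct.tmul_smul]
    have : ∀ (r s : R) (a b : X.P) (c : X.Q), (r * s) • ((a ⊗ₜ[R] b) ⊗ₜ[R] c) =
        ((r • a) ⊗ₜ (s • b)) ⊗ₜ c := fun r s a b c => by
      simp only [← TensorProduct.smul_tmul', TensorProduct.tmul_smul, smul_smul, mul_comm]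
    rw [this, this, Invertible.apply_smul_comm ξ, Invertible.apply_smul_comm ξ']

/-- With D = P^∨ this compares two parity factorizations of one algebra: for L = P^∨ ⊗ 𝒫, the
canonical p sends 𝒫^{⊗2} ⊗ I to ⋀⁴B, and p^* contracts that to Q. -/
theorem exists_tensor_pairing {D P I W Q : Type*} [AddCommMonoid D] [Module R D]
    [AddCommMonoid P] [Module R P] [AddCommMonoid I] [Module R I] [AddCommMonoid W] [Module R W]
    [AddCommMonoid Q] [Module R Q] (K : D →ₗ[R] D →ₗ[R] W →ₗ[R] Q) (p : (P ⊗[R] P) ⊗[R] I →ₗ[R] W) :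
    ∃ g : I ⊗[R] ((D ⊗[R] P) ⊗[R] (D ⊗[R] P)) →ₗ[R] Q, ∀ s ξ π ξ' π',
      g (s ⊗ₜ ((ξ ⊗ₜ π) ⊗ₜ (ξ' ⊗ₜ π'))) = K ξ ξ' (p ((π ⊗ₜ π') ⊗ₜ s)) :=
  ⟨TensorProduct.lift (TensorProduct.lift K) ∘ₗ LinearMap.lTensor _ p ∘ₗ
    LinearMap.lTensor _ (TensorProduct.comm R I (P ⊗[R] P)).toLinearMap ∘ₗ
    (TensorProduct.leftComm R I (D ⊗[R] D) (P ⊗[R] P)).toLinearMap ∘ₗ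
    LinearMap.lTensor I (TensorProduct.tensorTensorTensorComm R D P D P).toLinearMap,
    fun _ _ _ _ _ => rfl⟩

theorem exists_twistData {L : Type u} [AddCommGroup L] [Module R L] [Module.Invertible R L]
    (N : TernaryModule R) {Q : Type u} [AddCommGroup Q] [Module R Q] [Module.Invertible R Q]
    (g : N.I ⊗[R] (L ⊗[R] L) ≃ₗ[R] Q) :
    ∃ (N' : TernaryModule R) (T : TwistData N N' L) (v : N'.I ≃ₗ[R] Q), ∀ z, v (T.g z) = g z := by
  obtain ⟨q', hq'⟩ := exists_twist (L := L) N.q (LinearMap.mk₂ R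
    (fun l m => g.toLinearMap ∘ₗ (TensorProduct.mk R N.I (L ⊗[R] L)).flip (l ⊗ₜ m))
    (fun l l' m => by ext; simp [TensorProduct.add_tmul])
    (fun c l m => by ext; simp [← TensorProduct.smul_tmul'])
    (fun l m m' => by ext; simp [TensorProduct.tmul_add])
    (fun c l m => by ext; simp))
  let N' : TernaryModule R :=
    { M := N.M ⊗[R] L
      I := Q
      isTernary := isTernary_of_equiv N.isTernary (TensorProduct.rid R N.M).symm
      q := q' }
  exact ⟨N', ⟨LinearEquiv.refl R _, g, hq'⟩, LinearEquiv.refl R _, fun z => rfl⟩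

/-- Start from any quadratic module N whose even Clifford algebra is B and twist it by L = P^∨ ⊗ 𝒫.
Then P ⊗ L ≅ 𝒫, and I ⊗ L^{⊗2} ≅ Q by comparison of p with the canonical factorization. -/
theorem ParityRing.exists_parity_isomorphic (X : ParityRing R) :
    ∃ N : TernaryModule R, ParityRing.Isomorphic N.parity X := by
  obtain ⟨N, β, h⟩ := X.exists_isEvenClifford
  obtain ⟨p, hp⟩ := h.exists_parity
  replace hp := (hp p).2 rfl
  have hP := parityModule_invertible N
  have hI := N.isTernary.invertible
  obtain ⟨g, hg⟩ := exists_tensor_pairing X.dualParityₗ p.toLinearMap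
  -- Both modules are invertible, so surjectivity already gives bijectivity.
  have hsurj : Function.Surjective g := by
    intro c
    suffices c ∈ LinearMap.range g from this
    -- For r = ξ(a), the multiple r² c is p^*(ξ ⊗ ξ) applied to p(a ⊗ a ⊗ c), and that element of
    -- ⋀⁴B comes from 𝒫^{⊗2} ⊗ I.
    refine mem_of_local (span_frame_invertible R X.P) _ c ?_
    rintro r ⟨a, ξ, -, rfl⟩
    refine ⟨2, ?_⟩
    have h1 := X.dualParity_p ξ ξ a a c
    rw [← pow_two] at h1
    rw [← h1]
    obtain ⟨z, hz⟩ := p.surjective (X.p ((a ⊗ₜ a) ⊗ₜ c))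
    rw [← hz]
    generalize z = z
    clear hz
    induction z with
    | zero => simp
    | add x y hx hy => rw [map_add, map_add]; exact add_mem hx hy
    | tmul z s =>
    induction z with
    | zero => simp
    | add x y hx hy => rw [TensorProduct.add_tmul, map_add, map_add]; exact add_mem hx hy
    | tmul π π' => exact ⟨_, hg s ξ π ξ π'⟩
  obtain ⟨N', T, v, hT⟩ := exists_twistData (L := Module.Dual R X.P ⊗[R] N.parityModule) N
    (LinearEquiv.ofBijective g (Module.Invertible.bijective_of_surjective hsurj))
  let ρ : X.P ⊗[R] (Module.Dual R X.P ⊗[R] N.parityModule) ≃ₗ[R] N.parityModule :=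
    (TensorProduct.assoc R _ _ _).symm ≪≫ₗ TensorProduct.congr (TensorProduct.comm R _ _ ≪≫ₗ
      Module.Invertible.linearEquiv R X.P) (LinearEquiv.refl R _) ≪≫ₗ TensorProduct.lid R _
  have hρ : ∀ a ξ π, ρ (a ⊗ₜ (ξ ⊗ₜ π)) = ξ a • π := fun a ξ π => rfl
  obtain ⟨u, hu⟩ := T.exists_isModel h hp ρ v (fun a b s l m => by
    rw [hT]
    change X.p ((a ⊗ₜ b) ⊗ₜ g (s ⊗ₜ (l ⊗ₜ m))) = _
    induction l with
    | zero => simp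
    | add x y hx hy => simp only [TensorProduct.add_tmul, TensorProduct.tmul_add, map_add, hx, hy]
    | tmul ξ π =>
    induction m with
    | zero => simp
    | add x y hx hy => simp only [TensorProduct.add_tmul, TensorProduct.tmul_add, map_add, hx, hy]
    | tmul ξ' π' =>
      rw [hg, hρ, hρ]
      refine (X.p_dualParity a b ξ ξ' _).trans ?_
      simp only [← TensorProduct.smul_tmul', TensorProduct.tmul_smul, smul_smul, map_smul]
      rw [mul_comm])
  exact ⟨N', hu.isomorphic⟩

theorem parity_ternary_isometric (N : TernaryModule R) :
    TernaryModule.Isometric N.parity.ternary N := (parity_isModel N).isometric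

theorem isometric_of_parity_isomorphic (h : ParityRing.Isomorphic N.parity X) :
    TernaryModule.Isometric X.ternary N := by
  obtain ⟨β, u, v, h⟩ := IsModel.of_isomorphic h
  exact h.isometric

variable (R) in
/-- The bijection between isometry classes of ternary quadratic modules and isomorphism classes of
quaternion rings with a parity factorization. -/
def classEquiv : TernaryClass R ≃ ParityClass R where
  toFun := Quotient.map TernaryModule.parity fun _ _ h => parity_isomorphic_of_isometric h
  -- Isomorphic X and X' are both isomorphic to one `N.parity`, and each then has a quadratic module
  -- isometric to N.
  invFun := Quotient.map ParityRing.ternary fun X X' h => by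
    obtain ⟨N, hN⟩ := X.exists_parity_isomorphic
    exact Setoid.trans (isometric_of_parity_isomorphic hN)
      (Setoid.symm (isometric_of_parity_isomorphic (Setoid.trans hN h)))
  left_inv := by
    rintro ⟨N⟩
    exact Quotient.sound (parity_ternary_isometric N)
  right_inv := by
    rintro ⟨X⟩
    obtain ⟨N, hN⟩ := X.exists_parity_isomorphic
    exact Quotient.sound (Setoid.trans
      (parity_isomorphic_of_isometric (isometric_of_parity_isomorphic hN)) hN)

end Bijection

end

end TernaryQuaternion

namespace TernaryQuaternion

noncomputable section

/-! ### Base change -/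

section Frames

variable {R : Type*} [CommRing R] (S : Type*) [CommRing S] [Algebra R S]
variable {X : Type*} [AddCommMonoid X] [Module R X]

/-- The base change of linear forms. -/
def formBaseChange : Module.Dual R X →ₗ[R] Module.Dual S (S ⊗[R] X) where
  toFun ε := LinearMap.liftBaseChange S (Algebra.linearMap R S ∘ₗ ε)
  map_add' ε ε' := by ext; simp
  map_smul' c ε := by ext; simp [Algebra.smul_def]

@[simp]
theorem formBaseChange_tmul (ε : Module.Dual R X) (s : S) (x : X) :
    formBaseChange S ε (s ⊗ₜ x) = s * algebraMap R S (ε x) := by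
  simp [formBaseChange]

theorem IsFrame.baseChange {n : ℕ} {r : R} {e : Fin n → X} {ε : Fin n → Module.Dual R X}
    (h : IsFrame r e ε) : IsFrame (algebraMap R S r) (fun i => (1 : S) ⊗ₜ[R] e i)
      (fun i => formBaseChange S (ε i)) where
  expand z := by
    induction z with
    | zero => simp
    | add x y hx hy => simp only [smul_add, hx, hy, map_add, add_smul, Finset.sum_add_distrib]
    | tmul s x =>
      rw [algebraMap_smul, ← TensorProduct.tmul_smul, h.expand, TensorProduct.tmul_sum]
      refine Finset.sum_congr rfl fun i _ => ?_
      rw [formBaseChange_tmul, TensorProduct.tmul_smul, mul_comm, mul_smul, algebraMap_smul]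
      congr 1
      rw [TensorProduct.smul_tmul', smul_eq_mul, mul_one]
  pair i j := by
    rw [formBaseChange_tmul, h.pair, one_mul, apply_ite (algebraMap R S), map_zero]

theorem IsFrame₁.baseChange {r : R} {e : X} {ε : Module.Dual R X} (h : IsFrame₁ r e ε) :
    IsFrame₁ (algebraMap R S r) ((1 : S) ⊗ₜ[R] e) (formBaseChange S ε) :=
  (h.isFrame.baseChange S).isFrame₁

theorem IsFrame₁.pow_one {r : R} {e : X} {ε : Module.Dual R X} (h : IsFrame₁ r e ε) :
    IsFrame₁ (r ^ 1) e ε := by rwa [_root_.pow_one]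

theorem span_image_eq_top {T : Set R} (hT : Ideal.span T = ⊤) :
    Ideal.span (algebraMap R S '' T) = ⊤ := by
  rw [← Ideal.map_span, hT, Ideal.map_top]

end Frames

variable {R : Type u} [CommRing R] {S : Type u} [CommRing S] [Algebra R S]

/-- The data that exhibit `N'` as the base change of `N`. -/
structure BaseChangeData (N : TernaryModule R) (N' : TernaryModule S) where
  f : S ⊗[R] N.M ≃ₗ[S] N'.M
  g : S ⊗[R] N.I ≃ₗ[S] N'.I
  hq : ∀ x, N'.q (f (1 ⊗ₜ x)) = g (1 ⊗ₜ N.q x)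

variable (S) in
/-- The base change of a ternary quadratic module. -/
def TernaryModule.baseChangeData (N : TernaryModule R) : BaseChangeData N (N.baseChange S) where
  f := LinearEquiv.refl S _
  g := LinearEquiv.refl S _
  hq x := (quadraticBaseChange_tmul S N.q 1 x).trans (by rw [one_mul]; rfl)

section BaseChangeData

variable {N : TernaryModule R} {N' : TernaryModule S} (T : BaseChangeData N N')

/-- The base change of a frame. -/
def BaseChangeData.frame {r : R} (F : TernaryFrame R N.M N.I r) :
    TernaryFrame S N'.M N'.I (algebraMap R S r) where
  e i := T.f (1 ⊗ₜ F.e i)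
  ε i := formBaseChange S (F.ε i) ∘ₗ T.f.symm.toLinearMap
  t := T.g (1 ⊗ₜ F.t)
  τ := formBaseChange S F.τ ∘ₗ T.g.symm.toLinearMap
  isFrame := by
    have h := F.isFrame.baseChange S
    refine ⟨fun x => ?_, fun i j => ?_⟩
    · have := congrArg T.f (h.expand (T.f.symm x))
      simp only [map_smul, map_sum, LinearEquiv.apply_symm_apply] at this
      exact this
    · have := h.pair i j
      simpa only [LinearMap.comp_apply, LinearEquiv.coe_coe, LinearEquiv.symm_apply_apply] using this
  expand s := by
    have := congrArg T.g ((F.isFrame₁.baseChange S).1 (T.g.symm s))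
    simp only [map_smul, LinearEquiv.apply_symm_apply] at this
    exact this
  pair := by
    have := (F.isFrame₁.baseChange S).2
    simpa only [LinearMap.comp_apply, LinearEquiv.coe_coe, LinearEquiv.symm_apply_apply] using this

/-- The base change of linear forms on `I`. -/
def BaseChangeData.form : Module.Dual R N.I →ₗ[R] Module.Dual S N'.I where
  toFun f := formBaseChange S f ∘ₗ T.g.symm.toLinearMap
  map_add' f f' := by rw [map_add, LinearMap.add_comp]
  map_smul' c f := by rw [map_smul, LinearMap.smul_comp]; rfl

@[simp]
theorem BaseChangeData.form_apply (f : Module.Dual R N.I) (s : S) (x : N.I) :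
    T.form f (T.g (s ⊗ₜ x)) = s * algebraMap R S (f x) := by
  simp [BaseChangeData.form]

/-- The isomorphism of `S ⊗ I^∨` with the dual of the base change of `I`. -/
def BaseChangeData.dualEquiv : S ⊗[R] Module.Dual R N.I ≃ₗ[S] Module.Dual S N'.I :=
  LinearEquiv.ofBijective (LinearMap.liftBaseChange S T.form) <| by
    refine bijective_of_frames₁ (span_image_eq_top S N.span_frameSet) _ ?_
    rintro _ ⟨r, ⟨F⟩, rfl⟩
    have h1 := F.isFrame₁.dual.baseChange S
    have h2 := (T.frame F).isFrame₁.dual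
    refine ⟨1, 1, 0, 0, _, _, _, _, h1.pow_one, h2.pow_one, ?_⟩
    rw [LinearMap.liftBaseChange_tmul, one_smul]
    rfl

@[simp]
theorem BaseChangeData.dualEquiv_tmul (f : Module.Dual R N.I) :
    T.dualEquiv (1 ⊗ₜ f) = T.form f := by
  change LinearMap.liftBaseChange S T.form (1 ⊗ₜ f) = _
  rw [LinearMap.liftBaseChange_tmul, one_smul]

theorem BaseChangeData.dual_induction {p : Module.Dual S N'.I → Prop} (h0 : p 0)
    (ht : ∀ f, p (T.form f)) (hs : ∀ (s : S) F, p F → p (s • F))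
    (ha : ∀ F G, p F → p G → p (F + G)) (F : Module.Dual S N'.I) : p F := by
  obtain ⟨z, rfl⟩ := T.dualEquiv.surjective F
  induction z with
  | zero => simpa using h0
  | tmul s f =>
    have : s ⊗ₜ[R] f = s • ((1 : S) ⊗ₜ[R] f) := by rw [TensorProduct.smul_tmul', smul_eq_mul, mul_one]
    rw [this, map_smul, T.dualEquiv_tmul]
    exact hs _ _ (ht f)
  | add x y hx hy => rw [map_add]; exact ha _ _ hx hy

theorem BaseChangeData.induction {p : N'.M → Prop} (h0 : p 0)
    (ht : ∀ x, p (T.f (1 ⊗ₜ x))) (hs : ∀ (s : S) x, p x → p (s • x))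
    (ha : ∀ x y, p x → p y → p (x + y)) (x : N'.M) : p x := by
  obtain ⟨z, rfl⟩ := T.f.surjective x
  induction z with
  | zero => simpa using h0
  | tmul s f =>
    have : s ⊗ₜ[R] f = s • ((1 : S) ⊗ₜ[R] f) := by rw [TensorProduct.smul_tmul', smul_eq_mul, mul_one]
    rw [this, map_smul]
    exact hs _ _ (ht f)
  | add x y hx hy => rw [map_add]; exact ha _ _ hx hy

/-- The frame vectors and their pairwise sums are all of the form 1 ⊗ x, and they determine a
quadratic map over S. -/
theorem BaseChangeData.quadratic_ext {Z : Type*} [AddCommGroup Z] [Module S Z]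
    {Q Q' : QuadraticMap S N'.M Z} (h : ∀ x, Q (T.f (1 ⊗ₜ x)) = Q' (T.f (1 ⊗ₜ x))) (z : N'.M) :
    Q z = Q' z := by
  refine eq_of_local (span_image_eq_top S N.span_frameSet) ?_
  rintro _ ⟨r, ⟨F⟩, rfl⟩
  exact ⟨2, (T.frame F).isFrame.quadratic_ext Q Q' (fun i => h _) (fun i j _ => by
    have : (T.frame F).e i + (T.frame F).e j = T.f (1 ⊗ₜ (F.e i + F.e j)) := by
      rw [TensorProduct.tmul_add, map_add]; rfl
    rw [this, h]) z⟩

variable {A : Type u} [Ring A] [Algebra R A] (β : N.M →ₗ[R] N.M →ₗ[R] Module.Dual R N.I →ₗ[R] A)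

/-- The base change of the trilinear map `β`, before the identifications of `T`. -/
def preBaseChange : S ⊗[R] N.M →ₗ[S] S ⊗[R] N.M →ₗ[S] S ⊗[R] Module.Dual R N.I →ₗ[S] S ⊗[R] A :=
  LinearMap.liftBaseChange S
    { toFun := fun x => LinearMap.liftBaseChange S (LinearMap.baseChangeHom R S _ _ ∘ₗ β x)
      map_add' := fun x y => by ext; simp
      map_smul' := fun c x => by ext; simp }

/-- The base change of the trilinear map `β`. -/
def BaseChangeData.tri : N'.M →ₗ[S] N'.M →ₗ[S] Module.Dual S N'.I →ₗ[S] S ⊗[R] A :=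
  ((preBaseChange (S := S) β).compl₁₂ T.f.symm.toLinearMap T.f.symm.toLinearMap).compr₂
    (LinearMap.lcomp S (S ⊗[R] A) T.dualEquiv.symm.toLinearMap)

theorem BaseChangeData.tri_apply (x y : N.M) (f : Module.Dual R N.I) :
    T.tri β (T.f (1 ⊗ₜ x)) (T.f (1 ⊗ₜ y)) (T.form f) = 1 ⊗ₜ β x y f := by
  have : T.dualEquiv.symm (T.form f) = 1 ⊗ₜ f := by
    rw [LinearEquiv.symm_apply_eq, T.dualEquiv_tmul]
  simp [BaseChangeData.tri, preBaseChange, this]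

variable {β}

theorem BaseChangeData.isEvenMap (h : IsEvenMap N.q β) : IsEvenMap N'.q (T.tri β) where
  sq z F := by
    induction F using T.dual_induction with
    | h0 => simp
    | hs s F hF => simp only [map_smul, LinearMap.smul_apply, hF, smul_eq_mul, Algebra.smul_def,
        map_mul]
    | ha F G hF hG => simp only [map_add, LinearMap.add_apply, hF, hG]
    | ht f =>
    have := T.quadratic_ext
      (Q := LinearMap.BilinMap.toQuadraticMap ((T.tri β).compr₂ (LinearMap.applyₗ (T.form f))))
      (Q' := (Algebra.linearMap S (S ⊗[R] A) ∘ₗ T.form f).compQuadraticMap N'.q) (fun x => ?_) z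
    · exact this
    · change T.tri β (T.f (1 ⊗ₜ x)) (T.f (1 ⊗ₜ x)) (T.form f) =
        algebraMap S (S ⊗[R] A) (T.form f (N'.q (T.f (1 ⊗ₜ x))))
      rw [T.tri_apply, h.sq, T.hq, T.form_apply, one_mul, Algebra.TensorProduct.algebraMap_apply,
        Algebra.algebraMap_eq_smul_one, Algebra.algebraMap_eq_smul_one,
        Algebra.algebraMap_eq_smul_one, smul_assoc, one_smul, TensorProduct.smul_tmul]
  mul x y z F G := by
    induction x using T.induction with
    | h0 => simp
    | hs s x hx => simp only [map_smul, LinearMap.smul_apply, smul_mul_assoc, hx, smul_comm s]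
    | ha x x' hx hx' => simp only [map_add, LinearMap.add_apply, add_mul, hx, hx', smul_add]
    | ht x =>
    induction z using T.induction with
    | h0 => simp
    | hs s z hz => simp only [map_smul, LinearMap.smul_apply, mul_smul_comm, hz, smul_comm s]
    | ha z z' hz hz' => simp only [map_add, LinearMap.add_apply, mul_add, hz, hz', smul_add]
    | ht z =>
    induction F using T.dual_induction with
    | h0 => simp
    | hs s F hF => simp only [map_smul, LinearMap.smul_apply, smul_mul_assoc, hF, smul_eq_mul,
        mul_smul]
    | ha F F' hF hF' => simp only [map_add, LinearMap.add_apply, add_mul, hF, hF', add_smul]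
    | ht f =>
    induction G using T.dual_induction with
    | h0 => simp
    | hs s G hG => simp only [map_smul, mul_smul_comm, hG, smul_comm s]
    | ha G G' hG hG' => simp only [map_add, mul_add, hG, hG', smul_add]
    | ht g =>
    have := T.quadratic_ext
      (Q := LinearMap.BilinMap.toQuadraticMap ((LinearMap.mul S (S ⊗[R] A)).compl₁₂
        ((LinearMap.applyₗ (T.form f)) ∘ₗ T.tri β (T.f (1 ⊗ₜ x)))
        ((LinearMap.applyₗ (T.form g)) ∘ₗ (T.tri β).flip (T.f (1 ⊗ₜ z)))))
      (Q' := ((T.form f).smulRight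
        (T.tri β (T.f (1 ⊗ₜ x)) (T.f (1 ⊗ₜ z)) (T.form g))).compQuadraticMap N'.q)
      (fun y => ?_) y
    · exact this
    · change T.tri β (T.f (1 ⊗ₜ x)) (T.f (1 ⊗ₜ y)) (T.form f) *
        T.tri β (T.f (1 ⊗ₜ y)) (T.f (1 ⊗ₜ z)) (T.form g) =
        T.form f (N'.q (T.f (1 ⊗ₜ y))) • T.tri β (T.f (1 ⊗ₜ x)) (T.f (1 ⊗ₜ z)) (T.form g)
      rw [T.tri_apply, T.tri_apply, T.tri_apply, T.hq, T.form_apply, one_mul,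
        Algebra.TensorProduct.tmul_mul_tmul, h.mul, one_mul, algebraMap_smul,
        TensorProduct.tmul_smul]

theorem BaseChangeData.tri_frame {r : R} (F : TernaryFrame R N.M N.I r) (i j : Fin 3) :
    T.tri β ((T.frame F).e i) ((T.frame F).e j) (T.frame F).τ = 1 ⊗ₜ β (F.e i) (F.e j) F.τ :=
  T.tri_apply β _ _ _

/-- A frame whose denominator is given in two ways. -/
def TernaryFrame.copy {R M I : Type*} [CommRing R] [AddCommGroup M] [Module R M] [AddCommGroup I]
    [Module R I] {r r' : R} (F : TernaryFrame R M I r) (h : r = r') : TernaryFrame R M I r' where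
  e := F.e
  ε := F.ε
  t := F.t
  τ := F.τ
  isFrame := h ▸ F.isFrame
  expand := h ▸ F.expand
  pair := h ▸ F.pair

theorem quatBasis_baseChange (i j k : A) : (fun m => (1 : S) ⊗ₜ[R] quatBasis i j k m) =
    quatBasis ((1 : S) ⊗ₜ[R] i) ((1 : S) ⊗ₜ[R] j) ((1 : S) ⊗ₜ[R] k) := by
  funext m
  fin_cases m <;> rfl

theorem BaseChangeData.isEvenClifford (h : IsEvenClifford N.q β) :
    IsEvenClifford N'.q (T.tri β) := by
  refine (T.isEvenMap h.toIsEvenMap).of_frames (span_image_eq_top S N.span_frameSet) ?_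
  rintro _ ⟨r, ⟨F⟩, rfl⟩
  obtain ⟨θ, hθ, -⟩ := h.exists_frame F
  have h1 := hθ.baseChange S
  rw [map_pow, quatBasis_baseChange, ← T.tri_frame, ← T.tri_frame, ← T.tri_frame] at h1
  exact ⟨1, 3, (T.frame F).copy (pow_one _).symm, _, h1⟩

end BaseChangeData

end

end TernaryQuaternion

namespace TernaryQuaternion

noncomputable section

/-! ### Base change of parity factorizations -/

variable {R : Type u} [CommRing R] {S : Type u} [CommRing S] [Algebra R S]

/-- Locally the generator of the top exterior power goes to the generator. -/
theorem wedgeBaseChange_bijective {A : Type u} [AddCommGroup A] [Module R A] {n : ℕ} {T : Set R}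
    (hT : Ideal.span T = ⊤) (h : ∀ r ∈ T, ∃ (k : ℕ) (e : Fin n → A) (θ : Fin n → Module.Dual R A),
      IsFrame (r ^ k) e θ) :
    Function.Bijective (LinearMap.liftBaseChange S (wedgeBaseChange (R := R) S n A)) := by
  refine bijective_of_frames₁ (span_image_eq_top S hT) _ ?_
  rintro _ ⟨r, hr, rfl⟩
  obtain ⟨k, e, θ, hθ⟩ := h r hr
  have h1 := hθ.wedge.baseChange S
  have h2 := (hθ.baseChange S).wedge
  rw [← pow_mul, map_pow] at h1
  rw [map_pow, ← pow_mul] at h2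
  refine ⟨k * n, k * n, 0, 0, _, _, _, _, h1, h2, ?_⟩
  rw [LinearMap.liftBaseChange_tmul, one_smul, wedgeBaseChange_ιMulti]

section Parity

variable {N : TernaryModule R} {N' : TernaryModule S} (T : BaseChangeData N N')

/-- The map from the base change of `⋀³ M ⊗ (I^∨)^{⊗2}` to the module attached to the base change
of `(M,I,q)`. -/
def BaseChangeData.parityMap : S ⊗[R] N.parityModule →ₗ[S] N'.parityModule :=
  TensorProduct.map (exteriorPower.map 3 T.f.toLinearMap ∘ₗ
      LinearMap.liftBaseChange S (wedgeBaseChange S 3 N.M))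
    (TensorProduct.map T.dualEquiv.toLinearMap T.dualEquiv.toLinearMap ∘ₗ
      (TensorProduct.AlgebraTensorModule.distribBaseChange R S _ _).toLinearMap) ∘ₗ
    (TensorProduct.AlgebraTensorModule.distribBaseChange R S _ _).toLinearMap

theorem BaseChangeData.parityMap_parityMk (x y z : N.M) (f g : Module.Dual R N.I) :
    T.parityMap (1 ⊗ₜ N.parityMk x y z f g) =
      N'.parityMk (T.f (1 ⊗ₜ x)) (T.f (1 ⊗ₜ y)) (T.f (1 ⊗ₜ z)) (T.form f) (T.form g) := by
  have : (T.f ∘ fun i => (1 : S) ⊗ₜ[R] ![x, y, z] i) =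
      ![T.f (1 ⊗ₜ x), T.f (1 ⊗ₜ y), T.f (1 ⊗ₜ z)] := by
    ext i; fin_cases i <;> rfl
  simp only [parityMap, TernaryModule.parityMk, LinearMap.comp_apply, LinearEquiv.coe_coe,
    TensorProduct.AlgebraTensorModule.distribBaseChange_tmul, TensorProduct.map_tmul,
    LinearMap.liftBaseChange_tmul, one_smul, wedgeBaseChange_ιMulti,
    exteriorPower.map_apply_ιMulti, dualEquiv_tmul, this]

theorem BaseChangeData.parityMap_gen {r : R} (F : TernaryFrame R N.M N.I r) :
    T.parityMap (1 ⊗ₜ parityGen F) = parityGen (T.frame F) :=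
  T.parityMap_parityMk _ _ _ _ _

theorem BaseChangeData.parityMap_bijective : Function.Bijective T.parityMap := by
  refine bijective_of_frames₁ (span_image_eq_top S N.span_frameSet) _ ?_
  rintro _ ⟨r, ⟨F⟩, rfl⟩
  have h1 := (parity_isFrame₁ F).baseChange S
  rw [map_pow] at h1
  refine ⟨5, 5, 0, 0, _, _, _, _, h1, parity_isFrame₁ (T.frame F), ?_⟩
  rw [T.parityMap_gen]

/-- The base change of `⋀³ M ⊗ (I^∨)^{⊗2}`. -/
def BaseChangeData.parityEquiv : S ⊗[R] N.parityModule ≃ₗ[S] N'.parityModule :=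
  LinearEquiv.ofBijective T.parityMap T.parityMap_bijective

theorem BaseChangeData.parityEquiv_symm_gen {r : R} (F : TernaryFrame R N.M N.I r) :
    T.parityEquiv.symm (parityGen (T.frame F)) = 1 ⊗ₜ parityGen F := by
  rw [LinearEquiv.symm_apply_eq]
  exact (T.parityMap_gen F).symm

theorem BaseChangeData.quatTop_frame {A : Type u} [Ring A] [Algebra R A]
    (β : N.M →ₗ[R] N.M →ₗ[R] Module.Dual R N.I →ₗ[R] A) {r : R} (F : TernaryFrame R N.M N.I r) :
    quatTop (T.frame F) (T.tri β) = wedgeBaseChange S 4 A (quatTop F β) := by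
  rw [quatTop, quatTop, wedgeBaseChange_ιMulti, quatBasis_baseChange, T.tri_frame, T.tri_frame,
    T.tri_frame]

end Parity

variable (S) (X : ParityRing R)

/-- The trilinear map extended to S makes S ⊗ B an even Clifford algebra of the extended quadratic
module, and such an algebra is unique up to isomorphism. -/
theorem ParityRing.isQuaternionRing_baseChange : IsQuaternionRing S (S ⊗[R] X.B) := by
  obtain ⟨N, β, h⟩ := X.exists_isEvenClifford
  have h1 := (N.baseChangeData S).isEvenClifford h
  obtain ⟨ψ, -⟩ := h1.exists_algEquiv (N.baseChange S).isTernary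
    (evenTri_isEvenClifford (N.baseChange S).q (N.baseChange S).isTernary)
  exact ⟨N.baseChange S, ⟨ψ⟩⟩

theorem ParityRing.wedgeBaseChange_bijective :
    Function.Bijective (LinearMap.liftBaseChange S (wedgeBaseChange (R := R) S 4 X.B)) := by
  obtain ⟨N, β, h⟩ := X.exists_isEvenClifford
  refine TernaryQuaternion.wedgeBaseChange_bijective N.span_frameSet ?_
  rintro r ⟨F⟩
  obtain ⟨θ, hθ, -⟩ := h.exists_frame F
  exact ⟨3, _, θ, hθ⟩

/-- The base change of a parity factorization. -/
def ParityRing.parityBaseChange :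
    ((S ⊗[R] X.P) ⊗[S] (S ⊗[R] X.P)) ⊗[S] (S ⊗[R] X.Q) ≃ₗ[S] ⋀[S]^4 (S ⊗[R] X.B) :=
  TensorProduct.congr (TensorProduct.AlgebraTensorModule.distribBaseChange R S X.P X.P).symm
      (LinearEquiv.refl S _) ≪≫ₗ
    (TensorProduct.AlgebraTensorModule.distribBaseChange R S (X.P ⊗[R] X.P) X.Q).symm ≪≫ₗ
    X.p.baseChange R S _ _ ≪≫ₗ
    LinearEquiv.ofBijective _ (X.wedgeBaseChange_bijective S)

theorem ParityRing.parityBaseChange_tmul (a b : X.P) (c : X.Q) :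
    X.parityBaseChange S ((((1 : S) ⊗ₜ[R] a) ⊗ₜ[S] ((1 : S) ⊗ₜ[R] b)) ⊗ₜ[S] ((1 : S) ⊗ₜ[R] c)) =
      wedgeBaseChange S 4 X.B (X.p ((a ⊗ₜ[R] b) ⊗ₜ[R] c)) := by
  have h1 : (TensorProduct.AlgebraTensorModule.distribBaseChange R S X.P X.P).symm
      (((1 : S) ⊗ₜ[R] a) ⊗ₜ[S] ((1 : S) ⊗ₜ[R] b)) = 1 ⊗ₜ (a ⊗ₜ b) := by
    rw [LinearEquiv.symm_apply_eq, TensorProduct.AlgebraTensorModule.distribBaseChange_tmul]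
  have h2 : (TensorProduct.AlgebraTensorModule.distribBaseChange R S (X.P ⊗[R] X.P) X.Q).symm
      (((1 : S) ⊗ₜ[R] (a ⊗ₜ[R] b)) ⊗ₜ[S] ((1 : S) ⊗ₜ[R] c)) = 1 ⊗ₜ ((a ⊗ₜ b) ⊗ₜ c) := by
    rw [LinearEquiv.symm_apply_eq, TensorProduct.AlgebraTensorModule.distribBaseChange_tmul]
  simp only [parityBaseChange, LinearEquiv.trans_apply, TensorProduct.congr_tmul, h1,
    LinearEquiv.refl_apply, h2]
  change LinearMap.liftBaseChange S (wedgeBaseChange (R := R) S 4 X.B) (1 ⊗ₜ _) = _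
  rw [LinearMap.liftBaseChange_tmul, one_smul]
  rfl

theorem ParityRing.isParityBaseChange_iff
    (pS : ((S ⊗[R] X.P) ⊗[S] (S ⊗[R] X.P)) ⊗[S] (S ⊗[R] X.Q) ≃ₗ[S] ⋀[S]^4 (S ⊗[R] X.B)) :
    X.IsParityBaseChange S pS ↔ pS = X.parityBaseChange S := by
  constructor
  · intro h
    apply LinearEquiv.toLinearMap_injective
    refine TensorProduct.ext_threefold fun a b c => ?_
    induction a with
    | zero => simp
    | add a a' h h' => simp only [TensorProduct.add_tmul, map_add, h, h']
    | tmul s a =>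
    induction b with
    | zero => simp
    | add a a' h h' => simp only [TensorProduct.add_tmul, TensorProduct.tmul_add, map_add, h, h']
    | tmul t b =>
    induction c with
    | zero => simp
    | add a a' h h' => simp only [TensorProduct.tmul_add, map_add, h, h']
    | tmul v c =>
    have : ∀ {Y : Type u} [AddCommGroup Y] [Module R Y] (s : S) (y : Y),
        s ⊗ₜ[R] y = s • ((1 : S) ⊗ₜ[R] y) := fun s y => by
      rw [TensorProduct.smul_tmul', smul_eq_mul, mul_one]
    rw [this s, this t, this v]
    simp only [TensorProduct.tmul_smul, ← TensorProduct.smul_tmul', map_smul]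
    exact congrArg (fun z => v • t • s • z) ((h a b c).trans (X.parityBaseChange_tmul S a b c).symm)
  · rintro rfl a b c
    exact X.parityBaseChange_tmul S a b c

/-- The base change of `B` with its parity factorization. -/
def ParityRing.extend : ParityRing S :=
  X.baseChange S (X.isQuaternionRing_baseChange S) (X.parityBaseChange S)

variable {X}

/-- The parity formula need not be verified in general: the candidate is compared with the map that
satisfies it, on the generator, which comes from R. -/
theorem IsModel.baseChange {N : TernaryModule R}
    {β : N.M →ₗ[R] N.M →ₗ[R] Module.Dual R N.I →ₗ[R] X.B} {u : N.parityModule ≃ₗ[R] X.P}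
    {v : N.I ≃ₗ[R] X.Q} (h : IsModel N X β u v) {N' : TernaryModule S} (T : BaseChangeData N N') :
    IsModel N' (X.extend S) (T.tri β) (T.parityEquiv.symm ≪≫ₗ u.baseChange R S _ _)
      (T.g.symm ≪≫ₗ v.baseChange R S _ _) where
  isEvenClifford := T.isEvenClifford h.isEvenClifford
  isParity := by
    obtain ⟨p, hp⟩ := exists_parity_linearMap (T.isEvenClifford h.isEvenClifford)
    let w : N'.parityModule ≃ₗ[S] S ⊗[R] X.P := T.parityEquiv.symm ≪≫ₗ u.baseChange R S _ _
    let L : (N'.parityModule ⊗[S] N'.parityModule) ⊗[S] N'.I →ₗ[S] ⋀[S]^4 (S ⊗[R] X.B) :=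
      (X.parityBaseChange S).toLinearMap ∘ₗ
        TensorProduct.map (TensorProduct.map w.toLinearMap w.toLinearMap)
          (T.g.symm ≪≫ₗ v.baseChange R S _ _).toLinearMap
    suffices L = p by
      change IsParity N' (T.tri β) L
      rwa [this]
    refine LinearMap.ext fun x => eq_of_local (span_image_eq_top S N.span_frameSet) ?_
    rintro _ ⟨r, ⟨F⟩, rfl⟩
    refine ⟨11, (parity_total_isFrame₁ (T.frame F)).isFrame.ext L p (fun _ => ?_) x⟩
    rw [hp.apply_gen, (T.frame F).pair, T.quatTop_frame, algebraMap_smul, ← map_smul]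
    have h1 := h.isParity.apply_gen F F.t
    rw [F.pair] at h1
    rw [← h1]
    refine Eq.trans ?_ (X.parityBaseChange_tmul S (u (parityGen F)) (u (parityGen F)) (v F.t))
    have h2 : (T.parityEquiv.symm ≪≫ₗ u.baseChange R S _ _) (parityGen (T.frame F)) =
        1 ⊗ₜ u (parityGen F) := by
      rw [LinearEquiv.trans_apply, T.parityEquiv_symm_gen]
      rfl
    have h3 : (T.g.symm ≪≫ₗ v.baseChange R S _ _) (T.frame F).t = 1 ⊗ₜ v F.t := by
      change v.baseChange R S _ _ (T.g.symm (T.g (1 ⊗ₜ F.t))) = _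
      rw [LinearEquiv.symm_apply_apply]
      rfl
    rw [← h2, ← h3]
    rfl

/-- An isomorphism with `N.parity` is the same as a model structure, and model structures extend to
S. -/
theorem parity_baseChange_isomorphic {N : TernaryModule R}
    (h : ParityRing.Isomorphic N.parity X) :
    ParityRing.Isomorphic (N.baseChange S).parity (X.extend S) := by
  obtain ⟨β, u, v, h⟩ := IsModel.of_isomorphic h
  exact (h.baseChange S (N.baseChangeData S)).isomorphic

end

end TernaryQuaternion

/-- The equivalences such as `IsCanonicalParity p' ↔ p' = p` express existence and uniqueness of the
canonical maps at once. -/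
theorem theoremB :
    ∃ Φ : (R : Type u) → [CommRing R] →
        (TernaryQuaternion.TernaryClass R ≃ TernaryQuaternion.ParityClass R),
      -- `(M,I,q)` goes to `C⁰(M,I,q)` with its canonical parity factorization
      (∀ (R : Type u) [CommRing R] (N : TernaryQuaternion.TernaryModule R),
        ∃ (hP : Module.Invertible R N.parityModule)
          (p : (N.parityModule ⊗[R] N.parityModule) ⊗[R] N.I ≃ₗ[R]
            ⋀[R]^4 (TernaryQuaternion.evenClifford N.q)),
          (∀ p', N.IsCanonicalParity p' ↔ p' = p) ∧
          Φ R (Quotient.mk _ N) = Quotient.mk _ (N.toParityRing hP p)) ∧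
      -- the inverse takes `(B,p)` to `⋀²(B/R) ⊗ P^∨` with the form `φ_B ⊗ p^*`
      (∀ (R : Type u) [CommRing R] (X : TernaryQuaternion.ParityRing R),
        ∃ (h : TernaryQuaternion.IsTernary R X.twistModule X.Q)
          (φ : QuadraticMap R (⋀[R]^2 (TernaryQuaternion.ModScalars R X.B)) (⋀[R]^4 X.B))
          (Ψ : QuadraticMap R X.twistModule X.Q),
          (∀ φ', TernaryQuaternion.IsCanonicalExteriorForm R X.B φ' ↔ φ' = φ) ∧
          (∀ Ψ', X.IsTwist φ Ψ' ↔ Ψ' = Ψ) ∧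
          (Φ R).symm (Quotient.mk _ X) = Quotient.mk _ (X.toTernaryModule h Ψ)) ∧
      -- functoriality in the base ring
      (∀ (R S : Type u) [CommRing R] [CommRing S] [Algebra R S]
        (X : TernaryQuaternion.ParityRing R),
        ∃ (hS : TernaryQuaternion.IsQuaternionRing S (S ⊗[R] X.B))
          (pS : ((S ⊗[R] X.P) ⊗[S] (S ⊗[R] X.P)) ⊗[S] (S ⊗[R] X.Q) ≃ₗ[S]
            ⋀[S]^4 (S ⊗[R] X.B)),
          (∀ pS', X.IsParityBaseChange S pS' ↔ pS' = pS) ∧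
          ∀ N : TernaryQuaternion.TernaryModule R,
            Φ R (Quotient.mk _ N) = Quotient.mk _ X →
            Φ S (Quotient.mk _ (N.baseChange S)) = Quotient.mk _ (X.baseChange S hS pS)) := by
  refine ⟨fun R _ => TernaryQuaternion.classEquiv R, fun R _ N => ?_, fun R _ X => ?_,
    fun R S _ _ _ X => ?_⟩
  · exact ⟨TernaryQuaternion.parityModule_invertible N, TernaryQuaternion.canonicalParity N,
      TernaryQuaternion.isCanonicalParity_iff N, rfl⟩
  · refine ⟨X.isTernary, X.exteriorForm, X.twistForm, fun φ => ⟨fun h => X.exteriorForm_unique h X.exteriorForm_spec, ?_⟩,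
      fun Ψ => ⟨fun h => X.isTwist_unique h X.twistForm_spec, ?_⟩, rfl⟩
    · rintro rfl
      exact X.exteriorForm_spec
    · rintro rfl
      exact X.twistForm_spec
  · refine ⟨X.isQuaternionRing_baseChange S, X.parityBaseChange S, X.isParityBaseChange_iff S,
      fun N h => ?_⟩
    exact Quotient.sound (TernaryQuaternion.parity_baseChange_isomorphic S (Quotient.exact h))
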